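/- **Setting.** Let $d\ge 2$. Let $\mathcal V_{\mathrm d}$ be a space of polynomial vector fields and $\mathcal V_0$ a space of polynomials in $d$ variables, and let $k_u,k_p\ge 0$ be the largest integers with $[\mathbb P_{k_u}]^d\subset\mathcal V_{\mathrm d}$ and $\mathbb P_{k_p}\subset\mathcal V_0$. Let $\ell_u,\ell_p\ge 0$ be polynomial degrees of the two spaces in the following sense: $\mathcal V_0\subset\mathbb Q_{\ell_p}$, and $\mathcal V_{\mathrm d}\subset[\mathbb P_{\ell_u}]^d+x\,\mathbb P_{\ell_u}$ or $\mathcal V_{\mathrm d}\subset[\mathbb Q_{\ell_u}]^d$, where $\mathbb P_k$ and $\mathbb Q_k$ are the polynomials of degree at most $k$ in total and in each variable. (Thus $\ell_u=k_u$, $\ell_p=k_p$ are allowed for the simplicial pairs $\mathbb{RT}_k\times\mathbb P_k$ and $\mathbb{BDM}_{k+1}\times\mathbb P_k$, and $\ell_p=k$ for $\mathcal V_0=\mathbb Q_k$.) Let $\mathcal T_h^{\mathrm{bg}}$ be a finite conforming mesh of convex polytopes, with mesh size $h$ (the largest cell diameter), which is shape-regular (each cell $T$ contains a ball, and each facet of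 $T$ a disc of dimension $d-1$, of radius $\sigma h_T$, where $h_T$ is the diameter of $T$) and quasi-uniform ($h_T\ge\sigma h$), for a fixed $\sigma>0$. Let $\Omega$ be an open set covered by the mesh. The active cells $\mathcal T_h$ are those that meet $\Omega$ (cells are taken open in this classification); an active cell is interior if it is contained in $\Omega$, and cut otherwise. Let $\Omega_h$ be the interior of the closure of the union of the active cells, and let $\Omega^{\mathrm{ext}}\supset\Omega_h$ be open. Each active cell is assigned to a root among the interior cells, an interior cell being its own root, such that each cell is joined to its root by a chain of facet-adjacent cells with that root. The aggregates are the sets of active cells with a common root; their diameters are at most $c_{\mathrm{ag}}h$. For each aggregate $A$ with at least one cut cell let $\mathcal F_A$ be a set of facets, each shared by two cells of $A$, such that every cell of $A$ is joined to the root cell by a path through facets in $\mathcal F_A$; put $\mathcal F_h^{\mathrm{stab}}=\bigcup_A\mathcal F_A$. Let $V_{\mathrm d,h}=\{v\in H(\mathrm{div},\Omega_h): v|_T\in\mathcal V_{\mathrm d}\ \forall T\in\mathcal T_h\}$ and $V_{0,h}=\{q: q|_T\in\mathcal V_0\ \forall T\in\mathcal T_h\}$. Let $\Pi_{\mathrm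 d,h}:[L^2(\Omega_h)]^d\to V_{\mathrm d,h}$ and $\Pi_{0,h}:L^2(\Omega_h)\to V_{0,h}$ be linear projections that commute with the divergence, with $$\|u-\Pi_{\mathrm d,h}u\|_{L^2(\Omega_h)}\le c_\Pi h^r\|u\|_{H^r(\Omega_h)}\ (r=0,\dots,k_u+1),\qquad \|p-\Pi_{0,h}p\|_{L^2(\Omega_h)}\le c_\Pi h^t\|p\|_{H^t(\Omega_h)}\ (t=0,\dots,k_p+1).$$ Consider the face-based ghost-penalty forms $$s_h^{\mathrm d}(u,v)=\sum_{F\in\mathcal F_h^{\mathrm{stab}}}\sum_{j=0}^{\ell_u}h^{2j+1}([D_n^ju],[D_n^jv])_F,\qquad s_h^0(p,q)=\sum_{F\in\mathcal F_h^{\mathrm{stab}}}\sum_{j=0}^{\ell_p}h^{2j+1}([D^jp],[D^jq])_F,$$ where $[\cdot]$ is the jump across $F$, $D_n^j$ is the $j$-th derivative in the direction of the unit normal of $F$ (applied to each component), and $D^j$ is the tensor of all derivatives of order $j$. **Lemma (face-based stabilisation).** There is a constant $C>0$ that depends only on $d,\mathcal V_{\mathrm d},\mathcal V_0,\ell_u,\ell_p,\sigma,c_{\mathrm{ag}},c_\Pi$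 (hence neither on $h$ nor on the position of $\Omega$ relative to the mesh) such that, in every such situation: 1. (Norm equivalence) for all $w_h\in V_{\mathrm d,h}$ and $r_h\in V_{0,h}$, $$C^{-1}\|w_h\|^2_{L^2(\Omega_h)}\le\|w_h\|^2_{L^2(\Omega)}+s_h^{\mathrm d}(w_h,w_h)\le C\|w_h\|^2_{L^2(\Omega_h)},$$ $$C^{-1}\|r_h\|^2_{L^2(\Omega_h)}\le\|r_h\|^2_{L^2(\Omega)}+s_h^0(r_h,r_h)\le C\|r_h\|^2_{L^2(\Omega_h)}.$$ 2. (Weak consistency) for all integers $0\le s\le k_u+1$ and $0\le t\le k_p+1$ and all $w\in[H^s(\Omega^{\mathrm{ext}})]^d$, $r\in H^t(\Omega^{\mathrm{ext}})$, $v_h\in V_{\mathrm d,h}$, $q_h\in V_{0,h}$, $$|s_h^{\mathrm d}(\Pi_{\mathrm d,h}w,v_h)|\le Ch^s\|w\|_{H^s(\Omega^{\mathrm{ext}})}\|v_h\|_{L^2(\Omega_h)},\qquad |s_h^0(\Pi_{0,h}r,q_h)|\le Ch^t\|r\|_{H^t(\Omega^{\mathrm{ext}})}\|q_h\|_{L^2(\Omega_h)}.$$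 3. (Constants) $s_h^0(c,q_h)=0$ for every constant $c$ and every $q_h\in V_{0,h}$. 4. (Kernel approximation) for every integer $0\le t\le k_p+1$ and every $\tilde r\in H^t(\Omega^{\mathrm{ext}})$ there is $w_h\in V_{0,h}$ with $s_h^0(w_h,\phi_h)=0$ for all $\phi_h\in V_{0,h}$ and $\|\tilde r-w_h\|_{L^2(\Omega_h)}\le Ch^t\|\tilde r\|_{H^t(\Omega^{\mathrm{ext}})}$. -/

import Mathlib

open MeasureTheory Set
open scoped ContDiff

namespace UnfittedFEM

/-- The ambient Euclidean space. -/
abbrev E (d : ℕ) : Type := EuclideanSpace ℝ (Fin d)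

/-- Polynomials in `d` variables. -/
abbrev Poly (d : ℕ) : Type := MvPolynomial (Fin d) ℝ

/-- Polynomial vector fields in `d` variables. -/
abbrev VecPoly (d : ℕ) : Type := Fin d → Poly d

/-- The function on the Euclidean space given by a polynomial. -/
noncomputable def polyFun {d : ℕ} (p : Poly d) : E d → ℝ :=
  fun x => MvPolynomial.eval (fun i => x i) p

/-- The vector field on the Euclidean space given by a polynomial vector field. -/
noncomputable def vecPolyFun {d : ℕ} (v : VecPoly d) : E d → E d :=
  fun x => WithLp.toLp 2 (fun i => polyFun (v i) x)

/-- The polynomials of total degree at most `k`. -/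
noncomputable abbrev PP (d k : ℕ) : Submodule ℝ (Poly d) := MvPolynomial.restrictTotalDegree (Fin d) ℝ k

/-- The polynomials of degree at most `k` in each variable. -/
noncomputable abbrev QQ (d k : ℕ) : Submodule ℝ (Poly d) := MvPolynomial.restrictDegree (Fin d) ℝ k

/-- Vector fields all of whose components lie in `P`. -/
def vecOf {d : ℕ} (P : Submodule ℝ (Poly d)) : Set (VecPoly d) :=
  {v | ∀ i, v i ∈ P}

/-- The polynomial vector fields `p + x q` with `p` and `q` of total degree at most `k`. -/
def raviartThomas (d k : ℕ) : Set (VecPoly d) :=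
  {v | ∃ p : VecPoly d, ∃ q : Poly d, p ∈ vecOf (PP d k) ∧ q ∈ PP d k ∧
    ∀ i, v i = p i + MvPolynomial.X i * q}

/-! ### Integer-order Sobolev spaces on an open set, through weak derivatives -/

/-- The `L²` norm over `U`. -/
noncomputable def l2norm {d : ℕ} {F : Type*} [NormedAddCommGroup F] (U : Set (E d))
    (f : E d → F) : ℝ :=
  (eLpNorm f 2 (volume.restrict U)).toReal

/-- `φ` is a smooth function whose support is a compact subset of `U`. -/
def IsTestFunction {d : ℕ} (U : Set (E d)) (φ : E d → ℝ) : Prop :=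
  ContDiff ℝ ∞ φ ∧ HasCompactSupport φ ∧ tsupport φ ⊆ U

/-- The partial derivative in the `i`-th coordinate direction. -/
noncomputable def partialDeriv {d : ℕ} (i : Fin d) (φ : E d → ℝ) : E d → ℝ :=
  fun x => fderiv ℝ φ x (EuclideanSpace.single i 1)

/-- The partial derivative with multi-index `α`. -/
noncomputable def multiDeriv {d : ℕ} (α : Fin d → ℕ) (φ : E d → ℝ) : E d → ℝ :=
  (List.finRange d).foldr (fun i ψ => (partialDeriv i)^[α i] ψ) φ

/-- `g` is the weak derivative of `f` on `U` with multi-index `α`. -/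
def HasWeakDeriv {d : ℕ} (U : Set (E d)) (α : Fin d → ℕ) (f g : E d → ℝ) : Prop :=
  ∀ φ : E d → ℝ, IsTestFunction U φ →
    ∫ x in U, f x * multiDeriv α φ x = (-1) ^ (∑ i, α i) * ∫ x in U, g x * φ x

/-- `f` belongs to the Sobolev space `H^s(U)`. -/
def MemSobolev {d : ℕ} (U : Set (E d)) (s : ℕ) (f : E d → ℝ) : Prop :=
  MemLp f 2 (volume.restrict U) ∧
    ∀ α : Fin d → ℕ, ∑ i, α i ≤ s →
      ∃ g : E d → ℝ, MemLp g 2 (volume.restrict U) ∧ HasWeakDeriv U α f g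

open Classical in
/-- A square-integrable weak derivative of `f` with multi-index `α` (unique almost everywhere in
`U`, whenever there is one). -/
noncomputable def weakDeriv {d : ℕ} (U : Set (E d)) (α : Fin d → ℕ) (f : E d → ℝ) : E d → ℝ :=
  Classical.epsilon fun g => MemLp g 2 (volume.restrict U) ∧ HasWeakDeriv U α f g

/-- The norm of `H^s(U)`: the square root of the sum, over the multi-indices of length at most `s`,
of the squared `L²` norms of the weak derivatives. -/
noncomputable def sobolevNorm {d : ℕ} (U : Set (E d)) (s : ℕ) (f : E d → ℝ) : ℝ :=
  Real.sqrt (∑ j ∈ Finset.range (s + 1), ∑ α ∈ Finset.piAntidiag (Finset.univ : Finset (Fin d)) j,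
    l2norm U (weakDeriv U α f) ^ 2)

/-- `w` belongs to `[H^s(U)]^d`. -/
def MemVecSobolev {d : ℕ} (U : Set (E d)) (s : ℕ) (w : E d → E d) : Prop :=
  ∀ i, MemSobolev U s (fun x => w x i)

/-- The norm of `[H^s(U)]^d`. -/
noncomputable def vecSobolevNorm {d : ℕ} (U : Set (E d)) (s : ℕ) (w : E d → E d) : ℝ :=
  Real.sqrt (∑ i, sobolevNorm U s (fun x => w x i) ^ 2)

/-- `g` is the weak divergence of `v` on `U`. -/
def IsWeakDiv {d : ℕ} (U : Set (E d)) (v : E d → E d) (g : E d → ℝ) : Prop :=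
  ∀ φ : E d → ℝ, IsTestFunction U φ →
    ∫ x in U, inner ℝ (v x) (gradient φ x) = - ∫ x in U, g x * φ x

/-- `v` belongs to `H(div, U)`. -/
def MemHdiv {d : ℕ} (U : Set (E d)) (v : E d → E d) : Prop :=
  MemLp v 2 (volume.restrict U) ∧
    ∃ g : E d → ℝ, MemLp g 2 (volume.restrict U) ∧ IsWeakDiv U v g

/-! ### Background meshes -/

/-- `F` is a facet (a face of codimension one) of the convex polytope `T`. -/
def IsFacet {d : ℕ} (T F : Set (E d)) : Prop :=
  IsExposed ℝ T F ∧ F.Nonempty ∧ Module.finrank ℝ (vectorSpan ℝ F) + 1 = d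

/-- Two distinct cells that share a facet. -/
def FacetAdjacent {d : ℕ} (T T' : Set (E d)) : Prop :=
  T ≠ T' ∧ IsFacet T (T ∩ T') ∧ IsFacet T' (T ∩ T')

/-- A conforming mesh of finitely many convex polytopes with nonempty interior: two distinct cells
meet in a common face of both (which may be empty). The cells are stored as closed sets. -/
structure BackgroundMesh (d : ℕ) where
  cells : Finset (Set (E d))
  polytope : ∀ T ∈ cells,
    (∃ s : Finset (E d), T = convexHull ℝ (s : Set (E d))) ∧ (interior T).Nonempty
  conforming : ∀ T ∈ cells, ∀ T' ∈ cells, T ≠ T' →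
    IsExposed ℝ T (T ∩ T') ∧ IsExposed ℝ T' (T ∩ T')

namespace BackgroundMesh

variable {d : ℕ}

/-- The mesh size: the largest diameter of a cell. -/
noncomputable def size (M : BackgroundMesh d) : ℝ :=
  sSup (Metric.diam '' (M.cells : Set (Set (E d))))

/-- Shape regularity with parameter `σ`: every cell contains a ball, and each of its facets a disc
(a ball of the hyperplane that the facet spans), of radius `σ` times the diameter of the cell. -/
def ShapeRegular (M : BackgroundMesh d) (σ : ℝ) : Prop :=
  ∀ T ∈ M.cells, (∃ c, Metric.closedBall c (σ * Metric.diam T) ⊆ T) ∧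
    ∀ F, IsFacet T F → ∃ c ∈ F,
      Metric.closedBall c (σ * Metric.diam T) ∩ (affineSpan ℝ F : Set (E d)) ⊆ F

/-- Quasi-uniformity with parameter `σ`. -/
def QuasiUniform (M : BackgroundMesh d) (σ : ℝ) : Prop :=
  ∀ T ∈ M.cells, σ * M.size ≤ Metric.diam T

open Classical in
/-- The active cells: those whose interior meets `Ω`. -/
noncomputable def active (M : BackgroundMesh d) (Ω : Set (E d)) : Finset (Set (E d)) :=
  M.cells.filter fun T => (interior T ∩ Ω).Nonempty

open Classical in
/-- The interior cells: the active cells whose interior is contained in `Ω`. -/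
noncomputable def interiorCells (M : BackgroundMesh d) (Ω : Set (E d)) : Finset (Set (E d)) :=
  (M.active Ω).filter fun T => interior T ⊆ Ω

open Classical in
/-- The cut cells: the active cells that are not interior cells. -/
noncomputable def cut (M : BackgroundMesh d) (Ω : Set (E d)) : Finset (Set (E d)) :=
  M.active Ω \ M.interiorCells Ω

/-- The active domain `Ω_h`. -/
def activeDomain (M : BackgroundMesh d) (Ω : Set (E d)) : Set (E d) :=
  interior (closure (⋃ T ∈ M.active Ω, T))

/-- The interior facets of the active mesh that belong to at least one cut cell. -/
def cutFacets (M : BackgroundMesh d) (Ω : Set (E d)) : Set (Set (E d)) :=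
  {F | ∃ T ∈ M.cut Ω, ∃ T' ∈ M.active Ω, FacetAdjacent T T' ∧ F = T ∩ T'}

end BackgroundMesh

/-- The type of active cells. -/
abbrev Active {d : ℕ} (M : BackgroundMesh d) (Ω : Set (E d)) : Type :=
  {T : Set (E d) // T ∈ M.active Ω}

/-! ### Aggregates and the facets used for stabilisation -/

/-- An aggregation of the active mesh: each active cell is given a root among the interior cells,
an interior cell being its own root, and each cell is reached from its root through a chain of
facet-adjacent cells with that root. The aggregates are the sets of active cells with a common
root. -/
structure Aggregation {d : ℕ} (M : BackgroundMesh d) (Ω : Set (E d)) where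
  root : Set (E d) → Set (E d)
  root_mem : ∀ T ∈ M.active Ω, root T ∈ M.interiorCells Ω
  root_inner : ∀ T ∈ M.interiorCells Ω, root T = T
  chain : ∀ T ∈ M.active Ω, Relation.ReflTransGen
    (fun S S' => S' ∈ M.active Ω ∧ root S' = root T ∧ FacetAdjacent S S') (root T) T

namespace Aggregation

variable {d : ℕ} {M : BackgroundMesh d} {Ω : Set (E d)}

open Classical in
/-- The cells of the aggregate with root cell `K`. -/
noncomputable def aggregate (A : Aggregation M Ω) (K : Set (E d)) : Finset (Set (E d)) :=
  (M.active Ω).filter fun T => A.root T = K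

/-- All aggregates have diameter at most `c` times the mesh size. -/
def DiamBounded (A : Aggregation M Ω) (c : ℝ) : Prop :=
  ∀ K ∈ M.interiorCells Ω, Metric.diam (⋃ T ∈ A.aggregate K, T) ≤ c * M.size

open Classical in
/-- The roots of the nontrivial aggregates, i.e. of those containing at least one cut cell. -/
noncomputable def boundaryRoots (A : Aggregation M Ω) : Finset (Set (E d)) :=
  (M.interiorCells Ω).filter fun K => ∃ T ∈ M.cut Ω, A.root T = K

/-- `FA K` is an admissible set of facets for each nontrivial aggregate, `K` being its root cell:
it consists of facets from `F_h^cut`, each shared by two cells of the aggregate, and joins every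
cell of the aggregate to the root cell through a path. -/
def IsFacetSelection (A : Aggregation M Ω) (FA : Set (E d) → Finset (Set (E d))) : Prop :=
  ∀ K ∈ A.boundaryRoots,
    (∀ F ∈ FA K, F ∈ M.cutFacets Ω ∧
      ∃ T ∈ A.aggregate K, ∃ T' ∈ A.aggregate K, FacetAdjacent T T' ∧ F = T ∩ T') ∧
    ∀ T ∈ A.aggregate K, Relation.ReflTransGen
      (fun S S' => S ∈ A.aggregate K ∧ S' ∈ A.aggregate K ∧ FacetAdjacent S S' ∧
        S ∩ S' ∈ FA K) K T

open Classical in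
/-- The set `F_h^stab` of facets that carry the stabilisation. -/
noncomputable def stabFacets (A : Aggregation M Ω) (FA : Set (E d) → Finset (Set (E d))) :
    Finset (Set (E d)) :=
  A.boundaryRoots.biUnion FA

end Aggregation

/-! ### Discrete spaces

A discrete function is stored as the family of polynomials that represent it on the active cells. -/

/-- Scalar piecewise polynomials on the active mesh. -/
abbrev PwPoly {d : ℕ} (M : BackgroundMesh d) (Ω : Set (E d)) : Type := Active M Ω → Poly d

/-- Piecewise polynomial vector fields on the active mesh. -/
abbrev PwVecPoly {d : ℕ} (M : BackgroundMesh d) (Ω : Set (E d)) : Type := Active M Ω → VecPoly d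

section Discrete

variable {d : ℕ} {M : BackgroundMesh d} {Ω : Set (E d)}

/-- The function (zero on the null set of points outside the interiors of the active cells, and
outside the active domain) given by a scalar piecewise polynomial. -/
noncomputable def pwFun (q : PwPoly M Ω) : E d → ℝ :=
  fun x => ∑ T : Active M Ω, (interior T.1).indicator (polyFun (q T)) x

/-- The vector field given by a piecewise polynomial vector field. -/
noncomputable def pwVecFun (v : PwVecPoly M Ω) : E d → E d :=
  fun x => ∑ T : Active M Ω, (interior T.1).indicator (vecPolyFun (v T)) x

variable (M Ω)

/-- The discrete pressure space `V_{0,h}` with local space `V0`. -/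
def pressureSpace (V0 : Submodule ℝ (Poly d)) : Set (PwPoly M Ω) :=
  {q | ∀ T, q T ∈ V0}

/-- The discrete flux space `V_{d,h}` with local space `Vd`: the fields in `H(div, Ω_h)` whose
restriction to each active cell belongs to `Vd`. -/
def fluxSpace (Vd : Submodule ℝ (VecPoly d)) : Set (PwVecPoly M Ω) :=
  {v | (∀ T, v T ∈ Vd) ∧ MemHdiv (M.activeDomain Ω) (pwVecFun v)}

/-- `Pd` and `P0` are bounded cochain projections onto the discrete spaces: linear projections that
commute with the divergence and have the approximation properties in `L²(Ω_h)` up to the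
orders `ku + 1` and `kp + 1`, with constant `c`; order zero is the boundedness in `L²(Ω_h)`.
(The maps are only constrained on functions that are square-integrable on `Ω_h`.) -/
structure IsCochainInterpolation (Vd : Submodule ℝ (VecPoly d)) (V0 : Submodule ℝ (Poly d))
    (ku kp : ℕ) (c : ℝ)
    (Pd : (E d → E d) →ₗ[ℝ] PwVecPoly M Ω) (P0 : (E d → ℝ) →ₗ[ℝ] PwPoly M Ω) : Prop where
  mem_flux : ∀ u, MemLp u 2 (volume.restrict (M.activeDomain Ω)) → Pd u ∈ fluxSpace M Ω Vd
  mem_pressure : ∀ p, MemLp p 2 (volume.restrict (M.activeDomain Ω)) →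
    P0 p ∈ pressureSpace M Ω V0
  proj_flux : ∀ v ∈ fluxSpace M Ω Vd, Pd (pwVecFun v) = v
  proj_pressure : ∀ q ∈ pressureSpace M Ω V0, P0 (pwFun q) = q
  commute : ∀ u g, MemLp u 2 (volume.restrict (M.activeDomain Ω)) →
    MemLp g 2 (volume.restrict (M.activeDomain Ω)) → IsWeakDiv (M.activeDomain Ω) u g →
    IsWeakDiv (M.activeDomain Ω) (pwVecFun (Pd u)) (pwFun (P0 g))
  approx_flux : ∀ r ≤ ku + 1, ∀ u, MemVecSobolev (M.activeDomain Ω) r u →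
    l2norm (M.activeDomain Ω) (fun x => u x - pwVecFun (Pd u) x) ≤
      c * M.size ^ r * vecSobolevNorm (M.activeDomain Ω) r u
  approx_pressure : ∀ t ≤ kp + 1, ∀ p, MemSobolev (M.activeDomain Ω) t p →
    l2norm (M.activeDomain Ω) (fun x => p x - pwFun (P0 p) x) ≤
      c * M.size ^ t * sobolevNorm (M.activeDomain Ω) t p

/-! ### The stabilisation properties -/

/-- The assumptions on the stabilisation forms `sd` and `s0`, all with the constant `C`: norm
equivalence, weak consistency, and vanishing of `s0` on constants. -/
structure StabilisationAssumption (Vd : Submodule ℝ (VecPoly d)) (V0 : Submodule ℝ (Poly d))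
    (ku kp : ℕ) (Ωext : Set (E d))
    (Pd : (E d → E d) →ₗ[ℝ] PwVecPoly M Ω) (P0 : (E d → ℝ) →ₗ[ℝ] PwPoly M Ω)
    (sd : PwVecPoly M Ω → PwVecPoly M Ω → ℝ) (s0 : PwPoly M Ω → PwPoly M Ω → ℝ)
    (C : ℝ) : Prop where
  flux_le : ∀ w ∈ fluxSpace M Ω Vd,
    l2norm Ω (pwVecFun w) ^ 2 + sd w w ≤ C * l2norm (M.activeDomain Ω) (pwVecFun w) ^ 2
  flux_ge : ∀ w ∈ fluxSpace M Ω Vd,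
    l2norm (M.activeDomain Ω) (pwVecFun w) ^ 2 ≤ C * (l2norm Ω (pwVecFun w) ^ 2 + sd w w)
  pressure_le : ∀ r ∈ pressureSpace M Ω V0,
    l2norm Ω (pwFun r) ^ 2 + s0 r r ≤ C * l2norm (M.activeDomain Ω) (pwFun r) ^ 2
  pressure_ge : ∀ r ∈ pressureSpace M Ω V0,
    l2norm (M.activeDomain Ω) (pwFun r) ^ 2 ≤ C * (l2norm Ω (pwFun r) ^ 2 + s0 r r)
  flux_consistency : ∀ s ≤ ku + 1, ∀ w, MemVecSobolev Ωext s w → ∀ v ∈ fluxSpace M Ω Vd,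
    |sd (Pd w) v| ≤
      C * M.size ^ s * vecSobolevNorm Ωext s w * l2norm (M.activeDomain Ω) (pwVecFun v)
  pressure_consistency : ∀ t ≤ kp + 1, ∀ r, MemSobolev Ωext t r → ∀ q ∈ pressureSpace M Ω V0,
    |s0 (P0 r) q| ≤
      C * M.size ^ t * sobolevNorm Ωext t r * l2norm (M.activeDomain Ω) (pwFun q)
  pressure_const : ∀ a : ℝ, ∀ q ∈ pressureSpace M Ω V0,
    s0 (fun _ => MvPolynomial.C a) q = 0

/-- The kernel of the pressure stabilisation `s0` in the discrete pressure space. -/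
def pressureKernel (V0 : Submodule ℝ (Poly d)) (s0 : PwPoly M Ω → PwPoly M Ω → ℝ) :
    Set (PwPoly M Ω) :=
  {q | q ∈ pressureSpace M Ω V0 ∧ ∀ φ ∈ pressureSpace M Ω V0, s0 q φ = 0}

/-- The approximation property of the kernel of `s0`, with the constant `C`. -/
def KernelApproximation (V0 : Submodule ℝ (Poly d)) (kp : ℕ) (Ωext : Set (E d))
    (s0 : PwPoly M Ω → PwPoly M Ω → ℝ) (C : ℝ) : Prop :=
  ∀ t ≤ kp + 1, ∀ r, MemSobolev Ωext t r → ∃ w ∈ pressureKernel M Ω V0 s0,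
    l2norm (M.activeDomain Ω) (fun x => r x - pwFun w x) ≤ C * M.size ^ t * sobolevNorm Ωext t r

variable {M Ω}

/-! ### The face-based forms -/

open Classical in
/-- A unit normal of `F`. Its sign is irrelevant below. -/
noncomputable def unitNormal (F : Set (E d)) : E d :=
  Classical.epsilon fun n => ‖n‖ = 1 ∧ n ∈ (vectorSpan ℝ F)ᗮ

/-- The jump, from the cell `T'` to the cell `T`, of the `j`-th derivative in direction `n` of a
piecewise polynomial vector field. -/
noncomputable def normalJump (n : E d) (j : ℕ) (v : PwVecPoly M Ω) (T T' : Active M Ω) (x : E d) :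
    E d :=
  iteratedFDeriv ℝ j (vecPolyFun (v T)) x (fun _ => n) -
    iteratedFDeriv ℝ j (vecPolyFun (v T')) x (fun _ => n)

/-- The jump, from the cell `T'` to the cell `T`, of the component with indices `I` of the tensor of
`j`-th derivatives of a scalar piecewise polynomial. -/
noncomputable def fullJump {j : ℕ} (I : Fin j → Fin d) (q : PwPoly M Ω) (T T' : Active M Ω)
    (x : E d) : ℝ :=
  iteratedFDeriv ℝ j (polyFun (q T)) x (fun a => EuclideanSpace.single (I a) 1) -
    iteratedFDeriv ℝ j (polyFun (q T')) x (fun a => EuclideanSpace.single (I a) 1)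

open Classical in
/-- The integral over the interior facet `F` of an expression `f T T'` in the two cells sharing `F`
that does not depend on their order. The two cells are distinct active cells that meet in `F`;
they form exactly two ordered pairs, hence the factor `1 / 2`. -/
noncomputable def facetIntegral (F : Set (E d)) (f : Active M Ω → Active M Ω → E d → ℝ) : ℝ :=
  (1 / 2) * ∑ p : Active M Ω × Active M Ω with p.1 ≠ p.2 ∧ p.1.1 ∩ p.2.1 = F,
    ∫ x in F, f p.1 p.2 x ∂(Measure.euclideanHausdorffMeasure (d - 1))

/-- The face-based flux stabilisation over the facets in `Fs`, with normal derivatives up to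
order `m`. -/
noncomputable def faceFluxForm (Fs : Finset (Set (E d))) (m : ℕ) (u v : PwVecPoly M Ω) : ℝ :=
  ∑ F ∈ Fs, ∑ j ∈ Finset.range (m + 1), M.size ^ (2 * j + 1) *
    facetIntegral F fun T T' x =>
      inner ℝ (normalJump (unitNormal F) j u T T' x) (normalJump (unitNormal F) j v T T' x)

/-- The face-based pressure stabilisation over the facets in `Fs`, with all derivatives up to
order `m`. -/
noncomputable def facePressureForm (Fs : Finset (Set (E d))) (m : ℕ) (p q : PwPoly M Ω) : ℝ :=
  ∑ F ∈ Fs, ∑ j ∈ Finset.range (m + 1), M.size ^ (2 * j + 1) *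
    facetIntegral F fun T T' x =>
      ∑ I : Fin j → Fin d, fullJump I p T T' x * fullJump I q T T' x

end Discrete

end UnfittedFEM

namespace UnfittedFEM

/-! ### Polynomial functions -/

section PolynomialFunctions

variable {d : ℕ}

theorem polyFun_contDiff (p : Poly d) {n : WithTop ℕ∞} : ContDiff ℝ n (polyFun p) := by
  unfold polyFun
  induction p using MvPolynomial.induction_on with
  | C a => simpa using contDiff_const
  | add p q hp hq => simpa using hp.add hq
  | mul_X p i hp =>
    simp only [map_mul, MvPolynomial.eval_X]
    exact hp.mul (by fun_prop)

theorem polyFun_continuous (p : Poly d) : Continuous (polyFun p) :=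
  (polyFun_contDiff p (n := 0)).continuous

theorem polyFun_add (p q : Poly d) : polyFun (p + q) = polyFun p + polyFun q := by
  ext x; simp [polyFun]

theorem polyFun_sub (p q : Poly d) : polyFun (p - q) = polyFun p - polyFun q := by
  ext x; simp [polyFun]

theorem polyFun_smul (a : ℝ) (p : Poly d) : polyFun (a • p) = a • polyFun p := by
  ext x; simp [polyFun]

theorem polyFun_zero : polyFun (0 : Poly d) = 0 := by
  ext x; simp [polyFun]

theorem polyFun_sum {ι : Type*} (s : Finset ι) (p : ι → Poly d) :
    polyFun (∑ i ∈ s, p i) = ∑ i ∈ s, polyFun (p i) := by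
  ext x; simp [polyFun]

/-- The derivative of order `j` of a polynomial in the directions `u`. -/
noncomputable def dirDeriv (p : Poly d) (j : ℕ) (x : E d) (u : Fin j → E d) : ℝ :=
  iteratedFDeriv ℝ j (polyFun p) x u

theorem dirDeriv_add (p q : Poly d) (j : ℕ) (x : E d) (u : Fin j → E d) :
    dirDeriv (p + q) j x u = dirDeriv p j x u + dirDeriv q j x u := by
  simp only [dirDeriv, polyFun_add]
  rw [iteratedFDeriv_add_apply (polyFun_contDiff p).contDiffAt (polyFun_contDiff q).contDiffAt]
  rfl

theorem dirDeriv_smul (a : ℝ) (p : Poly d) (j : ℕ) (x : E d) (u : Fin j → E d) :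
    dirDeriv (a • p) j x u = a * dirDeriv p j x u := by
  simp only [dirDeriv, polyFun_smul]
  rw [iteratedFDeriv_const_smul_apply (polyFun_contDiff p).contDiffAt]
  rfl

theorem dirDeriv_sub (p q : Poly d) (j : ℕ) (x : E d) (u : Fin j → E d) :
    dirDeriv (p - q) j x u = dirDeriv p j x u - dirDeriv q j x u := by
  have : p - q = p + (-1 : ℝ) • q := by simp [sub_eq_add_neg]
  rw [this, dirDeriv_add, dirDeriv_smul]; ring

theorem dirDeriv_sum {ι : Type*} (s : Finset ι) (p : ι → Poly d) (j : ℕ) (x : E d)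
    (u : Fin j → E d) : dirDeriv (∑ i ∈ s, p i) j x u = ∑ i ∈ s, dirDeriv (p i) j x u := by
  classical
  induction s using Finset.induction_on with
  | empty =>
    have := dirDeriv_smul 0 (0 : Poly d) j x u
    simpa using this
  | insert i s hi ih => rw [Finset.sum_insert hi, Finset.sum_insert hi, dirDeriv_add, ih]

theorem dirDeriv_continuous (p : Poly d) (j : ℕ) :
    Continuous fun z : E d × (Fin j → E d) => dirDeriv p j z.1 z.2 := by
  have h : Continuous (iteratedFDeriv ℝ j (polyFun p)) :=
    (polyFun_contDiff p (n := j)).continuous_iteratedFDeriv le_rfl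
  unfold dirDeriv
  have h2 : Continuous fun z : E d × (Fin j → E d) =>
    ((iteratedFDeriv ℝ j (polyFun p) z.1, z.2) :
      ContinuousMultilinearMap ℝ (fun _ : Fin j => E d) ℝ × (Fin j → E d)) :=
    (h.comp continuous_fst).prodMk continuous_snd
  exact h2.fst.eval h2.snd

theorem dirDeriv_zero_order (p : Poly d) (x : E d) (u : Fin 0 → E d) :
    dirDeriv p 0 x u = polyFun p x := by
  simp [dirDeriv]

/-- Derivatives of the composition with an affine map. -/
theorem iteratedFDeriv_comp_affine {V F : Type*} [NormedAddCommGroup V] [NormedSpace ℝ V]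
    [NormedAddCommGroup F] [NormedSpace ℝ F] {f : E d → F} (hf : ContDiff ℝ ∞ f)
    (b : E d) (L : V →L[ℝ] E d) (j : ℕ) (y : V) (u : Fin j → V) :
    iteratedFDeriv ℝ j (fun y => f (b + L y)) y u =
      iteratedFDeriv ℝ j f (b + L y) (fun k => L (u k)) := by
  have hg : ContDiff ℝ ∞ (fun z => f (b + z)) := hf.comp (contDiff_const.add contDiff_id)
  have := L.iteratedFDeriv_comp_right hg y (i := j) (by exact_mod_cast le_top)
  have h2 : (fun z => f (b + z)) ∘ L = fun y => f (b + L y) := rfl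
  rw [← h2, this, iteratedFDeriv_comp_add_left]
  rfl

/-- The substitution `x ↦ b + h x`. -/
noncomputable def affSub (b : E d) (h : ℝ) : Poly d →ₐ[ℝ] Poly d :=
  MvPolynomial.aeval fun i => MvPolynomial.C (b i) + MvPolynomial.C h * MvPolynomial.X i

theorem polyFun_affSub (b : E d) (h : ℝ) (p : Poly d) (y : E d) :
    polyFun (affSub b h p) y = polyFun p (b + h • y) := by
  unfold polyFun affSub
  induction p using MvPolynomial.induction_on with
  | C a => simp
  | add p q hp hq => rw [map_add, map_add, map_add, hp, hq]
  | mul_X p i hp => rw [map_mul, map_mul, map_mul, hp]; simp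

theorem dirDeriv_affSub (b : E d) (h : ℝ) (p : Poly d) (j : ℕ) (y : E d) (u : Fin j → E d) :
    dirDeriv (affSub b h p) j y u = h ^ j * dirDeriv p j (b + h • y) u := by
  have h1 : polyFun (affSub b h p) =
      fun y => polyFun p (b + (h • ContinuousLinearMap.id ℝ (E d)) y) := by
    ext y; simp [polyFun_affSub]
  have := iteratedFDeriv_comp_affine (polyFun_contDiff p) b (h • ContinuousLinearMap.id ℝ (E d)) j y u
  unfold dirDeriv
  rw [h1, this]
  simp only [_root_.smul_apply, ContinuousLinearMap.id_apply]
  rw [ContinuousMultilinearMap.map_smul_univ]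
  simp

theorem totalDegree_affSub_le (b : E d) (h : ℝ) (p : Poly d) :
    (affSub b h p).totalDegree ≤ p.totalDegree := by
  have hX : ∀ i : Fin d, (MvPolynomial.C (b i) + MvPolynomial.C h * MvPolynomial.X i :
      Poly d).totalDegree ≤ 1 := fun i => by
    refine (MvPolynomial.totalDegree_add _ _).trans (max_le (by simp) ?_)
    refine (MvPolynomial.totalDegree_mul _ _).trans ?_
    simp [MvPolynomial.totalDegree_X]
  unfold affSub
  rw [MvPolynomial.aeval_def, MvPolynomial.eval₂]
  refine MvPolynomial.totalDegree_finsetSum_le fun s hs => ?_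
  refine (MvPolynomial.totalDegree_mul _ _).trans ?_
  simp only [MvPolynomial.algebraMap_eq, MvPolynomial.totalDegree_C, zero_add]
  refine (MvPolynomial.totalDegree_finsetProd _ _).trans ?_
  refine le_trans (Finset.sum_le_sum fun i _ => (MvPolynomial.totalDegree_pow _ _).trans
    (Nat.mul_le_mul_left _ (hX i))) ?_
  simp only [mul_one]
  exact MvPolynomial.le_totalDegree hs

theorem affSub_mem_PP {N : ℕ} (b : E d) (h : ℝ) {p : Poly d} (hp : p ∈ PP d N) :
    affSub b h p ∈ PP d N := by
  rw [MvPolynomial.mem_restrictTotalDegree] at hp ⊢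
  exact (totalDegree_affSub_le b h p).trans hp

theorem mem_QQ_iff {m : ℕ} {p : Poly d} : p ∈ QQ d m ↔ ∀ i, p.degreeOf i ≤ m := by
  rw [MvPolynomial.mem_restrictDegree]
  constructor
  · intro h i
    rw [MvPolynomial.degreeOf_le_iff]
    exact fun s hs => h s hs i
  · intro h s hs i
    exact (MvPolynomial.degreeOf_le_iff.mp (h i)) s hs

theorem affSub_mem_QQ {m : ℕ} (b : E d) (h : ℝ) {p : Poly d} (hp : p ∈ QQ d m) :
    affSub b h p ∈ QQ d m := by
  classical
  rw [mem_QQ_iff]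
  intro k
  have hX : ∀ i : Fin d, (MvPolynomial.C (b i) + MvPolynomial.C h * MvPolynomial.X i :
      Poly d).degreeOf k ≤ if i = k then 1 else 0 := fun i => by
    refine (MvPolynomial.degreeOf_add_le _ _ _).trans (max_le (by simp [MvPolynomial.degreeOf_C]) ?_)
    refine (MvPolynomial.degreeOf_C_mul_le _ _ _).trans ?_
    rw [MvPolynomial.degreeOf_X]
    split_ifs with h1 h2 <;> simp_all
  unfold affSub
  rw [MvPolynomial.aeval_def, MvPolynomial.eval₂]
  refine (MvPolynomial.degreeOf_sum_le _ _ _).trans (Finset.sup_le fun s hs => ?_)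
  refine (MvPolynomial.degreeOf_C_mul_le _ _ _).trans ?_
  refine (MvPolynomial.degreeOf_prod_le _ _ _).trans ?_
  refine le_trans (Finset.sum_le_sum fun i _ => (MvPolynomial.degreeOf_pow_le _ _ _).trans
    (Nat.mul_le_mul_left _ (hX i))) ?_
  refine le_trans ?_ ((MvPolynomial.mem_restrictDegree _ _ _).mp hp s hs k)
  calc ∑ i ∈ s.support, s i * (if i = k then 1 else 0)
      ≤ ∑ i : Fin d, s i * (if i = k then 1 else 0) :=
        Finset.sum_le_sum_of_subset (Finset.subset_univ _)
    _ = s k := by simp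

/-- A polynomial that vanishes on a ball is zero. -/
theorem eq_zero_of_polyFun_eq_zero {p : Poly d} {c : E d} {r : ℝ} (hr : 0 < r)
    (h : ∀ x ∈ Metric.closedBall c r, polyFun p x = 0) : p = 0 := by
  have hmem : ∀ᶠ y : Fin d → ℝ in nhds (fun i => c i),
      WithLp.toLp 2 y ∈ Metric.closedBall c r := by
    have : Filter.Tendsto (fun y : Fin d → ℝ => (WithLp.toLp 2 y : E d)) (nhds fun i => c i)
        (nhds c) := by
      have := (PiLp.continuous_toLp 2 (fun _ : Fin d => ℝ)).tendsto (fun i => c i)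
      simpa using this
    exact this (Metric.closedBall_mem_nhds c hr)
  obtain ⟨ε, hε, hball⟩ := Metric.eventually_nhds_iff_ball.mp hmem
  refine MvPolynomial.funext_set (fun i => Metric.ball (c i) ε) (fun i => ?_) fun y hy => ?_
  · rw [Real.ball_eq_Ioo]
    exact Set.Ioo_infinite (by linarith)
  · have hy' : y ∈ Metric.ball (fun i => c i) ε := by
      rw [ball_pi _ hε]; exact hy
    have := h _ (hball y hy')
    simpa [polyFun] using this

end PolynomialFunctions

/-! ### Bounds between homogeneous functions on finite-dimensional spaces -/

/-- Two continuous functions that are homogeneous of degree two on a finite-dimensional space, with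
parameters in a compact set: the first is bounded by the second if the second is definite. -/
theorem exists_le_mul_of_compact {V : Type*} [AddCommGroup V] [Module ℝ V] [FiniteDimensional ℝ V]
    {X : Type*} [TopologicalSpace X] {K : Set X} (hK : IsCompact K) (f g : X → V → ℝ)
    (hf : ∀ n (b : Fin n → V), Continuous fun z : X × (Fin n → ℝ) => f z.1 (∑ k, z.2 k • b k))
    (hg : ∀ n (b : Fin n → V), Continuous fun z : X × (Fin n → ℝ) => g z.1 (∑ k, z.2 k • b k))
    (hf2 : ∀ x (t : ℝ) v, f x (t • v) = t ^ 2 * f x v)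
    (hg2 : ∀ x (t : ℝ) v, g x (t • v) = t ^ 2 * g x v)
    (hpos : ∀ x ∈ K, ∀ v, v ≠ 0 → 0 < g x v) :
    ∃ C : ℝ, 0 < C ∧ ∀ x ∈ K, ∀ v, f x v ≤ C * g x v := by
  set n := Module.finrank ℝ V
  let b := Module.finBasis ℝ V
  have hrep : ∀ v, ∑ k, b.equivFun v k • b k = v := fun v => b.sum_equivFun v
  have hS : IsCompact (K ×ˢ Metric.sphere (0 : Fin n → ℝ) 1) := hK.prod (isCompact_sphere _ _)
  have hne : ∀ a : Fin n → ℝ, a ∈ Metric.sphere (0 : Fin n → ℝ) 1 → ∑ k, a k • b k ≠ 0 := by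
    intro a ha h0
    have : a = 0 := by
      apply b.equivFun.symm.injective
      rw [b.equivFun_symm_apply, h0, map_zero]
    simp [this] at ha
  have hc : ContinuousOn (fun z : X × (Fin n → ℝ) =>
      f z.1 (∑ k, z.2 k • b k) / g z.1 (∑ k, z.2 k • b k))
      (K ×ˢ Metric.sphere (0 : Fin n → ℝ) 1) := by
    refine (hf n b).continuousOn.div (hg n b).continuousOn fun z hz => ?_
    exact (hpos z.1 hz.1 _ (hne _ hz.2)).ne'
  obtain ⟨C, hC⟩ := (hS.image_of_continuousOn hc).bddAbove
  refine ⟨max C 1, by positivity, fun x hx v => ?_⟩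
  by_cases hv : v = 0
  · have h1 := hf2 x 0 0
    have h2 := hg2 x 0 0
    simp only [smul_zero, ne_eq, OfNat.ofNat_ne_zero, not_false_eq_true, zero_pow, zero_mul]
      at h1 h2
    simp [hv, h1, h2]
  · set a := b.equivFun v with ha
    have ha0 : a ≠ 0 := by simpa [ha] using hv
    have hna : ‖a‖ ≠ 0 := norm_ne_zero_iff.mpr ha0
    set a' := ‖a‖⁻¹ • a
    have ha' : a' ∈ Metric.sphere (0 : Fin n → ℝ) 1 := by
      simp [a', norm_smul, hna]
    have hv' : v = ‖a‖ • ∑ k, a' k • b k := by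
      rw [Finset.smul_sum]
      conv_lhs => rw [← hrep v]
      refine Finset.sum_congr rfl fun k _ => ?_
      simp [a', smul_smul, hna, ← ha]
    have hgp := hpos x hx _ (hne _ ha')
    have hq : f x (∑ k, a' k • b k) / g x (∑ k, a' k • b k) ≤ max C 1 :=
      (hC ⟨(x, a'), ⟨hx, ha'⟩, rfl⟩).trans (le_max_left _ _)
    rw [div_le_iff₀ hgp] at hq
    rw [hv', hf2, hg2]
    calc ‖a‖ ^ 2 * f x (∑ k, a' k • b k) ≤ ‖a‖ ^ 2 * (max C 1 * g x (∑ k, a' k • b k)) := by gcongr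
      _ = _ := by ring

end UnfittedFEM

namespace UnfittedFEM

section Lines

variable {d : ℕ}

/-- The restriction of a polynomial to the line `t ↦ a + t b`. -/
noncomputable def linePoly (a b : E d) : Poly d →ₐ[ℝ] Polynomial ℝ :=
  MvPolynomial.aeval fun i => Polynomial.C (a i) + Polynomial.C (b i) * Polynomial.X

theorem eval_linePoly (a b : E d) (p : Poly d) (t : ℝ) :
    (linePoly a b p).eval t = polyFun p (a + t • b) := by
  unfold polyFun linePoly
  induction p using MvPolynomial.induction_on with
  | C a => simp
  | add p q hp hq => rw [map_add, map_add, Polynomial.eval_add, hp, hq]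
  | mul_X p i hp => rw [map_mul, map_mul, Polynomial.eval_mul, hp]; simp; left; ring

theorem natDegree_line_le (x y : ℝ) :
    (Polynomial.C x + Polynomial.C y * Polynomial.X).natDegree ≤ 1 := by
  rw [add_comm]; exact Polynomial.natDegree_linear_le

theorem natDegree_linePoly_le (a b : E d) {m : ℕ} {p : Poly d} (hp : p ∈ PP d m) :
    (linePoly a b p).natDegree ≤ m := by
  have := MvPolynomial.aeval_natDegree_le (m := m) (n := 1) p
    ((MvPolynomial.mem_restrictTotalDegree _ _ _).mp hp)
    (fun i => Polynomial.C (a i) + Polynomial.C (b i) * Polynomial.X)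
    (fun i => natDegree_line_le _ _)
  simpa [linePoly] using this

theorem natDegree_linePoly_single_le (a : E d) (k : Fin d) {m : ℕ} {p : Poly d}
    (hp : p ∈ QQ d m) : (linePoly a (EuclideanSpace.single k 1) p).natDegree ≤ m := by
  classical
  unfold linePoly
  rw [MvPolynomial.aeval_def, MvPolynomial.eval₂]
  refine (Polynomial.natDegree_sum_le _ _).trans (Finset.sup_le fun s hs => ?_)
  simp only [Function.comp_apply, ← Polynomial.C_eq_algebraMap]
  refine (Polynomial.natDegree_C_mul_le _ _).trans ?_
  refine (Polynomial.natDegree_prod_le _ _).trans ?_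
  refine le_trans (Finset.sum_le_sum (g := fun i => s i * (if i = k then 1 else 0)) fun i _ => ?_) ?_
  · refine Polynomial.natDegree_pow_le.trans (Nat.mul_le_mul_left _ ?_)
    split_ifs with h
    · exact natDegree_line_le _ _
    · simp [h]
  · refine le_trans ?_ ((MvPolynomial.mem_restrictDegree _ _ _).mp hp s hs k)
    calc ∑ i ∈ s.support, s i * (if i = k then 1 else 0)
        ≤ ∑ i : Fin d, s i * (if i = k then 1 else 0) :=
          Finset.sum_le_sum_of_subset (Finset.subset_univ _)
      _ = s k := by simp

theorem iteratedDeriv_polynomial (g : Polynomial ℝ) (j : ℕ) :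
    iteratedDeriv j (fun t => g.eval t) = fun t => (Polynomial.derivative^[j] g).eval t := by
  induction j with
  | zero => simp
  | succ j ih =>
    rw [iteratedDeriv_succ, ih]
    ext t
    rw [Polynomial.deriv, Function.iterate_succ_apply']

theorem dirDeriv_eq_coeff_linePoly (a b : E d) (p : Poly d) (j : ℕ) :
    dirDeriv p j a (fun _ => b) = j.factorial * (linePoly a b p).coeff j := by
  have h := iteratedFDeriv_comp_affine (polyFun_contDiff p) a
    (ContinuousLinearMap.toSpanSingleton ℝ b) j (0 : ℝ) (fun _ => 1)
  have h1 : (fun t : ℝ => polyFun p (a + ContinuousLinearMap.toSpanSingleton ℝ b t)) =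
      fun t => (linePoly a b p).eval t := by
    ext t; simp [eval_linePoly]
  rw [h1, ← iteratedDeriv_eq_iteratedFDeriv, iteratedDeriv_polynomial] at h
  simp only [ContinuousLinearMap.toSpanSingleton_apply, one_smul, zero_smul, add_zero] at h
  rw [dirDeriv, ← h, ← Polynomial.coeff_zero_eq_eval_zero, Polynomial.coeff_iterate_derivative]
  simp [Nat.descFactorial_self]

theorem coeff_eq_zero_of_abs_eval_le {g : Polynomial ℝ} {m : ℕ} {C : ℝ}
    (h : ∀ t : ℝ, |t| ≤ 1 → |g.eval t| ≤ C * |t| ^ (m + 1)) :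
    ∀ k ≤ m, g.coeff k = 0 := by
  intro k
  induction k using Nat.strong_induction_on with
  | _ k ih =>
    intro hk
    obtain ⟨q, hq⟩ := Polynomial.X_pow_dvd_iff.mpr fun i hi => ih i hi (hi.le.trans hk)
    have hC : 0 ≤ C := by
      have := h 1 (by simp)
      simp only [abs_one, one_pow, mul_one] at this
      exact (abs_nonneg _).trans this
    have hb : ∀ t : ℝ, t ≠ 0 → |t| ≤ 1 → |q.eval t| ≤ C * |t| := by
      intro t ht ht1
      have h1 := h t ht1
      have hp : 0 < |t| := abs_pos.mpr ht
      rw [hq, Polynomial.eval_mul, Polynomial.eval_pow, Polynomial.eval_X, abs_mul, abs_pow] at h1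
      have h2 : |t| ^ (m + 1) ≤ |t| ^ k * |t| := by
        rw [← pow_succ]
        exact pow_le_pow_of_le_one hp.le ht1 (by omega)
      have h3 : |t| ^ k * |q.eval t| ≤ |t| ^ k * (C * |t|) := by
        calc _ ≤ C * |t| ^ (m + 1) := h1
          _ ≤ C * (|t| ^ k * |t|) := by gcongr
          _ = _ := by ring
      exact le_of_mul_le_mul_left h3 (by positivity)
    have hlim : Filter.Tendsto (fun t : ℝ => |q.eval t|) (nhdsWithin 0 {0}ᶜ) (nhds |q.eval 0|) :=
      (q.continuous.abs.tendsto 0).mono_left nhdsWithin_le_nhds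
    have hlim2 : Filter.Tendsto (fun t : ℝ => C * |t|) (nhdsWithin 0 {0}ᶜ) (nhds 0) := by
      have : Filter.Tendsto (fun t : ℝ => C * |t|) (nhds 0) (nhds (C * |0|)) :=
        (continuous_const.mul continuous_abs).tendsto 0
      simpa using this.mono_left nhdsWithin_le_nhds
    have hle : |q.eval 0| ≤ 0 := by
      refine le_of_tendsto_of_tendsto hlim hlim2 ?_
      have hball : ∀ᶠ t : ℝ in nhdsWithin 0 {0}ᶜ, |t| ≤ 1 := by
        refine nhdsWithin_le_nhds ?_
        filter_upwards [Metric.closedBall_mem_nhds (0 : ℝ) one_pos] with t ht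
        simpa using ht
      filter_upwards [hball, self_mem_nhdsWithin] with t ht ht0
      exact hb t ht0 ht
    have h0 : q.eval 0 = 0 := abs_nonpos_iff.mp hle
    rw [hq, Polynomial.coeff_X_pow_mul', if_pos le_rfl, Nat.sub_self,
      Polynomial.coeff_zero_eq_eval_zero, h0]

/-- A polynomial whose normal derivatives up to order `m` vanish on a hyperplane vanishes to that
order along every line through a point of the hyperplane. -/
theorem coeff_linePoly_eq_zero {n : E d} (hn : ‖n‖ = 1) {m : ℕ} {p : Poly d}
    (h : ∀ j ≤ m, ∀ x : E d, inner ℝ n x = 0 → dirDeriv p j x (fun _ => n) = 0)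
    {a : E d} (ha : inner ℝ n a = 0) (b : E d) :
    ∀ k ≤ m, (linePoly a b p).coeff k = 0 := by
  set β := inner ℝ n b with hβ
  set w := b - β • n with hw
  have hnn : inner ℝ n n = (1 : ℝ) := by rw [real_inner_self_eq_norm_sq, hn]; norm_num
  have hnw : inner ℝ n w = (0 : ℝ) := by
    rw [hw, inner_sub_right, inner_smul_right, hnn]; simp [hβ]
  have hbw : b = w + β • n := by simp [hw]
  set D := p.totalDegree
  have hD : ∀ x, (linePoly x n p).natDegree ≤ D := fun x =>
    natDegree_linePoly_le x n ((MvPolynomial.mem_restrictTotalDegree _ _ _).mpr le_rfl)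
  have hcoef : ∀ k, Continuous fun t : ℝ => (linePoly (a + t • w) n p).coeff k := by
    intro k
    have h1 : Continuous fun t : ℝ => dirDeriv p k (a + t • w) (fun _ => n) / k.factorial := by
      refine Continuous.div_const ?_ _
      exact (dirDeriv_continuous p k).comp
        (f := fun t : ℝ => (a + t • w, fun _ => n)) (by fun_prop)
    refine h1.congr fun t => ?_
    rw [dirDeriv_eq_coeff_linePoly]
    field_simp
  have hbd : ∀ k, ∃ B, 0 ≤ B ∧ ∀ t : ℝ, |t| ≤ 1 → |(linePoly (a + t • w) n p).coeff k| ≤ B := by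
    intro k
    obtain ⟨B, hB⟩ := (isCompact_Icc (a := (-1 : ℝ)) (b := 1)).exists_bound_of_continuousOn
      (hcoef k).continuousOn
    refine ⟨max B 0, le_max_right _ _, fun t ht => (hB t (abs_le.mp ht)).trans (le_max_left _ _)⟩
  choose B hB0 hB using hbd
  refine coeff_eq_zero_of_abs_eval_le (C := ∑ k ∈ Finset.range (D + 1), B k * |β| ^ k) ?_
  intro t ht
  have hpt : a + t • b = (a + t • w) + (t * β) • n := by
    rw [hbw]; module
  have hperp : inner ℝ n (a + t • w) = (0 : ℝ) := by
    rw [inner_add_right, inner_smul_right, hnw, ha]; simp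
  rw [eval_linePoly, hpt, ← eval_linePoly,
    Polynomial.eval_eq_sum_range' (Nat.lt_succ_of_le (hD _)), Finset.sum_mul]
  refine (Finset.abs_sum_le_sum_abs _ _).trans (Finset.sum_le_sum fun k _ => ?_)
  rw [abs_mul, abs_pow, abs_mul, mul_pow]
  by_cases hk : k ≤ m
  · have := h k hk _ hperp
    rw [dirDeriv_eq_coeff_linePoly] at this
    have h0 : (linePoly (a + t • w) n p).coeff k = 0 := by
      rcases mul_eq_zero.mp this with h1 | h1
      · exact absurd h1 (by positivity)
      · exact h1
    rw [h0]; simp only [abs_zero, zero_mul]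
    have := hB0 k; positivity
  · have h1 : |t| ^ k ≤ |t| ^ (m + 1) := pow_le_pow_of_le_one (abs_nonneg t) ht (by omega)
    calc _ ≤ B k * (|t| ^ (m + 1) * |β| ^ k) := by
            gcongr
            · exact hB0 k
            · exact hB k t ht
      _ = _ := by ring

/-- Polynomials of degree at most `m` in each variable are determined by their normal derivatives
up to order `m` on a hyperplane. -/
theorem eq_zero_of_mem_QQ {n : E d} (hn : ‖n‖ = 1) {m : ℕ} {p : Poly d} (hp : p ∈ QQ d m)
    (h : ∀ j ≤ m, ∀ x : E d, inner ℝ n x = 0 → dirDeriv p j x (fun _ => n) = 0) : p = 0 := by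
  obtain ⟨i, hi⟩ : ∃ i, n i ≠ 0 := by
    by_contra! hcon
    have : n = 0 := by ext i; simpa using hcon i
    simp [this] at hn
  refine eq_zero_of_polyFun_eq_zero (c := 0) one_pos fun x _ => ?_
  set e : E d := EuclideanSpace.single i 1
  have hne : inner ℝ n e = n i := by simp [e, EuclideanSpace.inner_single_right]
  set t := inner ℝ n x / n i
  have ha : inner ℝ n (x - t • e) = (0 : ℝ) := by
    rw [inner_sub_right, inner_smul_right, hne]; simp [t, hi]
  have hz : linePoly (x - t • e) e p = 0 := by
    ext k
    by_cases hk : k ≤ m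
    · simpa using coeff_linePoly_eq_zero hn h ha e k hk
    · rw [Polynomial.coeff_eq_zero_of_natDegree_lt
        (lt_of_le_of_lt (natDegree_linePoly_single_le _ i hp) (by omega))]
      simp
  have := eval_linePoly (x - t • e) e p t
  rw [hz] at this
  simpa using this.symm

theorem eq_coeff_mul_of_natDegree_le {g : Polynomial ℝ} {m : ℕ} (hg : g.natDegree ≤ m + 1)
    (h : ∀ k ≤ m, g.coeff k = 0) (t : ℝ) : g.eval t = g.coeff (m + 1) * t ^ (m + 1) := by
  rw [Polynomial.eval_eq_sum_range' (Nat.lt_succ_of_le hg), Finset.sum_range_succ,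
    Finset.sum_eq_zero fun k hk => ?_, zero_add]
  rw [h k (by simpa [Nat.lt_succ_iff] using hk), zero_mul]

/-- Raviart-Thomas fields of degree `m` are determined by their normal derivatives up to order `m`
on a hyperplane. -/
theorem eq_zero_of_mem_raviartThomas (hd : 2 ≤ d) {n : E d} (hn : ‖n‖ = 1) {m : ℕ} {v : VecPoly d}
    (hv : v ∈ raviartThomas d m)
    (h : ∀ i, ∀ j ≤ m, ∀ x : E d, inner ℝ n x = 0 → dirDeriv (v i) j x (fun _ => n) = 0) :
    v = 0 := by
  obtain ⟨p, q, hp, hq, hpq⟩ := hv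
  obtain ⟨w, hw, hnw⟩ : ∃ w : E d, w ≠ 0 ∧ inner ℝ n w = (0 : ℝ) := by
    have h1 : Module.finrank ℝ (Submodule.span ℝ {n}) + Module.finrank ℝ (Submodule.span ℝ {n})ᗮ
        = d := by
      rw [Submodule.finrank_add_finrank_orthogonal]; simp
    have h2 : Module.finrank ℝ (Submodule.span ℝ {n}) ≤ 1 := by
      rw [finrank_span_singleton (by intro h0; simp [h0] at hn)]
    have h3 : 0 < Module.finrank ℝ (Submodule.span ℝ {n})ᗮ := by omega
    have := Module.finrank_pos_iff.mp h3
    obtain ⟨⟨w, hw⟩, hw0⟩ := exists_ne (0 : (Submodule.span ℝ {n})ᗮ)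
    refine ⟨w, fun h0 => hw0 (by simpa using h0), ?_⟩
    exact Submodule.mem_orthogonal_singleton_iff_inner_right.mp hw
  set b := n + w
  have hnn : inner ℝ n n = (1 : ℝ) := by rw [real_inner_self_eq_norm_sq, hn]; norm_num
  have hnb : inner ℝ n b = (1 : ℝ) := by rw [inner_add_right, hnw, hnn]; norm_num
  -- along a line through a point of the hyperplane, the field is a multiple of the direction
  have hline : ∀ a b' : E d, inner ℝ n a = (0 : ℝ) → ∀ i t, polyFun (v i) (a + t • b') =
      b' i * (linePoly a b' q).coeff m * t ^ (m + 1) := by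
    intro a b' ha i t
    have hvi : linePoly a b' (v i) = linePoly a b' (p i) +
        (Polynomial.C (a i) + Polynomial.C (b' i) * Polynomial.X) * linePoly a b' q := by
      rw [hpq i, map_add, map_mul]
      simp [linePoly]
    have hpd := natDegree_linePoly_le a b' (hp i)
    have hqd := natDegree_linePoly_le a b' hq
    have hdeg : (linePoly a b' (v i)).natDegree ≤ m + 1 := by
      rw [hvi]
      refine (Polynomial.natDegree_add_le _ _).trans (max_le (by omega) ?_)
      refine Polynomial.natDegree_mul_le.trans ?_
      have := natDegree_line_le (a i) (b' i)
      omega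
    have hco : (linePoly a b' (v i)).coeff (m + 1) = b' i * (linePoly a b' q).coeff m := by
      rw [hvi, Polynomial.coeff_add, Polynomial.coeff_eq_zero_of_natDegree_lt (by omega), zero_add,
        add_mul, Polynomial.coeff_add, Polynomial.coeff_C_mul,
        Polynomial.coeff_eq_zero_of_natDegree_lt (lt_of_le_of_lt hqd (Nat.lt_succ_self m)), mul_assoc,
        Polynomial.coeff_C_mul, Polynomial.coeff_X_mul]
      simp
    rw [← eval_linePoly, eq_coeff_mul_of_natDegree_le hdeg (coeff_linePoly_eq_zero hn (h i) ha b'),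
      hco]
  have hzero : ∀ x : E d, ∀ i, polyFun (v i) x = 0 := by
    intro x i
    by_cases ht : inner ℝ n x = (0 : ℝ)
    · have := h i 0 (Nat.zero_le _) x ht
      rwa [dirDeriv_zero_order] at this
    · set t := inner ℝ n x
      set a := x - t • b
      have ha : inner ℝ n a = (0 : ℝ) := by
        rw [inner_sub_right, inner_smul_right, hnb]; simp [t]
      have ha2 : inner ℝ n (a + t • w) = (0 : ℝ) := by
        rw [inner_add_right, inner_smul_right, hnw, ha]; simp
      have hx : x = a + t • b := by simp [a]
      have hx2 : x = (a + t • w) + t • n := by simp only [a, b]; module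
      set μ := (linePoly a b q).coeff m
      set κ := (linePoly (a + t • w) n q).coeff m
      have he : ∀ i, b i * μ = n i * κ := by
        intro i
        have h1 := hline a b ha i t
        have h2 := hline (a + t • w) n ha2 i t
        rw [← hx] at h1
        rw [← hx2, h1] at h2
        exact mul_right_cancel₀ (pow_ne_zero _ ht) h2
      have hvec : μ • b = κ • n := by
        ext i; simpa [mul_comm] using he i
      have hin : inner ℝ w (μ • b) = inner ℝ w (κ • n) := by rw [hvec]
      rw [inner_smul_right, inner_smul_right, inner_add_right, real_inner_comm, hnw,
        real_inner_self_eq_norm_sq] at hin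
      have hμ : μ = 0 := by
        have hw' : ‖w‖ ^ 2 ≠ 0 := by simpa using hw
        have : μ * ‖w‖ ^ 2 = 0 := by simpa using hin
        exact (mul_eq_zero.mp this).resolve_right hw'
      rw [hx, hline a b ha i t]
      simp [μ, hμ]
  funext i
  exact eq_zero_of_polyFun_eq_zero (c := 0) one_pos fun x _ => hzero x i

end Lines

end UnfittedFEM

namespace UnfittedFEM

/-! ### Scaling of integrals over balls and discs -/

theorem setIntegral_closedBall_scale {k : ℕ} (b : E k) {h : ℝ} (hh : 0 < h) (ρ : ℝ) (F : E k → ℝ) :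
    ∫ x in Metric.closedBall b (ρ * h), F x =
      h ^ k * ∫ y in Metric.closedBall 0 ρ, F (b + h • y) := by
  have h1 := (measurePreserving_add_left (volume : Measure (E k)) b).setIntegral_preimage_emb
    (measurableEmbedding_addLeft b) F (Metric.closedBall b (ρ * h))
  have h2 : (fun x => b + x) ⁻¹' Metric.closedBall b (ρ * h) = Metric.closedBall 0 (ρ * h) := by
    ext x; simp
  rw [← h1, h2, Measure.setIntegral_comp_smul_of_pos volume (fun y => F (b + y)) _ hh,
    smul_closedBall' hh.ne']
  simp only [smul_zero, Real.norm_eq_abs, abs_of_pos hh, finrank_euclideanSpace, Fintype.card_fin,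
    smul_eq_mul]
  rw [mul_comm h ρ, ← mul_assoc, mul_inv_cancel₀ (by positivity), one_mul]

/-- The disc with centre `c`, unit normal `n` and radius `r`. -/
def disc {d : ℕ} (c n : E d) (r : ℝ) : Set (E d) :=
  {x | inner ℝ n (x - c) = (0 : ℝ) ∧ ‖x - c‖ ≤ r}

theorem exists_isometry_orthogonal {d : ℕ} {n : E d} (hn : ‖n‖ = 1) :
    ∃ L : E (d - 1) →ₗᵢ[ℝ] E d, ∀ z, inner ℝ n z = (0 : ℝ) ↔ ∃ y, L y = z := by
  have h1 : Module.finrank ℝ (Submodule.span ℝ {n}) + Module.finrank ℝ (Submodule.span ℝ {n})ᗮ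
      = d := by
    rw [Submodule.finrank_add_finrank_orthogonal]; simp
  rw [finrank_span_singleton (by intro h0; simp [h0] at hn)] at h1
  have h2 : Module.finrank ℝ (Submodule.span ℝ {n})ᗮ = d - 1 := by omega
  let e : E (d - 1) ≃ₗᵢ[ℝ] (Submodule.span ℝ {n})ᗮ :=
    ((stdOrthonormalBasis ℝ (Submodule.span ℝ {n})ᗮ).reindex (finCongr h2)).repr.symm
  refine ⟨(Submodule.span ℝ {n})ᗮ.subtypeₗᵢ.comp e.toLinearIsometry, fun z => ?_⟩
  rw [← Submodule.mem_orthogonal_singleton_iff_inner_right]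
  constructor
  · intro hz
    exact ⟨e.symm ⟨z, hz⟩, by simp⟩
  · rintro ⟨y, rfl⟩
    exact (e y).2

theorem setIntegral_disc {d : ℕ} {n : E d} (L : E (d - 1) →ₗᵢ[ℝ] E d)
    (hL : ∀ z, inner ℝ n z = (0 : ℝ) ↔ ∃ y, L y = z) (c : E d) {h : ℝ} (hh : 0 < h) (ρ : ℝ)
    (F : E d → ℝ) :
    ∫ x in disc c n (ρ * h), F x ∂(Measure.euclideanHausdorffMeasure (d - 1)) =
      h ^ (d - 1) * ∫ y in Metric.closedBall 0 ρ, F (c + h • L y) := by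
  set φ : E (d - 1) → E d := fun y => c + L y with hφ
  have hiso : Isometry φ := (isometry_add_left c).comp L.isometry
  have hpre : φ ⁻¹' (disc c n (ρ * h)) = Metric.closedBall 0 (ρ * h) := by
    ext y
    have : inner ℝ n (L y) = (0 : ℝ) := (hL _).mpr ⟨y, rfl⟩
    simp [disc, hφ, this, L.norm_map]
  have hsub : disc c n (ρ * h) ⊆ Set.range φ := by
    rintro x ⟨hx, -⟩
    obtain ⟨y, hy⟩ := (hL _).mp hx
    exact ⟨y, by simp [hφ, hy]⟩
  have hmeas : MeasurableSet (disc c n (ρ * h)) := by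
    refine IsClosed.measurableSet ?_
    have h1 : IsClosed {x : E d | inner ℝ n (x - c) = (0 : ℝ)} :=
      isClosed_eq (by fun_prop) continuous_const
    have h2 : IsClosed {x : E d | ‖x - c‖ ≤ ρ * h} := isClosed_le (by fun_prop) continuous_const
    exact h1.inter h2
  have h1 := hiso.isClosedEmbedding.measurableEmbedding.setIntegral_map
    (μ := Measure.euclideanHausdorffMeasure (d - 1)) F (disc c n (ρ * h))
  rw [hiso.map_euclideanHausdorffMeasure, Measure.restrict_restrict hmeas,
    inter_eq_left.mpr hsub, hpre, EuclideanSpace.euclideanHausdorffMeasure_eq_volume,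
    setIntegral_closedBall_scale 0 hh] at h1
  rw [h1]
  simp [hφ]

theorem eq_zero_of_setIntegral_closedBall_eq_zero {k : ℕ} {F : E k → ℝ} (hF : Continuous F)
    (h0 : ∀ x, 0 ≤ F x) {ρ : ℝ} (hint : ∫ x in Metric.closedBall 0 ρ, F x = 0) :
    ∀ x ∈ Metric.ball (0 : E k) ρ, F x = 0 := by
  have hi : IntegrableOn F (Metric.closedBall 0 ρ) :=
    hF.continuousOn.integrableOn_compact (isCompact_closedBall _ _)
  rw [setIntegral_eq_zero_iff_of_nonneg_ae (Filter.Eventually.of_forall h0) hi] at hint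
  have h2 : F =ᵐ[volume.restrict (Metric.ball 0 ρ)] 0 :=
    ae_restrict_of_ae_restrict_of_subset Metric.ball_subset_closedBall hint
  exact Measure.eqOn_open_of_ae_eq h2 Metric.isOpen_ball hF.continuousOn continuousOn_const

/-! ### Inverse estimates -/

section Inverse

variable {d : ℕ}

theorem polyFun_sum_smul {N n : ℕ} (b : Fin n → PP d N) (a : Fin n → ℝ) (x : E d) :
    polyFun ((∑ k, a k • b k : PP d N) : Poly d) x = ∑ k, a k * polyFun (b k : Poly d) x := by
  simp [polyFun_sum, polyFun_smul]

/-- Inverse estimate: derivatives of a polynomial are bounded by its `L²` norm on a ball. -/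
theorem exists_dirDeriv_sq_le (d N j : ℕ) (R : ℝ) {ρ : ℝ} (hρ : 0 < ρ) :
    ∃ C : ℝ, 0 < C ∧ ∀ p ∈ PP d N, ∀ h : ℝ, 0 < h → ∀ b x : E d, dist x b ≤ R * h →
      ∀ u : Fin j → E d, (∀ k, ‖u k‖ ≤ 1) →
      h ^ (2 * j + d) * dirDeriv p j x u ^ 2 ≤
        C * ∫ y in Metric.closedBall b (ρ * h), polyFun p y ^ 2 := by
  have hK : IsCompact (Metric.closedBall (0 : E d) R ×ˢ
      Set.pi univ fun _ : Fin j => Metric.closedBall (0 : E d) 1) :=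
    (isCompact_closedBall _ _).prod (isCompact_univ_pi fun _ => isCompact_closedBall _ _)
  have key : ∃ C : ℝ, 0 < C ∧ ∀ z ∈ Metric.closedBall (0 : E d) R ×ˢ
      Set.pi univ (fun _ : Fin j => Metric.closedBall (0 : E d) 1), ∀ p : PP d N,
      dirDeriv (p : Poly d) j z.1 z.2 ^ 2 ≤
        C * ∫ y in Metric.closedBall (0 : E d) ρ, polyFun (p : Poly d) y ^ 2 := by
    refine exists_le_mul_of_compact (V := PP d N) hK
      (fun z p => dirDeriv (p : Poly d) j z.1 z.2 ^ 2)
      (fun _ p => ∫ y in Metric.closedBall (0 : E d) ρ, polyFun (p : Poly d) y ^ 2) ?_ ?_ ?_ ?_ ?_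
    · intro n b
      simp only [Submodule.coe_sum, Submodule.coe_smul, dirDeriv_sum, dirDeriv_smul]
      refine (continuous_finsetSum _ fun k _ => ?_).pow 2
      exact ((continuous_apply k).comp continuous_snd).mul
        ((dirDeriv_continuous (b k : Poly d) j).comp continuous_fst)
    · intro n b
      simp only [polyFun_sum_smul]
      have : Continuous fun a : Fin n → ℝ => ∫ y in Metric.closedBall (0 : E d) ρ,
          (∑ k, a k * polyFun (b k : Poly d) y) ^ 2 := by
        refine continuous_parametric_integral_of_continuous (f := fun (a : Fin n → ℝ) y =>
          (∑ k, a k * polyFun (b k : Poly d) y) ^ 2) ?_ (isCompact_closedBall _ _)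
        refine (continuous_finsetSum _ fun k _ => ?_).pow 2
        exact ((continuous_apply k).comp continuous_fst).mul
          ((polyFun_continuous _).comp continuous_snd)
      exact this.comp continuous_snd
    · intro z t p
      simp [dirDeriv_smul, mul_pow]
    · intro z t p
      simp only [Submodule.coe_smul, polyFun_smul, Pi.smul_apply, smul_eq_mul, mul_pow]
      rw [integral_const_mul]
    · intro z _ p hp
      refine lt_of_le_of_ne (integral_nonneg fun y => sq_nonneg _) fun h0 => hp ?_
      have := eq_zero_of_setIntegral_closedBall_eq_zero
        (F := fun y => polyFun (p : Poly d) y ^ 2) ((polyFun_continuous _).pow 2)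
        (fun y => sq_nonneg _) h0.symm
      refine Subtype.ext (eq_zero_of_polyFun_eq_zero (c := 0) (half_pos hρ) fun x hx => ?_)
      have hx' : x ∈ Metric.ball (0 : E d) ρ :=
        Metric.closedBall_subset_ball (by linarith) hx
      simpa using this x hx'
  obtain ⟨C, hC, hle⟩ := key
  refine ⟨C, hC, fun p hp h hh b x hx u hu => ?_⟩
  have hx' : x = b + h • (h⁻¹ • (x - b)) := by
    rw [smul_smul, mul_inv_cancel₀ hh.ne']; simp
  have := hle (h⁻¹ • (x - b), u) ⟨?_, fun k _ => by simpa using hu k⟩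
    ⟨affSub b h p, affSub_mem_PP b h hp⟩
  · simp only [dirDeriv_affSub, polyFun_affSub, ← hx'] at this
    rw [setIntegral_closedBall_scale b hh]
    calc h ^ (2 * j + d) * dirDeriv p j x u ^ 2 = h ^ d * (h ^ j * dirDeriv p j x u) ^ 2 := by ring
      _ ≤ h ^ d * (C * ∫ y in Metric.closedBall 0 ρ, polyFun p (b + h • y) ^ 2) := by gcongr
      _ = _ := by ring
  · rw [mem_closedBall_zero_iff, norm_smul, norm_inv, Real.norm_eq_abs, abs_of_pos hh,
      ← dist_eq_norm, inv_mul_le_iff₀ hh]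
    linarith

theorem polyFun_sq_integrableOn (p : Poly d) {S : Set (E d)} (hS : Bornology.IsBounded S) :
    IntegrableOn (fun x => polyFun p x ^ 2) S := by
  obtain ⟨r, hr⟩ := hS.subset_closedBall 0
  exact (((polyFun_continuous p).pow 2).continuousOn.integrableOn_compact
    (isCompact_closedBall 0 r)).mono_set hr

theorem setIntegral_polyFun_sq_mono (p : Poly d) {S S' : Set (E d)} (hS' : Bornology.IsBounded S')
    (h : S ⊆ S') : ∫ x in S, polyFun p x ^ 2 ≤ ∫ x in S', polyFun p x ^ 2 :=
  setIntegral_mono_set (polyFun_sq_integrableOn p hS')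
    (Filter.Eventually.of_forall fun _ => sq_nonneg _) h.eventuallyLE

/-- The `L²` norms of a polynomial on comparable balls are equivalent. -/
theorem exists_setIntegral_sq_le (d N : ℕ) (R : ℝ) {ρ : ℝ} (hρ : 0 < ρ) :
    ∃ C : ℝ, 0 < C ∧ ∀ p ∈ PP d N, ∀ h : ℝ, 0 < h → ∀ (b : E d) (S : Set (E d)),
      S ⊆ Metric.closedBall b (R * h) →
      ∫ x in S, polyFun p x ^ 2 ≤ C * ∫ y in Metric.closedBall b (ρ * h), polyFun p y ^ 2 := by
  obtain ⟨C, hC, hle⟩ := exists_dirDeriv_sq_le d N 0 R hρ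
  set v := volume.real (Metric.closedBall (0 : E d) R) with hv
  refine ⟨C * (v + 1), by positivity, fun p hp h hh b S hS => ?_⟩
  refine (setIntegral_polyFun_sq_mono p Metric.isBounded_closedBall hS).trans ?_
  rw [setIntegral_closedBall_scale b hh]
  set I := ∫ y in Metric.closedBall b (ρ * h), polyFun p y ^ 2
  have hI : 0 ≤ I := integral_nonneg fun y => sq_nonneg _
  have hpt : ∀ y ∈ Metric.closedBall (0 : E d) R, polyFun p (b + h • y) ^ 2 ≤ (h ^ d)⁻¹ * (C * I) := by
    intro y hy
    have := hle p hp h hh b (b + h • y) ?_ (fun k => 0) (fun k => by simp)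
    · rw [dirDeriv_zero_order] at this
      simp only [mul_zero, zero_add] at this
      rwa [le_inv_mul_iff₀ (by positivity)]
    · rw [mem_closedBall_zero_iff] at hy
      simp only [dist_eq_norm, add_sub_cancel_left, norm_smul, Real.norm_eq_abs, abs_of_pos hh]
      rw [mul_comm]; gcongr
  have h1 : ∫ y in Metric.closedBall 0 R, polyFun p (b + h • y) ^ 2 ≤
      ∫ y in Metric.closedBall (0 : E d) R, (h ^ d)⁻¹ * (C * I) := by
    refine setIntegral_mono_on ?_ (integrableOn_const measure_closedBall_lt_top.ne)
      measurableSet_closedBall hpt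
    have h2 : (fun y => polyFun p (b + h • y) ^ 2) = fun y => polyFun (affSub b h p) y ^ 2 := by
      simp only [polyFun_affSub]
    rw [h2]
    exact polyFun_sq_integrableOn _ Metric.isBounded_closedBall
  rw [setIntegral_const, smul_eq_mul, ← hv] at h1
  calc _ ≤ h ^ d * (v * ((h ^ d)⁻¹ * (C * I))) := by gcongr
    _ = v * (C * I) := by field_simp
    _ ≤ C * (v + 1) * I := by nlinarith [mul_nonneg hC.le hI]

end Inverse

end UnfittedFEM

namespace UnfittedFEM

/-! ### Control of a polynomial by its derivatives on a disc -/

section FaceControl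

variable {d : ℕ}

theorem dirDeriv_comp_eq_zero {k : ℕ} (p : Poly d) (j : ℕ) (u : Fin j → E d) (L : E k →L[ℝ] E d)
    {ρ : ℝ} (hρ : 0 < ρ) (h : ∀ y ∈ Metric.ball (0 : E k) ρ, dirDeriv p j (L y) u = 0) (y : E k) :
    dirDeriv p j (L y) u = 0 := by
  have h1 : ContDiff ℝ ω (iteratedFDeriv ℝ j (polyFun p)) :=
    (polyFun_contDiff p (n := ω)).iteratedFDeriv_right le_top
  have h2 : ContDiff ℝ ω (fun y => dirDeriv p j (L y) u) :=
    (((ContinuousMultilinearMap.apply ℝ (fun _ : Fin j => E d) ℝ u).contDiff (n := ω)).comp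
      h1).comp L.contDiff
  rw [contDiff_omega_iff_analyticOnNhd] at h2
  have h3 := h2.eq_of_eventuallyEq (g := fun _ => (0 : ℝ)) analyticOnNhd_const (z₀ := 0) (by
    filter_upwards [Metric.ball_mem_nhds (0 : E k) hρ] with y hy using h y hy)
  exact congrFun h3 y

theorem mem_range_of_orthogonal {n : E d} (hn : ‖n‖ = 1) (L : E (d - 1) →L[ℝ] E d)
    (hL : ∀ y, ‖L y‖ = ‖y‖) (hLn : ∀ y, inner ℝ n (L y) = (0 : ℝ)) (z : E d) :
    inner ℝ n z = (0 : ℝ) ↔ ∃ y, L y = z := by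
  constructor
  · intro hz
    have h1 : Module.finrank ℝ (Submodule.span ℝ {n}) + Module.finrank ℝ (Submodule.span ℝ {n})ᗮ
        = d := by
      rw [Submodule.finrank_add_finrank_orthogonal]; simp
    rw [finrank_span_singleton (by intro h0; simp [h0] at hn)] at h1
    have hinj : Function.Injective L.toLinearMap := by
      rw [injective_iff_map_eq_zero]
      intro y hy
      have := hL y
      rw [show L y = 0 from hy, norm_zero] at this
      exact norm_eq_zero.mp this.symm
    have h2 : Module.finrank ℝ (LinearMap.range L.toLinearMap) = d - 1 := by
      rw [LinearMap.finrank_range_of_inj hinj]; simp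
    have hle : LinearMap.range L.toLinearMap ≤ (Submodule.span ℝ {n})ᗮ := by
      rintro _ ⟨y, rfl⟩
      exact Submodule.mem_orthogonal_singleton_iff_inner_right.mpr (hLn y)
    have heq := Submodule.eq_of_le_of_finrank_eq hle (by omega)
    have : z ∈ LinearMap.range L.toLinearMap := by
      rw [heq]; exact Submodule.mem_orthogonal_singleton_iff_inner_right.mpr hz
    exact this
  · rintro ⟨y, rfl⟩
    exact hLn y

theorem isCompact_frames : IsCompact {z : (E (d - 1) →L[ℝ] E d) × E d |
    (∀ y, ‖z.1 y‖ = ‖y‖) ∧ ‖z.2‖ = 1 ∧ ∀ y, inner ℝ z.2 (z.1 y) = (0 : ℝ)} := by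
  have : ProperSpace (E (d - 1) →L[ℝ] E d) := FiniteDimensional.proper_real _
  refine Metric.isCompact_of_isClosed_isBounded ?_ ?_
  · simp only [Set.ofPred_and, Set.ofPred_forall]
    refine (isClosed_iInter fun y => ?_).inter (IsClosed.inter ?_ (isClosed_iInter fun y => ?_))
    · exact isClosed_eq (by fun_prop) continuous_const
    · exact isClosed_eq (by fun_prop) continuous_const
    · exact isClosed_eq (by fun_prop) continuous_const
  · refine (Metric.isBounded_closedBall (x := (0 : (E (d - 1) →L[ℝ] E d) × E d))
      (r := 1)).subset ?_
    rintro ⟨L, n⟩ ⟨hL, hn, -⟩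
    rw [mem_closedBall_zero_iff, Prod.norm_def]
    refine max_le ?_ hn.le
    exact ContinuousLinearMap.opNorm_le_bound _ zero_le_one fun y => by rw [one_mul]; exact (hL y).le

variable {ι : Type*} [Fintype ι] {κ : ℕ → Type*} [∀ j, Fintype (κ j)]

theorem exists_setIntegral_sq_le_disc (hd : 1 ≤ d) (W : Submodule ℝ (ι → Poly d)) {N : ℕ}
    (hWN : ∀ v ∈ W, ∀ i, v i ∈ PP d N)
    (hWaff : ∀ v ∈ W, ∀ b h, (fun i => affSub b h (v i)) ∈ W) (m : ℕ)
    (dir : E d → (j : ℕ) → κ j → Fin j → E d) (hdir : ∀ j k, Continuous fun n => dir n j k)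
    (hunis : ∀ n, ‖n‖ = 1 → ∀ v ∈ W, (∀ i, ∀ j ≤ m, ∀ k, ∀ x, inner ℝ n x = (0 : ℝ) →
      dirDeriv (v i) j x (dir n j k) = 0) → v = 0)
    (R : ℝ) {ρ : ℝ} (hρ : 0 < ρ) :
    ∃ C : ℝ, 0 < C ∧ ∀ v ∈ W, ∀ h : ℝ, 0 < h → ∀ c n : E d, ‖n‖ = 1 →
      ∑ i, ∫ x in Metric.closedBall c (R * h), polyFun (v i) x ^ 2 ≤
        C * ∑ j ∈ Finset.range (m + 1), h ^ (2 * j + 1) *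
          ∫ x in disc c n (ρ * h), ∑ i, ∑ k, dirDeriv (v i) j x (dir n j k) ^ 2
            ∂(Measure.euclideanHausdorffMeasure (d - 1)) := by
  have : ProperSpace (E (d - 1) →L[ℝ] E d) := FiniteDimensional.proper_real _
  have hfin : FiniteDimensional ℝ W := by
    have hle : W ≤ Submodule.pi univ fun _ : ι => PP d N := fun v hv i _ => hWN v hv i
    let e : (Submodule.pi univ fun _ : ι => PP d N) →ₗ[ℝ] (ι → PP d N) :=
      { toFun := fun v i => ⟨v.1 i, v.2 i (mem_univ i)⟩
        map_add' := fun _ _ => rfl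
        map_smul' := fun _ _ => rfl }
    have he : Function.Injective e := fun v w h => Subtype.ext (funext fun i =>
      congrArg Subtype.val (congrFun h i))
    have := FiniteDimensional.of_injective e he
    exact Submodule.finiteDimensional_of_le hle
  have hcoord : ∀ n (b : Fin n → W) (a : Fin n → ℝ) (i : ι),
      ((∑ k, a k • b k : W) : ι → Poly d) i = ∑ k, a k • (b k : ι → Poly d) i := by
    intro n b a i
    simp
  have key : ∃ C : ℝ, 0 < C ∧ ∀ z ∈ {z : (E (d - 1) →L[ℝ] E d) × E d |
      (∀ y, ‖z.1 y‖ = ‖y‖) ∧ ‖z.2‖ = 1 ∧ ∀ y, inner ℝ z.2 (z.1 y) = (0 : ℝ)}, ∀ v : W,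
      ∑ i, ∫ x in Metric.closedBall (0 : E d) R, polyFun ((v : ι → Poly d) i) x ^ 2 ≤
      C * ∑ j ∈ Finset.range (m + 1), ∫ y in Metric.closedBall (0 : E (d - 1)) ρ,
        ∑ i, ∑ k, dirDeriv ((v : ι → Poly d) i) j (z.1 y) (dir z.2 j k) ^ 2 := by
    refine exists_le_mul_of_compact (V := W) isCompact_frames
      (fun _ v => ∑ i, ∫ x in Metric.closedBall (0 : E d) R, polyFun ((v : ι → Poly d) i) x ^ 2)
      (fun z v => ∑ j ∈ Finset.range (m + 1), ∫ y in Metric.closedBall (0 : E (d - 1)) ρ,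
        ∑ i, ∑ k, dirDeriv ((v : ι → Poly d) i) j (z.1 y) (dir z.2 j k) ^ 2) ?_ ?_ ?_ ?_ ?_
    · intro n b
      simp only [hcoord, polyFun_sum, polyFun_smul, Finset.sum_apply, Pi.smul_apply, smul_eq_mul]
      refine continuous_finsetSum _ fun i _ => ?_
      have : Continuous fun a : Fin n → ℝ => ∫ y in Metric.closedBall (0 : E d) R,
          (∑ k, a k * polyFun ((b k : ι → Poly d) i) y) ^ 2 := by
        refine continuous_parametric_integral_of_continuous (f := fun (a : Fin n → ℝ) y =>
          (∑ k, a k * polyFun ((b k : ι → Poly d) i) y) ^ 2) ?_ (isCompact_closedBall _ _)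
        refine (continuous_finsetSum _ fun k _ => ?_).pow 2
        exact ((continuous_apply k).comp continuous_fst).mul
          ((polyFun_continuous _).comp continuous_snd)
      exact this.comp continuous_snd
    · intro n b
      simp only [hcoord, dirDeriv_sum, dirDeriv_smul]
      refine continuous_finsetSum _ fun j _ => ?_
      refine continuous_parametric_integral_of_continuous
        (f := fun (z : ((E (d - 1) →L[ℝ] E d) × E d) × (Fin n → ℝ)) y =>
          ∑ i, ∑ k, (∑ l, z.2 l * dirDeriv ((b l : ι → Poly d) i) j (z.1.1 y) (dir z.1.2 j k)) ^ 2)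
        ?_ (isCompact_closedBall _ _)
      refine continuous_finsetSum _ fun i _ => continuous_finsetSum _ fun k _ =>
        (continuous_finsetSum _ fun l _ => ?_).pow 2
      refine Continuous.mul (by fun_prop) ?_
      have h1 := hdir j k
      exact (dirDeriv_continuous ((b l : ι → Poly d) i) j).comp
        (f := fun w : (((E (d - 1) →L[ℝ] E d) × E d) × (Fin n → ℝ)) × E (d - 1) =>
          (w.1.1.1 w.2, dir w.1.1.2 j k)) (by fun_prop)
    · intro z t v
      simp only [Submodule.coe_smul, Pi.smul_apply, polyFun_smul, smul_eq_mul, mul_pow,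
        Finset.mul_sum, integral_const_mul]
    · intro z t v
      simp only [Submodule.coe_smul, Pi.smul_apply, dirDeriv_smul, mul_pow, ← Finset.mul_sum,
        integral_const_mul]
    · rintro ⟨L, n⟩ ⟨hL, hn, hLn⟩ v hv
      have hnn : ∀ j, 0 ≤ ∫ y in Metric.closedBall (0 : E (d - 1)) ρ,
          ∑ i, ∑ k, dirDeriv ((v : ι → Poly d) i) j (L y) (dir n j k) ^ 2 := fun j =>
        integral_nonneg fun y => Finset.sum_nonneg fun i _ => Finset.sum_nonneg fun k _ => sq_nonneg _
      refine lt_of_le_of_ne (Finset.sum_nonneg fun j _ => hnn j) fun h0 => hv ?_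
      refine Subtype.ext (hunis n hn v v.2 fun i j hj k x hx => ?_)
      have h1 := (Finset.sum_eq_zero_iff_of_nonneg fun j _ => hnn j).mp h0.symm j
        (Finset.mem_range.mpr (Nat.lt_succ_of_le hj))
      have h2 := eq_zero_of_setIntegral_closedBall_eq_zero (F := fun y =>
        ∑ i, ∑ k, dirDeriv ((v : ι → Poly d) i) j (L y) (dir n j k) ^ 2) (by
          refine continuous_finsetSum _ fun i _ => continuous_finsetSum _ fun k _ =>
            Continuous.pow ?_ 2
          exact (dirDeriv_continuous ((v : ι → Poly d) i) j).comp
            (f := fun y => (L y, dir n j k)) (by fun_prop))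
        (fun y => Finset.sum_nonneg fun i _ => Finset.sum_nonneg fun k _ => sq_nonneg _) h1
      obtain ⟨y, rfl⟩ := (mem_range_of_orthogonal hn L hL hLn x).mp hx
      refine dirDeriv_comp_eq_zero _ j _ L hρ (fun y hy => ?_) y
      have h3 := (Finset.sum_eq_zero_iff_of_nonneg fun i _ =>
        Finset.sum_nonneg fun k _ => sq_nonneg _).mp (h2 y hy) i (Finset.mem_univ i)
      have h4 := (Finset.sum_eq_zero_iff_of_nonneg fun k _ => sq_nonneg _).mp h3 k
        (Finset.mem_univ k)
      simpa using h4
  obtain ⟨C, hC, hle⟩ := key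
  refine ⟨C, hC, fun v hv h hh c n hn => ?_⟩
  obtain ⟨L, hL⟩ := exists_isometry_orthogonal hn
  have h1 := hle (L.toContinuousLinearMap, n)
    ⟨fun y => L.norm_map y, hn, fun y => (hL _).mpr ⟨y, rfl⟩⟩ ⟨_, hWaff v hv c h⟩
  simp only [polyFun_affSub, dirDeriv_affSub, LinearIsometry.coe_toContinuousLinearMap] at h1
  simp only [setIntegral_closedBall_scale c hh, setIntegral_disc L hL c hh, ← Finset.mul_sum]
  calc _ ≤ h ^ d * _ := mul_le_mul_of_nonneg_left h1 (by positivity)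
    _ = _ := by
      rw [mul_left_comm, Finset.mul_sum]
      congr 1
      refine Finset.sum_congr rfl fun j _ => ?_
      simp only [mul_pow, ← Finset.mul_sum, integral_const_mul]
      have : h ^ d = h * h ^ (d - 1) := by rw [← pow_succ']; congr 1; omega
      rw [this]; ring

end FaceControl

end UnfittedFEM

namespace UnfittedFEM

section FaceUpper

variable {d : ℕ}

theorem measure_disc {c n : E d} (hn : ‖n‖ = 1) {h : ℝ} (hh : 0 < h) (R : ℝ) :
    Measure.euclideanHausdorffMeasure (d - 1) (disc c n (R * h)) < ⊤ ∧
    (Measure.euclideanHausdorffMeasure (d - 1) : Measure (E d)).real (disc c n (R * h)) =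
      h ^ (d - 1) * volume.real (Metric.closedBall (0 : E (d - 1)) R) := by
  obtain ⟨L, hL⟩ := exists_isometry_orthogonal hn
  have h1 := setIntegral_disc L hL c hh R fun _ => 1
  rw [setIntegral_const, setIntegral_const] at h1
  simp only [smul_eq_mul, mul_one] at h1
  refine ⟨?_, h1⟩
  have hiso : Isometry fun y => c + L y := (isometry_add_left c).comp L.isometry
  have hsub : disc c n (R * h) ⊆ (fun y => c + L y) '' Metric.closedBall 0 (R * h) := by
    rintro x ⟨hx, hxr⟩
    obtain ⟨y, hy⟩ := (hL _).mp hx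
    refine ⟨y, ?_, by simp [hy]⟩
    rw [mem_closedBall_zero_iff, ← L.norm_map, hy]; exact hxr
  refine (measure_mono hsub).trans_lt ?_
  rw [hiso.euclideanHausdorffMeasure_image, EuclideanSpace.euclideanHausdorffMeasure_eq_volume]
  exact measure_closedBall_lt_top

variable {ι : Type*} [Fintype ι] {κ : ℕ → Type*} [∀ j, Fintype (κ j)]

/-- The bilinear forms of jumps on a facet are bounded by `L²` norms on a ball. -/
theorem exists_abs_face_le (hd : 1 ≤ d) (N m : ℕ)
    (dir : E d → (j : ℕ) → κ j → Fin j → E d)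
    (hdir : ∀ n, ‖n‖ = 1 → ∀ j k a, ‖dir n j k a‖ ≤ 1) {R : ℝ} {ρ : ℝ} (hρ : 0 < ρ) :
    ∃ C : ℝ, 0 < C ∧ ∀ u v : ι → Poly d, (∀ i, u i ∈ PP d N) → (∀ i, v i ∈ PP d N) →
      ∀ h : ℝ, 0 < h → ∀ c n : E d, ‖n‖ = 1 → ∀ F ⊆ disc c n (R * h),
      |∑ j ∈ Finset.range (m + 1), h ^ (2 * j + 1) *
        ∫ x in F, ∑ i, ∑ k, dirDeriv (u i) j x (dir n j k) * dirDeriv (v i) j x (dir n j k)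
          ∂(Measure.euclideanHausdorffMeasure (d - 1))| ≤
      C * (Real.sqrt (∑ i, ∫ x in Metric.closedBall c (ρ * h), polyFun (u i) x ^ 2) *
        Real.sqrt (∑ i, ∫ x in Metric.closedBall c (ρ * h), polyFun (v i) x ^ 2)) := by
  choose C hC hle using fun j => exists_dirDeriv_sq_le d N j R hρ
  set V := volume.real (Metric.closedBall (0 : E (d - 1)) R)
  refine ⟨(∑ j ∈ Finset.range (m + 1), (Fintype.card ι * (Fintype.card (κ j) * C j)) * V) + 1,
    ?_, fun u v hu hv h hh c n hn F hF => ?_⟩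
  · have : 0 ≤ ∑ j ∈ Finset.range (m + 1), (Fintype.card ι * (Fintype.card (κ j) * C j)) * V :=
      Finset.sum_nonneg fun j _ => by have := hC j; positivity
    linarith
  obtain ⟨hfin, hreal⟩ := measure_disc (c := c) hn hh R
  set I := fun w : ι → Poly d => ∑ i, ∫ x in Metric.closedBall c (ρ * h), polyFun (w i) x ^ 2
    with hI
  have hpt : ∀ w : ι → Poly d, (∀ i, w i ∈ PP d N) → ∀ j i k, ∀ x ∈ F,
      |dirDeriv (w i) j x (dir n j k)| ≤ Real.sqrt (C j * (h ^ (2 * j + d))⁻¹) * Real.sqrt (I w) := by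
    intro w hw j i k x hx
    have h1 := hle j (w i) (hw i) h hh c x (by rw [dist_eq_norm]; exact (hF hx).2)
      (dir n j k) (hdir n hn j k)
    have h2 : ∫ x in Metric.closedBall c (ρ * h), polyFun (w i) x ^ 2 ≤ I w :=
      Finset.single_le_sum (f := fun i => ∫ x in Metric.closedBall c (ρ * h), polyFun (w i) x ^ 2)
        (fun i _ => integral_nonneg fun x => sq_nonneg _) (Finset.mem_univ i)
    rw [← Real.sqrt_mul (by have := hC j; positivity)]
    refine Real.le_sqrt_of_sq_le ?_
    rw [sq_abs]
    have h3 : h ^ (2 * j + d) * dirDeriv (w i) j x (dir n j k) ^ 2 ≤ C j * I w :=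
      h1.trans (by have := hC j; gcongr)
    rw [mul_right_comm, ← div_eq_mul_inv, le_div_iff₀ (by positivity)]
    linarith
  have hterm : ∀ j, |h ^ (2 * j + 1) * ∫ x in F, ∑ i, ∑ k,
      dirDeriv (u i) j x (dir n j k) * dirDeriv (v i) j x (dir n j k)
        ∂(Measure.euclideanHausdorffMeasure (d - 1))| ≤
      (Fintype.card ι * (Fintype.card (κ j) * C j)) * V * (Real.sqrt (I u) * Real.sqrt (I v)) := by
    intro j
    have hCj := hC j
    have hb : ∀ x ∈ F, ‖∑ i, ∑ k, dirDeriv (u i) j x (dir n j k) * dirDeriv (v i) j x (dir n j k)‖ ≤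
        Fintype.card ι * (Fintype.card (κ j) *
          (C j * (h ^ (2 * j + d))⁻¹ * (Real.sqrt (I u) * Real.sqrt (I v)))) := by
      intro x hx
      refine (norm_sum_le _ _).trans ((Finset.sum_le_card_nsmul _ _ (Fintype.card (κ j) *
          (C j * (h ^ (2 * j + d))⁻¹ * (Real.sqrt (I u) * Real.sqrt (I v)))) fun i _ => ?_).trans_eq
          (by simp))
      refine (norm_sum_le _ _).trans ((Finset.sum_le_card_nsmul _ _
          (C j * (h ^ (2 * j + d))⁻¹ * (Real.sqrt (I u) * Real.sqrt (I v))) fun k _ => ?_).trans_eq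
          (by simp))
      rw [norm_mul, Real.norm_eq_abs, Real.norm_eq_abs]
      refine (mul_le_mul (hpt u hu j i k x hx) (hpt v hv j i k x hx) (abs_nonneg _)
        (by positivity)).trans_eq ?_
      have := Real.mul_self_sqrt (show 0 ≤ C j * (h ^ (2 * j + d))⁻¹ by positivity)
      linear_combination (Real.sqrt (I u) * Real.sqrt (I v)) * this
    have h1 := norm_setIntegral_le_of_norm_le_const ((measure_mono hF).trans_lt hfin) hb
    have h2 : (Measure.euclideanHausdorffMeasure (d - 1) : Measure (E d)).real F ≤ h ^ (d - 1) * V := by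
      rw [← hreal]
      exact measureReal_mono hF hfin.ne
    rw [abs_mul, abs_of_pos (by positivity : (0 : ℝ) < h ^ (2 * j + 1)), ← Real.norm_eq_abs]
    calc _ ≤ h ^ (2 * j + 1) * (Fintype.card ι * (Fintype.card (κ j) *
          (C j * (h ^ (2 * j + d))⁻¹ * (Real.sqrt (I u) * Real.sqrt (I v)))) * (h ^ (d - 1) * V)) := by
          refine mul_le_mul_of_nonneg_left (h1.trans ?_) (by positivity)
          exact mul_le_mul_of_nonneg_left h2 (by positivity)
      _ = (h ^ (2 * j + 1) * h ^ (d - 1) * (h ^ (2 * j + d))⁻¹) *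
          ((Fintype.card ι * (Fintype.card (κ j) * C j)) * V * (Real.sqrt (I u) * Real.sqrt (I v))) := by
          ring
      _ = _ := by
          have : h ^ (2 * j + 1) * h ^ (d - 1) = h ^ (2 * j + d) := by
            rw [← pow_add]; congr 1; omega
          rw [this, mul_inv_cancel₀ (by positivity), one_mul]
  refine (Finset.abs_sum_le_sum_abs _ _).trans ((Finset.sum_le_sum fun j _ => hterm j).trans ?_)
  rw [← Finset.sum_mul]
  have : 0 ≤ Real.sqrt (I u) * Real.sqrt (I v) := by positivity
  nlinarith

end FaceUpper

end UnfittedFEM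

namespace UnfittedFEM

/-! ### Partial derivatives of smooth functions -/

section PartialDerivatives

variable {d : ℕ}

theorem partialDeriv_contDiff (i : Fin d) {φ : E d → ℝ} (hφ : ContDiff ℝ ∞ φ) :
    ContDiff ℝ ∞ (partialDeriv i φ) := by
  have h : ContDiff ℝ ∞ (fderiv ℝ φ) := hφ.fderiv_right (by simp)
  exact h.clm_apply contDiff_const

theorem iterate_partialDeriv_contDiff (i : Fin d) (k : ℕ) {φ : E d → ℝ} (hφ : ContDiff ℝ ∞ φ) :
    ContDiff ℝ ∞ ((partialDeriv i)^[k] φ) := by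
  induction k with
  | zero => simpa
  | succ k ih => rw [Function.iterate_succ_apply']; exact partialDeriv_contDiff i ih

theorem partialDeriv_comm (i k : Fin d) {φ : E d → ℝ} (hφ : ContDiff ℝ ∞ φ) :
    partialDeriv i (partialDeriv k φ) = partialDeriv k (partialDeriv i φ) := by
  have h1 : Differentiable ℝ (fderiv ℝ φ) :=
    (hφ.fderiv_right (m := ∞) (by simp)).differentiable (by simp)
  have h2 : ∀ i : Fin d, ∀ x v, fderiv ℝ (partialDeriv i φ) x v =
      fderiv ℝ (fderiv ℝ φ) x v (EuclideanSpace.single i 1) := by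
    intro i x v
    unfold partialDeriv
    rw [fderiv_clm_apply (h1 x) (differentiableAt_const _)]
    simp
  ext x
  have hs : IsSymmSndFDerivAt ℝ φ x := hφ.contDiffAt.isSymmSndFDerivAt (by
    rw [minSmoothness_of_isRCLikeNormedField]; exact WithTop.coe_le_coe.mpr le_top)
  rw [partialDeriv, h2, partialDeriv, h2]
  exact hs.eq _ _

theorem iterate_partialDeriv_comm (i k : Fin d) (j : ℕ) {φ : E d → ℝ} (hφ : ContDiff ℝ ∞ φ) :
    (partialDeriv i)^[j] (partialDeriv k φ) = partialDeriv k ((partialDeriv i)^[j] φ) := by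
  induction j with
  | zero => rfl
  | succ j ih =>
    rw [Function.iterate_succ_apply', ih, partialDeriv_comm i k
      (iterate_partialDeriv_contDiff i j hφ), Function.iterate_succ_apply']

theorem foldr_partialDeriv_contDiff (α : Fin d → ℕ) (l : List (Fin d)) {φ : E d → ℝ}
    (hφ : ContDiff ℝ ∞ φ) :
    ContDiff ℝ ∞ (l.foldr (fun i ψ => (partialDeriv i)^[α i] ψ) φ) := by
  induction l with
  | nil => simpa using hφ
  | cons k l ih => exact iterate_partialDeriv_contDiff k _ ih

theorem multiDeriv_zero (φ : E d → ℝ) : multiDeriv 0 φ = φ := by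
  unfold multiDeriv
  simp

theorem multiDeriv_add_single (α : Fin d → ℕ) (i : Fin d) {φ : E d → ℝ} (hφ : ContDiff ℝ ∞ φ) :
    multiDeriv (α + Pi.single i 1) φ = partialDeriv i (multiDeriv α φ) := by
  have h : ∀ l : List (Fin d), l.Nodup →
      (i ∉ l → l.foldr (fun k ψ => (partialDeriv k)^[(α + Pi.single i 1 : Fin d → ℕ) k] ψ) φ =
        l.foldr (fun k ψ => (partialDeriv k)^[α k] ψ) φ) ∧
      (i ∈ l → l.foldr (fun k ψ => (partialDeriv k)^[(α + Pi.single i 1 : Fin d → ℕ) k] ψ) φ =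
        partialDeriv i (l.foldr (fun k ψ => (partialDeriv k)^[α k] ψ) φ)) := by
    intro l
    induction l with
    | nil => simp
    | cons k l ih =>
      intro hl
      rw [List.nodup_cons] at hl
      obtain ⟨ih1, ih2⟩ := ih hl.2
      constructor
      · intro hi
        rw [List.mem_cons, not_or] at hi
        simp only [List.foldr_cons]
        rw [ih1 hi.2]
        simp [Pi.single_eq_of_ne (Ne.symm hi.1)]
      · intro hi
        simp only [List.foldr_cons]
        by_cases hki : k = i
        · subst hki
          rw [ih1 hl.1]
          simp only [Pi.add_apply, Pi.single_eq_same]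
          rw [Function.iterate_succ_apply']
        · have hi' : i ∈ l := by simpa [Ne.symm hki] using hi
          rw [ih2 hi']
          simp only [Pi.add_apply, Pi.single_eq_of_ne hki, add_zero]
          rw [iterate_partialDeriv_comm k i _ (foldr_partialDeriv_contDiff α l hφ)]
  exact (h _ (List.nodup_finRange d)).2 (List.mem_finRange i)

/-- The multi-index of a word. -/
def wordIndex {j : ℕ} (I : Fin j → Fin d) : Fin d → ℕ :=
  ∑ a, Pi.single (I a) 1

theorem sum_wordIndex {j : ℕ} (I : Fin j → Fin d) : ∑ i, wordIndex I i = j := by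
  unfold wordIndex
  simp only [Finset.sum_apply]
  rw [Finset.sum_comm]
  simp [Pi.single_apply]

theorem iteratedFDeriv_single_eq_multiDeriv {φ : E d → ℝ} (hφ : ContDiff ℝ ∞ φ) {j : ℕ}
    (I : Fin j → Fin d) (x : E d) :
    iteratedFDeriv ℝ j φ x (fun a => EuclideanSpace.single (I a) 1) =
      multiDeriv (wordIndex I) φ x := by
  induction j generalizing x with
  | zero => simp [wordIndex, multiDeriv_zero]
  | succ j ih =>
    have hdiff : Differentiable ℝ (iteratedFDeriv ℝ j φ) :=
      hφ.differentiable_iteratedFDeriv (by exact_mod_cast WithTop.coe_lt_top j)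
    have hw : wordIndex I = wordIndex (Fin.tail I) + Pi.single (I 0) 1 := by
      simp only [wordIndex, Fin.sum_univ_succ, Fin.tail]
      rw [add_comm]
    rw [hw, multiDeriv_add_single _ _ hφ, iteratedFDeriv_succ_apply_left, partialDeriv]
    have hfun : multiDeriv (wordIndex (Fin.tail I)) φ = fun x =>
        iteratedFDeriv ℝ j φ x (fun a => EuclideanSpace.single (Fin.tail I a) 1) :=
      funext fun x => (ih (Fin.tail I) x).symm
    rw [hfun]
    have h2 := ((ContinuousMultilinearMap.apply ℝ (fun _ : Fin j => E d) ℝ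
      (fun a => EuclideanSpace.single (Fin.tail I a) 1)).hasFDerivAt.comp x
        (hdiff x).hasFDerivAt).fderiv
    have h3 : (fun x => iteratedFDeriv ℝ j φ x fun a => EuclideanSpace.single (Fin.tail I a) 1) =
      (ContinuousMultilinearMap.apply ℝ (fun _ : Fin j => E d) ℝ
      (fun a => EuclideanSpace.single (Fin.tail I a) 1)) ∘ (iteratedFDeriv ℝ j φ) := rfl
    rw [h3, h2]
    rfl

theorem euclidean_eq_sum_single (v : E d) : v = ∑ i, v i • EuclideanSpace.single i (1 : ℝ) := by
  ext k
  simp [Finset.sum_apply, Pi.single_apply]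

theorem multilinear_eq_sum_single {j : ℕ} (T : ContinuousMultilinearMap ℝ (fun _ : Fin j => E d) ℝ)
    (v : E d) : T (fun _ => v) =
      ∑ I : Fin j → Fin d, (∏ a, v (I a)) * T (fun a => EuclideanSpace.single (I a) 1) := by
  conv_lhs => rw [euclidean_eq_sum_single v]
  rw [T.map_sum]
  refine Finset.sum_congr rfl fun I _ => ?_
  rw [T.map_smul_univ, smul_eq_mul]

theorem partialDeriv_comp_sub (i : Fin d) {φ : E d → ℝ} (hφ : ContDiff ℝ ∞ φ) (x : E d) :
    partialDeriv i (fun t => φ (x - t)) = fun t => -(partialDeriv i φ (x - t)) := by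
  ext t
  have h1 : HasFDerivAt (fun t => x - t) (-(ContinuousLinearMap.id ℝ (E d))) t := by
    simpa using (hasFDerivAt_id t).const_sub x
  have h2 := ((hφ.differentiable (by simp) (x - t)).hasFDerivAt.comp t h1).fderiv
  have h3 : (φ ∘ fun t => x - t) = fun t => φ (x - t) := rfl
  rw [h3] at h2
  simp [partialDeriv, h2]

theorem multiDeriv_comp_sub (α : Fin d → ℕ) {φ : E d → ℝ} (hφ : ContDiff ℝ ∞ φ) (x : E d) :
    multiDeriv α (fun t => φ (x - t)) = fun t => (-1) ^ (∑ i, α i) * multiDeriv α φ (x - t) := by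
  have hiter : ∀ (i : Fin d) (k : ℕ) (ψ : E d → ℝ) (c : ℝ), ContDiff ℝ ∞ ψ →
      (partialDeriv i)^[k] (fun t => c * ψ (x - t)) =
        fun t => ((-1) ^ k * c) * ((partialDeriv i)^[k] ψ) (x - t) := by
    intro i k ψ c hψ
    induction k with
    | zero => simp
    | succ k ih =>
      rw [Function.iterate_succ_apply', ih, Function.iterate_succ_apply']
      have h1 := iterate_partialDeriv_contDiff i k hψ
      have h2 := partialDeriv_comp_sub i h1 x
      ext t
      have h4 : DifferentiableAt ℝ (fun t => ((partialDeriv i)^[k] ψ) (x - t)) t :=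
        ((h1.comp (contDiff_const.sub contDiff_id)).differentiable (by simp)) t
      have h3 : partialDeriv i (fun t => ((-1) ^ k * c) * ((partialDeriv i)^[k] ψ) (x - t)) t =
          ((-1) ^ k * c) * partialDeriv i (fun t => ((partialDeriv i)^[k] ψ) (x - t)) t := by
        change fderiv ℝ _ t _ = _ * fderiv ℝ _ t _
        rw [fderiv_const_mul h4]
        simp
      rw [h3, h2]
      ring
  have hfold : ∀ l : List (Fin d), l.foldr (fun i ψ => (partialDeriv i)^[α i] ψ)
      (fun t => φ (x - t)) = fun t => (-1) ^ ((l.map α).sum) *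
        (l.foldr (fun i ψ => (partialDeriv i)^[α i] ψ) φ) (x - t) := by
    intro l
    induction l with
    | nil => simp
    | cons k l ih =>
      simp only [List.foldr_cons, List.map_cons, List.sum_cons]
      rw [ih, hiter k (α k) _ _ (foldr_partialDeriv_contDiff α l hφ)]
      simp only [pow_add]
  unfold multiDeriv
  rw [hfold]
  rw [← List.ofFn_eq_map, List.sum_ofFn]

end PartialDerivatives

/-! ### Convolutions -/

section Convolution

variable {d : ℕ}

theorem sq_integral_mul_le {X : Type*} [MeasurableSpace X] {μ : Measure X} {f g : X → ℝ}
    (hf : MemLp f 2 μ) (hg : MemLp g 2 μ) :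
    (∫ x, f x * g x ∂μ) ^ 2 ≤ (∫ x, f x ^ 2 ∂μ) * ∫ x, g x ^ 2 ∂μ := by
  have hfg : Integrable (fun x => f x * g x) μ := hf.integrable_mul hg
  have hf2 := hf.integrable_sq
  have hg2 := hg.integrable_sq
  have h : ∀ t : ℝ, 0 ≤ (∫ x, f x ^ 2 ∂μ) * (t * t) + (2 * ∫ x, f x * g x ∂μ) * t +
      ∫ x, g x ^ 2 ∂μ := by
    intro t
    have h1 : 0 ≤ ∫ x, (t * f x + g x) ^ 2 ∂μ := integral_nonneg fun x => sq_nonneg _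
    have h2 : ∫ x, (t * f x + g x) ^ 2 ∂μ =
        ∫ x, ((t * t) * f x ^ 2 + (2 * t) * (f x * g x)) + g x ^ 2 ∂μ := by
      congr 1; ext x; ring
    have h3 := integral_add (f := fun x => (t * t) * f x ^ 2 + (2 * t) * (f x * g x))
      ((hf2.const_mul (t * t)).add (hfg.const_mul (2 * t))) hg2
    rw [h2, h3, integral_add (hf2.const_mul _) (hfg.const_mul _), integral_const_mul,
      integral_const_mul] at h1
    linarith
  have := discrim_le_zero h
  unfold discrim at this
  nlinarith

/-- The convolution of a function with a kernel. -/
noncomputable def conv (f g : E d → ℝ) : E d → ℝ :=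
  MeasureTheory.convolution f g (ContinuousLinearMap.mul ℝ ℝ) volume

theorem conv_apply (f g : E d → ℝ) (x : E d) : conv f g x = ∫ t, f t * g (x - t) := rfl

theorem conv_contDiff {f g : E d → ℝ} (hf : LocallyIntegrable f) (hg : ContDiff ℝ ∞ g)
    (hcg : HasCompactSupport g) : ContDiff ℝ ∞ (conv f g) :=
  hcg.contDiff_convolution_right (n := ⊤) _ hf hg

theorem partialDeriv_hasCompactSupport (i : Fin d) {g : E d → ℝ} (hcg : HasCompactSupport g) :
    HasCompactSupport (partialDeriv i g) :=
  hcg.fderiv_apply (𝕜 := ℝ) _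

theorem partialDeriv_conv (i : Fin d) {f g : E d → ℝ} (hf : LocallyIntegrable f)
    (hg : ContDiff ℝ ∞ g) (hcg : HasCompactSupport g) :
    partialDeriv i (conv f g) = conv f (partialDeriv i g) := by
  ext x
  have h1 := hcg.hasFDerivAt_convolution_right (ContinuousLinearMap.mul ℝ ℝ) hf
    (hg.of_le (by simp)) x
  have h2 := convolution_precompR_apply (ContinuousLinearMap.mul ℝ ℝ) hf (hcg.fderiv (𝕜 := ℝ))
    (hg.continuous_fderiv (by simp)) x (EuclideanSpace.single i (1 : ℝ))
  unfold partialDeriv conv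
  rw [h1.fderiv, h2]

theorem multiDeriv_conv (α : Fin d → ℕ) {f g : E d → ℝ} (hf : LocallyIntegrable f)
    (hg : ContDiff ℝ ∞ g) (hcg : HasCompactSupport g) :
    multiDeriv α (conv f g) = conv f (multiDeriv α g) := by
  have hiter : ∀ (i : Fin d) (k : ℕ) (g : E d → ℝ), ContDiff ℝ ∞ g → HasCompactSupport g →
      (partialDeriv i)^[k] (conv f g) = conv f ((partialDeriv i)^[k] g) ∧
        HasCompactSupport ((partialDeriv i)^[k] g) := by
    intro i k g hg hcg
    induction k with
    | zero => exact ⟨rfl, hcg⟩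
    | succ k ih =>
      rw [Function.iterate_succ_apply', Function.iterate_succ_apply', ih.1,
        partialDeriv_conv i hf (iterate_partialDeriv_contDiff i k hg) ih.2]
      exact ⟨rfl, partialDeriv_hasCompactSupport i ih.2⟩
  have hfold : ∀ l : List (Fin d), l.foldr (fun i ψ => (partialDeriv i)^[α i] ψ) (conv f g) =
      conv f (l.foldr (fun i ψ => (partialDeriv i)^[α i] ψ) g) ∧
      HasCompactSupport (l.foldr (fun i ψ => (partialDeriv i)^[α i] ψ) g) := by
    intro l
    induction l with
    | nil => exact ⟨rfl, hcg⟩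
    | cons k l ih =>
      simp only [List.foldr_cons]
      rw [ih.1]
      exact hiter k _ _ (foldr_partialDeriv_contDiff α l hg) ih.2
  exact (hfold _).1

end Convolution

end UnfittedFEM

namespace UnfittedFEM

section Taylor

variable {d : ℕ}

theorem iteratedDeriv_line {W : E d → ℝ} (hW : ContDiff ℝ ∞ W) (c v : E d) (j : ℕ) (t : ℝ) :
    iteratedDeriv j (fun t : ℝ => W (c + t • v)) t = iteratedFDeriv ℝ j W (c + t • v) (fun _ => v) := by
  have h := iteratedFDeriv_comp_affine hW c (ContinuousLinearMap.toSpanSingleton ℝ v) j t (fun _ => 1)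
  simp only [ContinuousLinearMap.toSpanSingleton_apply, one_smul] at h
  rw [iteratedDeriv_eq_iteratedFDeriv, h]

/-- The homogeneous term of order `j` of the Taylor polynomial at `c`. -/
noncomputable def taylorTerm (W : E d → ℝ) (c : E d) (j : ℕ) : Poly d :=
  ∑ I : Fin j → Fin d, MvPolynomial.C
    (iteratedFDeriv ℝ j W c (fun a => EuclideanSpace.single (I a) 1)) *
      ∏ a, (MvPolynomial.X (I a) - MvPolynomial.C (c (I a)))

theorem polyFun_taylorTerm (W : E d → ℝ) (c : E d) (j : ℕ) (x : E d) :
    polyFun (taylorTerm W c j) x = iteratedFDeriv ℝ j W c (fun _ => x - c) := by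
  rw [multilinear_eq_sum_single]
  simp [taylorTerm, polyFun, mul_comm]

theorem totalDegree_taylorTerm_le (W : E d → ℝ) (c : E d) (j : ℕ) :
    (taylorTerm W c j).totalDegree ≤ j := by
  refine MvPolynomial.totalDegree_finsetSum_le fun I _ => ?_
  refine (MvPolynomial.totalDegree_mul _ _).trans ?_
  rw [MvPolynomial.totalDegree_C, zero_add]
  refine (MvPolynomial.totalDegree_finsetProd _ _).trans ?_
  refine (Finset.sum_le_sum fun a _ => (MvPolynomial.totalDegree_sub_C_le _ _).trans
    (MvPolynomial.totalDegree_X (R := ℝ) (I a)).le).trans ?_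
  simp

theorem exists_taylorPoly (s : ℕ) {W : E d → ℝ} (hW : ContDiff ℝ ∞ W) (c : E d) :
    ∃ q ∈ PP d (s - 1), ∀ (a : E d) (M : ℝ), (∀ t ∈ Icc (0 : ℝ) 1, ∀ I : Fin s → Fin d,
      |iteratedFDeriv ℝ s W (c + t • (a - c)) (fun k => EuclideanSpace.single (I k) 1)| ≤ M) →
      |W a - polyFun q a| ≤ d ^ s * ‖a - c‖ ^ s * M := by
  have hbound : ∀ (a x : E d) (M : ℝ), (∀ I : Fin s → Fin d,
      |iteratedFDeriv ℝ s W x (fun k => EuclideanSpace.single (I k) 1)| ≤ M) →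
      |iteratedFDeriv ℝ s W x (fun _ => a - c)| ≤ d ^ s * ‖a - c‖ ^ s * M := by
    intro a x M hM
    rw [multilinear_eq_sum_single]
    refine (Finset.abs_sum_le_sum_abs _ _).trans ((Finset.sum_le_card_nsmul _ _
      (‖a - c‖ ^ s * M) fun I _ => ?_).trans_eq (by simp; ring))
    rw [abs_mul, Finset.abs_prod]
    refine mul_le_mul ?_ (hM I) (abs_nonneg _) (by positivity)
    refine (Finset.prod_le_prod (fun _ _ => abs_nonneg _) fun k _ =>
      (PiLp.norm_apply_le (a - c) (I k))).trans_eq (by simp)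
  cases s with
  | zero =>
    refine ⟨0, zero_mem _, fun a M hM => ?_⟩
    have := hM 1 (by simp) (fun k => k.elim0)
    simp only [iteratedFDeriv_zero_apply, one_smul, add_sub_cancel] at this
    simpa [polyFun_zero] using this
  | succ n =>
    refine ⟨∑ j ∈ Finset.range (n + 1), ((j.factorial : ℝ)⁻¹) • taylorTerm W c j,
      Submodule.sum_mem _ fun j hj => Submodule.smul_mem _ _ ?_, fun a M hM => ?_⟩
    · rw [MvPolynomial.mem_restrictTotalDegree]
      exact (totalDegree_taylorTerm_le W c j).trans (by
        have := Finset.mem_range.mp hj; omega)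
    · have hg : ContDiff ℝ ∞ (fun t : ℝ => W (c + t • (a - c))) := hW.comp (by fun_prop)
      obtain ⟨ξ, hξ, heq⟩ := taylor_mean_remainder_lagrange_iteratedDeriv (n := n)
        (zero_ne_one (α := ℝ)) (hg.of_le (by exact_mod_cast le_top)).contDiffOn
      rw [uIoo_of_le zero_le_one] at hξ
      have hq : taylorWithinEval (fun t : ℝ => W (c + t • (a - c))) n (uIcc 0 1) 0 1 =
          polyFun (∑ j ∈ Finset.range (n + 1), ((j.factorial : ℝ)⁻¹) • taylorTerm W c j) a := by
        rw [taylor_within_apply, polyFun_sum, Finset.sum_apply]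
        refine Finset.sum_congr rfl fun j _ => ?_
        rw [iteratedDerivWithin_eq_iteratedDeriv (uniqueDiffOn_uIcc zero_ne_one)
          (hg.of_le (by exact_mod_cast le_top)).contDiffAt (by simp), iteratedDeriv_line hW,
          polyFun_smul, Pi.smul_apply, polyFun_taylorTerm]
        simp
      rw [hq, iteratedDeriv_line hW] at heq
      simp only [one_smul, add_sub_cancel, sub_zero, one_pow, mul_one] at heq
      rw [heq, abs_div]
      refine (div_le_self (abs_nonneg _) ?_).trans (hbound a _ M (hM ξ ⟨hξ.1.le, hξ.2.le⟩))
      rw [abs_of_pos (by positivity)]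
      exact_mod_cast Nat.factorial_pos (n + 1)

end Taylor

section Kernel

variable {d : ℕ}

theorem exists_reproducing_kernel (d N : ℕ) : ∃ φ : E d → ℝ, ContDiff ℝ ∞ φ ∧
    tsupport φ ⊆ Metric.closedBall 0 1 ∧
    ∀ p ∈ PP d N, ∫ y, φ y * polyFun p y = polyFun p 0 := by
  let θ : ContDiffBump (0 : E d) := ⟨1 / 2, 1, by norm_num, by norm_num⟩
  have hcont : ∀ p q : Poly d, Continuous fun y => θ y * (polyFun p y * polyFun q y) :=
    fun p q => θ.continuous.mul ((polyFun_continuous p).mul (polyFun_continuous q))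
  have hint : ∀ p q : Poly d, Integrable fun y => θ y * (polyFun p y * polyFun q y) := fun p q =>
    (hcont p q).integrable_of_hasCompactSupport θ.hasCompactSupport.mul_right
  let B : PP d N →ₗ[ℝ] Module.Dual ℝ (PP d N) := LinearMap.mk₂ ℝ
    (fun p q => ∫ y, θ y * (polyFun (p : Poly d) y * polyFun (q : Poly d) y))
    (fun p p' q => by
      rw [← integral_add (hint _ _) (hint _ _)]
      congr 1; ext y; simp [polyFun_add]; ring)
    (fun a p q => by
      rw [smul_eq_mul, ← integral_const_mul]
      congr 1; ext y; simp [polyFun_smul]; ring)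
    (fun p q q' => by
      rw [← integral_add (hint _ _) (hint _ _)]
      congr 1; ext y; simp [polyFun_add]; ring)
    (fun a p q => by
      rw [smul_eq_mul, ← integral_const_mul]
      congr 1; ext y; simp [polyFun_smul]; ring)
  have hB : ∀ p q, B p q = ∫ y, θ y * (polyFun (p : Poly d) y * polyFun (q : Poly d) y) := fun p q => rfl
  have hinj : Function.Injective B := by
    rw [injective_iff_map_eq_zero]
    intro p hp
    have h0 : ∫ y, θ y * (polyFun (p : Poly d) y * polyFun (p : Poly d) y) = 0 := by rw [← hB, hp]; rfl
    have hnn : ∀ y, 0 ≤ θ y * (polyFun (p : Poly d) y * polyFun (p : Poly d) y) := fun y =>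
      mul_nonneg θ.nonneg (mul_self_nonneg _)
    rw [integral_eq_zero_iff_of_nonneg hnn (hint _ _)] at h0
    have h1 := (hcont p p).ae_eq_iff_eq
      volume continuous_const |>.mp h0
    refine Subtype.ext (eq_zero_of_polyFun_eq_zero (c := 0) (r := 1 / 2) (by norm_num)
      fun x hx => ?_)
    have h2 : θ x * (polyFun (p : Poly d) x * polyFun (p : Poly d) x) = 0 := congrFun h1 x
    have h3 : θ x = 1 := θ.one_of_mem_closedBall hx
    simpa [h3] using h2
  have hsurj : Function.Surjective B :=
    (LinearMap.injective_iff_surjective_of_finrank_eq_finrank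
      Subspace.dual_finrank_eq.symm).mp hinj
  let ev : Module.Dual ℝ (PP d N) :=
    { toFun := fun p => polyFun (p : Poly d) 0
      map_add' := fun p q => by simp [polyFun_add]
      map_smul' := fun a p => by simp [polyFun_smul] }
  obtain ⟨q, hq⟩ := hsurj ev
  refine ⟨fun y => θ y * polyFun (q : Poly d) y, θ.contDiff.mul (polyFun_contDiff _), ?_, ?_⟩
  · refine (tsupport_mul_subset_left).trans ?_
    rw [θ.tsupport_eq]
  · intro p hp
    have h1 : B q ⟨p, hp⟩ = polyFun p 0 := by rw [hq]; rfl
    rw [hB] at h1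
    rw [← h1]
    congr 1; ext y; simp; ring

/-- The scaled kernel. -/
noncomputable def scaledKernel (φ : E d → ℝ) (δ : ℝ) : E d → ℝ :=
  fun y => (δ ^ d)⁻¹ * φ (δ⁻¹ • y)

variable {φ : E d → ℝ} {δ : ℝ}

theorem scaledKernel_contDiff (hφ : ContDiff ℝ ∞ φ) : ContDiff ℝ ∞ (scaledKernel φ δ) :=
  contDiff_const.mul (hφ.comp (by fun_prop))

theorem scaledKernel_tsupport (hδ : 0 < δ) (hφ : tsupport φ ⊆ Metric.closedBall 0 1) :
    tsupport (scaledKernel φ δ) ⊆ Metric.closedBall 0 δ := by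
  refine closure_minimal (fun y hy => ?_) Metric.isClosed_closedBall
  have h1 : φ (δ⁻¹ • y) ≠ 0 := right_ne_zero_of_mul hy
  have h2 := hφ (subset_tsupport _ h1)
  rw [mem_closedBall_zero_iff, norm_smul, norm_inv, Real.norm_eq_abs, abs_of_pos hδ,
    inv_mul_le_iff₀ hδ, mul_one] at h2
  simpa using h2

theorem scaledKernel_hasCompactSupport (hδ : 0 < δ) (hφ : tsupport φ ⊆ Metric.closedBall 0 1) :
    HasCompactSupport (scaledKernel φ δ) :=
  (isCompact_closedBall _ _).of_isClosed_subset (isClosed_tsupport _) (scaledKernel_tsupport hδ hφ)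

theorem integral_scaledKernel (hδ : 0 < δ) (F : E d → ℝ → ℝ) (x : E d) :
    ∫ t, F t (φ (δ⁻¹ • (x - t))) = δ ^ d * ∫ z, F (x - δ • z) (φ z) := by
  have h1 := integral_sub_left_eq_self (fun y => F (x - y) (φ (δ⁻¹ • y))) volume x
  simp only [sub_sub_cancel] at h1
  have h2 := Measure.integral_comp_smul_of_nonneg (volume : Measure (E d))
    (fun y => F (x - y) (φ (δ⁻¹ • y))) δ (hR := hδ.le)
  simp only [smul_smul, inv_mul_cancel₀ hδ.ne', one_smul, finrank_euclideanSpace, Fintype.card_fin,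
    smul_eq_mul] at h2
  rw [h1, h2, ← mul_assoc, mul_inv_cancel₀ (by positivity), one_mul]

theorem scaledKernel_reproduces {N : ℕ} (hδ : 0 < δ)
    (hφ : ∀ p ∈ PP d N, ∫ y, φ y * polyFun p y = polyFun p 0) {p : Poly d} (hp : p ∈ PP d N)
    (x : E d) : ∫ t, polyFun p t * scaledKernel φ δ (x - t) = polyFun p x := by
  have h1 := integral_scaledKernel (φ := φ) hδ (fun t r => polyFun p t * ((δ ^ d)⁻¹ * r)) x
  have h2 := hφ _ (affSub_mem_PP x (-δ) hp)
  simp only [polyFun_affSub, smul_zero, add_zero, neg_smul, ← sub_eq_add_neg] at h2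
  unfold scaledKernel
  rw [h1, ← h2, ← integral_const_mul]
  congr 1; ext z
  field_simp

theorem integral_scaledKernel_sq (hδ : 0 < δ) (x : E d) :
    ∫ t, scaledKernel φ δ (x - t) ^ 2 = (δ ^ d)⁻¹ * ∫ y, φ y ^ 2 := by
  have h1 := integral_scaledKernel (φ := φ) hδ (fun t r => ((δ ^ d)⁻¹ * r) ^ 2) x
  unfold scaledKernel
  rw [h1]
  simp only [mul_pow]
  rw [integral_const_mul]
  field_simp

end Kernel

end UnfittedFEM

namespace UnfittedFEM

section DenyLions

variable {d : ℕ}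

theorem kernel_comp_sub_memLp {ψ : E d → ℝ} (hψ : ContDiff ℝ ∞ ψ) (hc : HasCompactSupport ψ)
    (x : E d) (B : Set (E d)) : MemLp (fun t => ψ (x - t)) 2 (volume.restrict B) := by
  have h1 : HasCompactSupport fun t => ψ (x - t) := hc.comp_homeomorph (Homeomorph.subLeft x)
  have h2 : Continuous fun t => ψ (x - t) := by have := hψ.continuous; fun_prop
  exact (h2.memLp_of_hasCompactSupport h1).restrict B

theorem kernel_comp_sub_eq_zero {ψ : E d → ℝ} {δ : ℝ} (hs : tsupport ψ ⊆ Metric.closedBall 0 δ)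
    {x t : E d} (ht : t ∉ Metric.closedBall x δ) : ψ (x - t) = 0 := by
  by_contra h
  have := hs (subset_tsupport _ h)
  rw [mem_closedBall_zero_iff, ← dist_eq_norm, dist_comm] at this
  exact ht this

theorem sq_setIntegral_kernel_le {φ : E d → ℝ} (hφ : ContDiff ℝ ∞ φ)
    (hs : tsupport φ ⊆ Metric.closedBall 0 1) {δ : ℝ} (hδ : 0 < δ) {B : Set (E d)} {f : E d → ℝ}
    (hf : MemLp f 2 (volume.restrict B)) (x : E d) :
    (∫ t in B, f t * scaledKernel φ δ (x - t)) ^ 2 ≤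
      (∫ t in B, f t ^ 2) * ((δ ^ d)⁻¹ * ∫ y, φ y ^ 2) := by
  have hψ := scaledKernel_contDiff (δ := δ) hφ
  have hc := scaledKernel_hasCompactSupport hδ hs
  refine (sq_integral_mul_le hf (kernel_comp_sub_memLp hψ hc x B)).trans ?_
  refine mul_le_mul_of_nonneg_left ?_ (integral_nonneg fun _ => sq_nonneg _)
  rw [← integral_scaledKernel_sq hδ x]
  have h1 := (kernel_comp_sub_memLp hψ hc x univ).integrable_sq
  rw [Measure.restrict_univ] at h1
  exact setIntegral_le_integral h1 (Filter.Eventually.of_forall fun _ => sq_nonneg _)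

/-- A function with weak derivatives of order `s` is close to one polynomial of degree less than `s`
in a ball, when compared with polynomials that approximate it on smaller balls. -/
theorem exists_polynomial_approximation (d N s : ℕ) : ∃ C : ℝ, 0 < C ∧
    ∀ (U : Set (E d)), IsOpen U → ∀ (w : E d → ℝ), MemLp w 2 (volume.restrict U) →
    ∀ G : (Fin d → ℕ) → E d → ℝ, (∀ α, ∑ i, α i = s →
      MemLp (G α) 2 (volume.restrict U) ∧ HasWeakDeriv U α w (G α)) →
    ∀ (c : E d) (r : ℝ), 0 < r → Metric.closedBall c r ⊆ U →
    ∃ q ∈ PP d (s - 1), ∀ p ∈ PP d N, ∀ a, dist a c ≤ 3 / 4 * r →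
      ∫ x in Metric.closedBall a (r / 8), polyFun (p - q) x ^ 2 ≤
        C * ((∫ x in Metric.closedBall a (r / 4), (w x - polyFun p x) ^ 2) +
          r ^ (2 * s) * ∑ α ∈ Finset.piAntidiag (Finset.univ : Finset (Fin d)) s,
            ∫ x in Metric.closedBall c r, G α x ^ 2) := by
  obtain ⟨φ, hφ, hs, hrep⟩ := exists_reproducing_kernel d N
  set Φ := ∫ y, φ y ^ 2
  have hΦ : 0 ≤ Φ := integral_nonneg fun _ => sq_nonneg _
  set v := volume.real (Metric.closedBall (0 : E d) 1)
  refine ⟨2 * v * Φ * (1 + (d : ℝ) ^ (2 * s)) + 1, by positivity, ?_⟩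
  intro U hU w hw G hG c r hr hcU
  set δ := r / 8
  have hδ : 0 < δ := by positivity
  set ψ := scaledKernel φ δ
  have hψ : ContDiff ℝ ∞ ψ := scaledKernel_contDiff hφ
  have hψc : HasCompactSupport ψ := scaledKernel_hasCompactSupport hδ hs
  have hψs : tsupport ψ ⊆ Metric.closedBall 0 δ := scaledKernel_tsupport hδ hs
  set w0 := U.indicator w
  have hw0 : LocallyIntegrable w0 :=
    ((memLp_indicator_iff_restrict hU.measurableSet).mpr hw).locallyIntegrable (by norm_num)
  set W := conv w0 ψ
  have hW : ContDiff ℝ ∞ W := conv_contDiff hw0 hψ hψc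
  set S := ∑ α ∈ Finset.piAntidiag (Finset.univ : Finset (Fin d)) s,
    ∫ x in Metric.closedBall c r, G α x ^ 2
  have hS : 0 ≤ S := Finset.sum_nonneg fun α _ => integral_nonneg fun _ => sq_nonneg _
  obtain ⟨q, hq, hWq⟩ := exists_taylorPoly s hW c
  refine ⟨q, hq, fun p hp a ha => ?_⟩
  have hball : ∀ x, dist x c ≤ 7 / 8 * r → Metric.closedBall x δ ⊆ Metric.closedBall c r :=
    fun x hx => Metric.closedBall_subset_closedBall' (by simp only [δ]; linarith)
  have hsupp : ∀ x, ∀ B B' : Set (E d), Metric.closedBall x δ ⊆ B' → B' ⊆ B → MeasurableSet B →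
      ∀ f : E d → ℝ, ∫ t in B, f t * ψ (x - t) = ∫ t in B', f t * ψ (x - t) := by
    intro x B B' hB' hBB hB f
    refine setIntegral_eq_of_subset_of_forall_sdiff_eq_zero hB hBB fun t ht => ?_
    rw [kernel_comp_sub_eq_zero hψs fun h => ht.2 (hB' h), mul_zero]
  -- derivatives of the mollified function
  have hderiv : ∀ x, dist x c ≤ 7 / 8 * r → ∀ I : Fin s → Fin d,
      |iteratedFDeriv ℝ s W x (fun k => EuclideanSpace.single (I k) 1)| ≤
        Real.sqrt (S * ((δ ^ d)⁻¹ * Φ)) := by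
    intro x hx I
    set α := wordIndex I
    have hα : ∑ i, α i = s := sum_wordIndex I
    obtain ⟨hGm, hGw⟩ := hG α hα
    have hxU : Metric.closedBall x δ ⊆ U := (hball x hx).trans hcU
    have htest : IsTestFunction U fun t => ψ (x - t) := by
      refine ⟨hψ.comp (by fun_prop), hψc.comp_homeomorph (Homeomorph.subLeft x), ?_⟩
      refine (closure_minimal (fun t ht => ?_) Metric.isClosed_closedBall).trans hxU
      by_contra h
      exact ht (kernel_comp_sub_eq_zero hψs h)
    have h1 := hGw _ htest
    rw [multiDeriv_comp_sub α hψ, hα] at h1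
    have h2 : iteratedFDeriv ℝ s W x (fun k => EuclideanSpace.single (I k) 1) =
        ∫ t in U, w t * multiDeriv α ψ (x - t) := by
      rw [iteratedFDeriv_single_eq_multiDeriv hW, multiDeriv_conv α hw0 hψ hψc, conv_apply,
        ← integral_indicator hU.measurableSet]
      congr 1; ext t
      by_cases ht : t ∈ U <;> simp [w0, ht]
    have h3 : (∫ t in U, w t * multiDeriv α ψ (x - t)) = ∫ t in U, G α t * ψ (x - t) := by
      have h4 : (∫ t in U, w t * ((-1) ^ s * multiDeriv α ψ (x - t))) =
          (-1) ^ s * ∫ t in U, w t * multiDeriv α ψ (x - t) := by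
        rw [← integral_const_mul]; congr 1; ext t; ring
      rw [h4] at h1
      exact mul_left_cancel₀ (pow_ne_zero s (by norm_num)) h1
    rw [h2, h3, hsupp x U _ (hball x hx) hcU hU.measurableSet]
    refine Real.abs_le_sqrt ((sq_setIntegral_kernel_le hφ hs hδ
      (hGm.mono_measure (Measure.restrict_mono hcU le_rfl)) x).trans ?_)
    refine mul_le_mul_of_nonneg_right ?_ (by positivity)
    exact Finset.single_le_sum (f := fun α => ∫ x in Metric.closedBall c r, G α x ^ 2)
      (fun α _ => integral_nonneg fun _ => sq_nonneg _) (by simpa using hα)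
  -- pointwise comparison
  have hpt : ∀ x ∈ Metric.closedBall a δ, polyFun (p - q) x ^ 2 ≤
      2 * ((δ ^ d)⁻¹ * Φ) * ((∫ x in Metric.closedBall a (r / 4), (w x - polyFun p x) ^ 2) +
        (d : ℝ) ^ (2 * s) * (r ^ (2 * s) * S)) := by
    intro x hx
    rw [Metric.mem_closedBall] at hx
    have hxc : dist x c ≤ 7 / 8 * r := (dist_triangle x a c).trans (by simp only [δ] at hx; linarith)
    have haU : Metric.closedBall a (r / 4) ⊆ U :=
      (Metric.closedBall_subset_closedBall' (by linarith)).trans hcU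
    have hxa : Metric.closedBall x δ ⊆ Metric.closedBall a (r / 4) :=
      Metric.closedBall_subset_closedBall' (by simp only [δ] at hx ⊢; linarith)
    have hw' : MemLp w 2 (volume.restrict (Metric.closedBall a (r / 4))) :=
      hw.mono_measure (Measure.restrict_mono haU le_rfl)
    have hp' : MemLp (polyFun p) 2 (volume.restrict (Metric.closedBall a (r / 4))) := by
      rw [memLp_two_iff_integrable_sq (polyFun_continuous p).aestronglyMeasurable]
      exact polyFun_sq_integrableOn p Metric.isBounded_closedBall
    have hk := kernel_comp_sub_memLp hψ hψc x (Metric.closedBall a (r / 4))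
    have h1 : W x - polyFun p x =
        ∫ t in Metric.closedBall a (r / 4), (w t - polyFun p t) * ψ (x - t) := by
      have e1 : W x = ∫ t in Metric.closedBall a (r / 4), w t * ψ (x - t) := by
        rw [← hsupp x U _ hxa haU hU.measurableSet, ← integral_indicator hU.measurableSet]
        change ∫ t, w0 t * ψ (x - t) = _
        congr 1; ext t
        by_cases ht : t ∈ U <;> simp [w0, ht]
      have e2 : polyFun p x = ∫ t in Metric.closedBall a (r / 4), polyFun p t * ψ (x - t) := by
        rw [← hsupp x univ _ hxa (subset_univ _) MeasurableSet.univ, Measure.restrict_univ]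
        exact (scaledKernel_reproduces hδ hrep hp x).symm
      have e3 := integral_sub (hw'.integrable_mul hk) (hp'.integrable_mul hk)
      simp only [Pi.mul_apply] at e3
      rw [e1, e2, ← e3]
      congr 1; ext t; ring
    have h2 : (W x - polyFun p x) ^ 2 ≤
        (∫ t in Metric.closedBall a (r / 4), (w t - polyFun p t) ^ 2) * ((δ ^ d)⁻¹ * Φ) := by
      rw [h1]
      exact sq_setIntegral_kernel_le hφ hs hδ (hw'.sub hp') x
    have h3 : |W x - polyFun q x| ≤ d ^ s * ‖x - c‖ ^ s * Real.sqrt (S * ((δ ^ d)⁻¹ * Φ)) := by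
      refine hWq x _ fun t ht I => hderiv _ ?_ I
      rw [dist_eq_norm, add_sub_cancel_left, norm_smul, Real.norm_eq_abs, abs_of_nonneg ht.1,
        ← dist_eq_norm]
      calc t * dist x c ≤ 1 * dist x c := by gcongr; exact ht.2
        _ ≤ _ := by rw [one_mul]; exact hxc
    have h4 : (W x - polyFun q x) ^ 2 ≤ (d : ℝ) ^ (2 * s) * (r ^ (2 * s) * S) * ((δ ^ d)⁻¹ * Φ) := by
      rw [← sq_abs]
      have hn : ‖x - c‖ ≤ r := by rw [← dist_eq_norm]; linarith
      have h5 : |W x - polyFun q x| ≤ d ^ s * r ^ s * Real.sqrt (S * ((δ ^ d)⁻¹ * Φ)) :=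
        h3.trans (by gcongr)
      refine (pow_le_pow_left₀ (abs_nonneg _) h5 2).trans_eq ?_
      rw [mul_pow, Real.sq_sqrt (by positivity)]
      ring
    rw [polyFun_sub, Pi.sub_apply]
    have h6 : (polyFun p x - polyFun q x) ^ 2 ≤
        2 * (W x - polyFun p x) ^ 2 + 2 * (W x - polyFun q x) ^ 2 := by
      nlinarith [sq_nonneg ((W x - polyFun p x) + (W x - polyFun q x))]
    refine h6.trans ((add_le_add (mul_le_mul_of_nonneg_left h2 zero_le_two)
      (mul_le_mul_of_nonneg_left h4 zero_le_two)).trans_eq ?_)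
    ring
  set J := ∫ x in Metric.closedBall a (r / 4), (w x - polyFun p x) ^ 2
  have hJ : 0 ≤ J := integral_nonneg fun _ => sq_nonneg _
  have hint : ∫ x in Metric.closedBall a δ, polyFun (p - q) x ^ 2 ≤
      ∫ x in Metric.closedBall a δ, 2 * ((δ ^ d)⁻¹ * Φ) * (J + (d : ℝ) ^ (2 * s) * (r ^ (2 * s) * S)) :=
    setIntegral_mono_on (polyFun_sq_integrableOn _ Metric.isBounded_closedBall)
      (integrableOn_const measure_closedBall_lt_top.ne) measurableSet_closedBall hpt
  refine hint.trans ?_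
  have hvol : volume.real (Metric.closedBall a δ) = δ ^ d * v := by
    have := setIntegral_closedBall_scale a hδ 1 fun _ => 1
    rw [one_mul, setIntegral_const, setIntegral_const] at this
    simpa using this
  rw [setIntegral_const, hvol, smul_eq_mul]
  have hT : 0 ≤ r ^ (2 * s) * S := by positivity
  have hv : 0 ≤ v := measureReal_nonneg
  have hD : (0 : ℝ) ≤ (d : ℝ) ^ (2 * s) := by positivity
  calc δ ^ d * v * (2 * ((δ ^ d)⁻¹ * Φ) * (J + (d : ℝ) ^ (2 * s) * (r ^ (2 * s) * S)))
      = 2 * v * Φ * (J + (d : ℝ) ^ (2 * s) * (r ^ (2 * s) * S)) := by field_simp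
    _ ≤ 2 * v * Φ * ((1 + (d : ℝ) ^ (2 * s)) * (J + r ^ (2 * s) * S)) := by
        refine mul_le_mul_of_nonneg_left ?_ (by positivity)
        nlinarith [mul_nonneg hD hJ]
    _ ≤ _ := by nlinarith

end DenyLions

end UnfittedFEM

namespace UnfittedFEM

/-! ### Norms -/

section Norms

variable {d : ℕ}

theorem l2norm_nonneg {F : Type*} [NormedAddCommGroup F] (U : Set (E d)) (f : E d → F) :
    0 ≤ l2norm U f := ENNReal.toReal_nonneg

theorem l2norm_sq_eq {F : Type*} [NormedAddCommGroup F] {U : Set (E d)} {f : E d → F}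
    (hf : MemLp f 2 (volume.restrict U)) : l2norm U f ^ 2 = ∫ x in U, ‖f x‖ ^ 2 := by
  unfold l2norm
  rw [hf.eLpNorm_eq_integral_rpow_norm (by norm_num) (by norm_num)]
  have h0 : 0 ≤ ∫ x in U, ‖f x‖ ^ (2 : ℝ) :=
    integral_nonneg fun x => by positivity
  simp only [ENNReal.toReal_ofNat, Real.rpow_ofNat] at h0 ⊢
  rw [ENNReal.toReal_ofReal (by positivity), ← Real.rpow_natCast, ← Real.rpow_mul h0]
  norm_num

theorem l2norm_sq_eq_real {U : Set (E d)} {f : E d → ℝ}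
    (hf : MemLp f 2 (volume.restrict U)) : l2norm U f ^ 2 = ∫ x in U, f x ^ 2 := by
  rw [l2norm_sq_eq hf]
  simp

theorem l2norm_mono {F : Type*} [NormedAddCommGroup F] {U V : Set (E d)} (h : U ⊆ V) {f : E d → F}
    (hf : MemLp f 2 (volume.restrict V)) : l2norm U f ≤ l2norm V f :=
  ENNReal.toReal_mono hf.2.ne (eLpNorm_mono_measure f (Measure.restrict_mono h le_rfl))

end Norms

/-! ### Weak derivatives -/

section WeakDerivatives

variable {d : ℕ} {U V : Set (E d)}

theorem weakDeriv_spec {s : ℕ} {f : E d → ℝ} (hf : MemSobolev U s f) {α : Fin d → ℕ}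
    (hα : ∑ i, α i ≤ s) :
    MemLp (weakDeriv U α f) 2 (volume.restrict U) ∧ HasWeakDeriv U α f (weakDeriv U α f) :=
  Classical.epsilon_spec (hf.2 α hα)

theorem HasWeakDeriv.ae_eq {α : Fin d → ℕ} {f g g' : E d → ℝ} (hU : IsOpen U)
    (hg : MemLp g 2 (volume.restrict U)) (hg' : MemLp g' 2 (volume.restrict U))
    (h : HasWeakDeriv U α f g) (h' : HasWeakDeriv U α f g') : g =ᵐ[volume.restrict U] g' := by
  have hm := hg.sub hg'
  have hloc : LocallyIntegrableOn (g - g') U volume := by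
    have h1 : LocallyIntegrable (U.indicator (g - g')) volume :=
      ((memLp_indicator_iff_restrict hU.measurableSet).mpr hm).locallyIntegrable (by norm_num)
    rw [locallyIntegrableOn_iff hU.isLocallyClosed]
    intro K hK hKc
    refine (h1.integrableOn_isCompact hKc).congr_fun (fun x hx => ?_) hKc.measurableSet
    simp [hK hx]
  have hz := hU.ae_eq_zero_of_integral_contDiff_smul_eq_zero hloc (fun φ hφ hφc hφs => ?_)
  · rw [Filter.EventuallyEq, ae_restrict_iff' hU.measurableSet]
    filter_upwards [hz] with x hx hxU
    have := hx hxU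
    simpa [sub_eq_zero] using this
  · have h1 := h φ ⟨hφ, hφc, hφs⟩
    have h2 := h' φ ⟨hφ, hφc, hφs⟩
    have h3 : ∫ x in U, g x * φ x = ∫ x in U, g' x * φ x :=
      mul_left_cancel₀ (pow_ne_zero (∑ i, α i) (by norm_num : (-1 : ℝ) ≠ 0)) (h1.symm.trans h2)
    have hφm : MemLp φ 2 (volume.restrict U) :=
      (hφ.continuous.memLp_of_hasCompactSupport hφc).restrict U
    have h4 : ∫ x, φ x • (g - g') x = ∫ x in U, φ x • (g - g') x := by
      refine (setIntegral_eq_integral_of_forall_compl_eq_zero fun x hx => ?_).symm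
      rw [image_eq_zero_of_notMem_tsupport fun h => hx (hφs h), zero_smul]
    have h5 := integral_sub (hg.integrable_mul hφm) (hg'.integrable_mul hφm)
    simp only [Pi.mul_apply] at h5
    rw [h3, sub_self] at h5
    rw [h4, ← h5]
    congr 1; ext x; simp; ring

theorem HasWeakDeriv.mono (hV : IsOpen V) (hUV : U ⊆ V) {α : Fin d → ℕ}
    {f g : E d → ℝ} (h : HasWeakDeriv V α f g) : HasWeakDeriv U α f g := by
  intro φ hφ
  have hφV : IsTestFunction V φ := ⟨hφ.1, hφ.2.1, hφ.2.2.trans hUV⟩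
  have h0 : ∀ x, x ∉ U → φ =ᶠ[nhds x] 0 := fun x hx =>
    notMem_tsupport_iff_eventuallyEq.mp fun h => hx (hφ.2.2 h)
  have hsupp : ∀ x, x ∉ U → multiDeriv α φ =ᶠ[nhds x] 0 := by
    intro x hx
    have hiter : ∀ (i : Fin d) (k : ℕ) (ψ : E d → ℝ), ψ =ᶠ[nhds x] 0 →
        (partialDeriv i)^[k] ψ =ᶠ[nhds x] 0 := by
      intro i k ψ hψ
      induction k with
      | zero => exact hψ
      | succ k ih =>
        rw [Function.iterate_succ_apply']
        have := ih.fderiv (𝕜 := ℝ)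
        filter_upwards [this] with y hy
        simp [partialDeriv, hy]
    have hfold : ∀ l : List (Fin d),
        l.foldr (fun i ψ => (partialDeriv i)^[α i] ψ) φ =ᶠ[nhds x] 0 := by
      intro l
      induction l with
      | nil => exact h0 x hx
      | cons k l ih => exact hiter k _ _ ih
    exact hfold _
  have e1 : ∀ F : E d → ℝ, (∀ x, x ∉ U → F x = 0) → ∫ x in U, F x = ∫ x in V, F x := by
    intro F hF
    exact (setIntegral_eq_of_subset_of_forall_sdiff_eq_zero hV.measurableSet hUV
      fun x hx => hF x hx.2).symm
  rw [e1 _ fun x hx => by rw [(hsupp x hx).self_of_nhds]; simp,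
    e1 _ fun x hx => by rw [(h0 x hx).self_of_nhds]; simp]
  exact h φ hφV

theorem MemSobolev.mono (hV : IsOpen V) (hUV : U ⊆ V) {s : ℕ} {f : E d → ℝ}
    (h : MemSobolev V s f) : MemSobolev U s f :=
  ⟨h.1.mono_measure (Measure.restrict_mono hUV le_rfl), fun α hα => by
    obtain ⟨g, hg, hw⟩ := h.2 α hα
    exact ⟨g, hg.mono_measure (Measure.restrict_mono hUV le_rfl), hw.mono hV hUV⟩⟩

theorem sobolevNorm_nonneg (s : ℕ) (f : E d → ℝ) : 0 ≤ sobolevNorm U s f := Real.sqrt_nonneg _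

theorem sobolevNorm_sq (s : ℕ) (f : E d → ℝ) : sobolevNorm U s f ^ 2 =
    ∑ j ∈ Finset.range (s + 1), ∑ α ∈ Finset.piAntidiag (Finset.univ : Finset (Fin d)) j,
      l2norm U (weakDeriv U α f) ^ 2 :=
  Real.sq_sqrt (Finset.sum_nonneg fun _ _ => Finset.sum_nonneg fun _ _ => sq_nonneg _)

theorem sobolevNorm_mono (hU : IsOpen U) (hV : IsOpen V) (hUV : U ⊆ V) {s : ℕ} {f : E d → ℝ}
    (h : MemSobolev V s f) : sobolevNorm U s f ≤ sobolevNorm V s f := by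
  refine Real.sqrt_le_sqrt (Finset.sum_le_sum fun j hj => Finset.sum_le_sum fun α hα => ?_)
  have hα' : ∑ i, α i ≤ s := by
    have h1 : ∑ i, α i = j := by simpa using hα
    have := Finset.mem_range.mp hj
    omega
  refine pow_le_pow_left₀ (l2norm_nonneg _ _) ?_ 2
  obtain ⟨hV1, hV2⟩ := weakDeriv_spec h hα'
  obtain ⟨hU1, hU2⟩ := weakDeriv_spec (h.mono hV hUV) hα'
  have hae := HasWeakDeriv.ae_eq hU hU1
    (hV1.mono_measure (Measure.restrict_mono hUV le_rfl)) hU2 (hV2.mono hV hUV)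
  have : l2norm U (weakDeriv U α f) = l2norm U (weakDeriv V α f) := by
    unfold l2norm; rw [eLpNorm_congr_ae hae]
  rw [this]
  exact l2norm_mono hUV hV1

/-- The integrals of the squared weak derivatives of order `s` are bounded by the Sobolev norm. -/
theorem sum_integral_weakDeriv_sq_le {s : ℕ} {f : E d → ℝ} (h : MemSobolev U s f) :
    ∑ α ∈ Finset.piAntidiag (Finset.univ : Finset (Fin d)) s, ∫ x in U, weakDeriv U α f x ^ 2 ≤
      sobolevNorm U s f ^ 2 := by
  rw [sobolevNorm_sq]
  have h1 : ∑ α ∈ Finset.piAntidiag (Finset.univ : Finset (Fin d)) s,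
      ∫ x in U, weakDeriv U α f x ^ 2 =
      ∑ α ∈ Finset.piAntidiag (Finset.univ : Finset (Fin d)) s, l2norm U (weakDeriv U α f) ^ 2 := by
    refine Finset.sum_congr rfl fun α hα => ?_
    have hα' : ∑ i, α i = s := by simpa using hα
    rw [l2norm_sq_eq_real (weakDeriv_spec h hα'.le).1]
  rw [h1]
  exact Finset.single_le_sum (f := fun j =>
    ∑ α ∈ Finset.piAntidiag (Finset.univ : Finset (Fin d)) j, l2norm U (weakDeriv U α f) ^ 2)
    (fun j _ => Finset.sum_nonneg fun _ _ => sq_nonneg _) (Finset.self_mem_range_succ s)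

end WeakDerivatives

end UnfittedFEM

namespace UnfittedFEM

/-! ### Geometry of facets -/

section Facets

variable {d : ℕ}

/-- A convex set that contains a disc and a point on one side of it contains a half ball. -/
theorem halfBall_subset {T : Set (E d)} (hT : Convex ℝ T) {n c z : E d} {ρ H D ε : ℝ}
    (hdisc : disc c n ρ ⊆ T) (hz : z ∈ T) (hH : 0 < H) (hzH : inner ℝ n (z - c) = -H)
    (hD : ‖z - c‖ ≤ D) (hε : 2 * ε ≤ H) (hε2 : 2 * ε * (H + D) ≤ ρ * H) (hn : ‖n‖ = 1) :
    ∀ x, ‖x - c‖ ≤ ε → inner ℝ n (x - c) ≤ (0 : ℝ) → x ∈ T := by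
  intro x hx hxn
  have hε0 : 0 ≤ ε := (norm_nonneg _).trans hx
  have hD0 : 0 ≤ D := (norm_nonneg _).trans hD
  set t := -inner ℝ n (x - c) with ht
  have ht0 : 0 ≤ t := by linarith
  have htε : t ≤ ε := by
    have := (abs_real_inner_le_norm n (x - c))
    rw [hn, one_mul] at this
    linarith [neg_abs_le (inner ℝ n (x - c))]
  set l := t / H with hl
  have hl0 : 0 ≤ l := by positivity
  have hlε : l * H ≤ ε := by rw [hl, div_mul_cancel₀ _ hH.ne']; exact htε
  have hl2 : l ≤ 1 / 2 := by
    rw [hl, div_le_iff₀ hH]; linarith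
  have h1l : 0 < 1 - l := by linarith
  set y := c + (1 - l)⁻¹ • ((x - c) - l • (z - c)) with hy
  have hxy : x = (1 - l) • y + l • z := by
    rw [hy, smul_add, smul_smul, mul_inv_cancel₀ h1l.ne']
    module
  have hyT : y ∈ T := by
    refine hdisc ⟨?_, ?_⟩
    · rw [hy, add_sub_cancel_left, inner_smul_right, inner_sub_right, inner_smul_right, hzH]
      have : inner ℝ n (x - c) = -t := by rw [ht]; ring
      rw [this, hl]
      field_simp
      ring
    · rw [hy, add_sub_cancel_left, norm_smul, Real.norm_eq_abs, abs_of_pos (by positivity),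
        inv_mul_le_iff₀ h1l]
      have h1 : ‖(x - c) - l • (z - c)‖ ≤ ε + l * D := by
        refine (norm_sub_le _ _).trans (add_le_add hx ?_)
        rw [norm_smul, Real.norm_eq_abs, abs_of_nonneg hl0]
        gcongr
      have h2 : (ε + l * D) * H ≤ ε * (H + D) := by nlinarith
      have hρ : 0 ≤ ρ := by
        by_contra hneg
        have : ρ * H < 0 := mul_neg_of_neg_of_pos (not_le.mp hneg) hH
        have : 0 ≤ 2 * ε * (H + D) := by positivity
        linarith
      have h3 : (ε + l * D) * H ≤ ((1 - l) * ρ) * H := by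
        have : 1 / 2 * ρ ≤ (1 - l) * ρ := by gcongr; linarith
        nlinarith
      exact h1.trans (le_of_mul_le_mul_right h3 hH)
  rw [hxy]
  exact hT hyT hz h1l.le hl0 (by ring)

theorem interior_nonempty_of_halfBall {S : Set (E d)} {n c : E d} (hn : ‖n‖ = 1) {ε : ℝ}
    (hε : 0 < ε) (h : ∀ x, ‖x - c‖ ≤ ε → inner ℝ n (x - c) ≤ (0 : ℝ) → x ∈ S) :
    (interior S).Nonempty := by
  refine ⟨c - (ε / 2) • n, mem_interior.mpr ⟨Metric.ball (c - (ε / 2) • n) (ε / 2), fun x hx => ?_,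
    Metric.isOpen_ball, Metric.mem_ball_self (by positivity)⟩⟩
  have hx' : ‖x - (c - (ε / 2) • n)‖ < ε / 2 := by rwa [← dist_eq_norm]
  have hxc : x - c = (x - (c - (ε / 2) • n)) - (ε / 2) • n := by module
  refine h x ?_ ?_
  · rw [hxc]
    refine (norm_sub_le _ _).trans ?_
    rw [norm_smul, hn, Real.norm_eq_abs, abs_of_pos (by positivity)]
    linarith
  · rw [hxc, inner_sub_right, inner_smul_right, real_inner_self_eq_norm_sq, hn]
    have := real_inner_le_norm n (x - (c - (ε / 2) • n))
    rw [hn, one_mul] at this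
    linarith

theorem unitNormal_spec {F : Set (E d)} (hF : Module.finrank ℝ (vectorSpan ℝ F) + 1 = d) :
    ‖unitNormal F‖ = 1 ∧ unitNormal F ∈ (vectorSpan ℝ F)ᗮ := by
  refine Classical.epsilon_spec (p := fun n : E d => ‖n‖ = 1 ∧ n ∈ (vectorSpan ℝ F)ᗮ) ?_
  have h1 : Module.finrank ℝ (vectorSpan ℝ F) + Module.finrank ℝ (vectorSpan ℝ F)ᗮ = d := by
    rw [Submodule.finrank_add_finrank_orthogonal]; simp
  have : 0 < Module.finrank ℝ (vectorSpan ℝ F)ᗮ := by omega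
  have := Module.finrank_pos_iff.mp this
  obtain ⟨⟨w, hw⟩, hw0⟩ := exists_ne (0 : (vectorSpan ℝ F)ᗮ)
  have hw0' : w ≠ 0 := fun h => hw0 (by simpa using h)
  refine ⟨‖w‖⁻¹ • w, ?_, Submodule.smul_mem _ _ hw⟩
  rw [norm_smul, norm_inv, norm_norm, inv_mul_cancel₀ (norm_ne_zero_iff.mpr hw0')]

theorem vectorSpan_eq_orthogonal {F : Set (E d)}
    (hF : Module.finrank ℝ (vectorSpan ℝ F) + 1 = d) (u : E d) :
    u ∈ vectorSpan ℝ F ↔ inner ℝ (unitNormal F) u = (0 : ℝ) := by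
  obtain ⟨hn, hno⟩ := unitNormal_spec hF
  have hle : vectorSpan ℝ F ≤ (Submodule.span ℝ {unitNormal F})ᗮ := by
    intro u hu
    exact Submodule.mem_orthogonal_singleton_iff_inner_right.mpr
      (Submodule.mem_orthogonal' _ _ |>.mp hno u hu)
  have h1 : Module.finrank ℝ (Submodule.span ℝ {unitNormal F}) +
      Module.finrank ℝ (Submodule.span ℝ {unitNormal F})ᗮ = d := by
    rw [Submodule.finrank_add_finrank_orthogonal]; simp
  rw [finrank_span_singleton (by intro h0; simp [h0] at hn)] at h1
  rw [Submodule.eq_of_le_of_finrank_eq hle (by omega),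
    Submodule.mem_orthogonal_singleton_iff_inner_right]

theorem mem_affineSpan_iff {F : Set (E d)}
    (hF : Module.finrank ℝ (vectorSpan ℝ F) + 1 = d) {c : E d} (hc : c ∈ F) (x : E d) :
    x ∈ affineSpan ℝ F ↔ inner ℝ (unitNormal F) (x - c) = (0 : ℝ) := by
  rw [← vectorSpan_eq_orthogonal hF, ← direction_affineSpan, ← vsub_eq_sub,
    AffineSubspace.vsub_right_mem_direction_iff_mem (subset_affineSpan ℝ F hc)]

/-- A polytope lies on one side of each of its facets. -/
theorem IsFacet.exists_side {T F : Set (E d)} (hT : (interior T).Nonempty) (h : IsFacet T F)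
    {c : E d} (hc : c ∈ F) : ∃ e : ℝ, (e = 1 ∨ e = -1) ∧
      ∀ x ∈ T, inner ℝ (e • unitNormal F) (x - c) ≤ (0 : ℝ) := by
  obtain ⟨hexp, hne, hF⟩ := h
  obtain ⟨hn, hno⟩ := unitNormal_spec hF
  obtain ⟨l, hl⟩ := hexp hne
  have hcT := hl ▸ hc
  set a := l (unitNormal F)
  -- the functional is a multiple of the normal
  have hker : ∀ u, inner ℝ (unitNormal F) u = (0 : ℝ) → l u = 0 := by
    intro u hu
    rw [← vectorSpan_eq_orthogonal hF] at hu
    have hle : vectorSpan ℝ F ≤ LinearMap.ker l.toLinearMap := by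
      rw [vectorSpan_def, Submodule.span_le]
      rintro _ ⟨x, hx, y, hy, rfl⟩
      have hx' := hl ▸ hx
      have hy' := hl ▸ hy
      have : l x = l y := le_antisymm (hy'.2 x hx'.1) (hx'.2 y hy'.1)
      simp [this]
    exact hle hu
  have hform : ∀ u, l u = a * inner ℝ (unitNormal F) u := by
    intro u
    have h1 := hker (u - (inner ℝ (unitNormal F) u : ℝ) • unitNormal F) (by
      rw [inner_sub_right, inner_smul_right, real_inner_self_eq_norm_sq, hn]; ring)
    rw [map_sub, map_smul, smul_eq_mul, sub_eq_zero] at h1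
    rw [h1, mul_comm]
  have hle : ∀ x ∈ T, a * inner ℝ (unitNormal F) (x - c) ≤ 0 := by
    intro x hx
    rw [← hform, map_sub]
    linarith [hcT.2 x hx]
  rcases lt_trichotomy a 0 with ha | ha | ha
  · refine ⟨-1, Or.inr rfl, fun x hx => ?_⟩
    have := hle x hx
    rw [inner_smul_left]
    simp only [map_neg, map_one]
    nlinarith
  · exfalso
    have hTF : T ⊆ F := by
      intro x hx
      rw [hl]
      refine ⟨hx, fun y _ => ?_⟩
      rw [hform, hform, ha]; simp
    have htop : affineSpan ℝ F = ⊤ := by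
      have h1 : affineSpan ℝ (interior T) = ⊤ := isOpen_interior.affineSpan_eq_top hT
      exact top_le_iff.mp (h1 ▸ affineSpan_mono ℝ (interior_subset.trans hTF))
    have h2 : vectorSpan ℝ F = ⊤ := by
      rw [← direction_affineSpan, htop]
      exact AffineSubspace.direction_top ℝ (E d) (E d)
    rw [h2, finrank_top, finrank_euclideanSpace, Fintype.card_fin] at hF
    omega
  · refine ⟨1, Or.inl rfl, fun x hx => ?_⟩
    have := hle x hx
    rw [one_smul]
    exact nonpos_of_mul_nonpos_right this ha

end Facets

namespace BackgroundMesh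

variable {d : ℕ} (M : BackgroundMesh d)

theorem convex_cell {T : Set (E d)} (hT : T ∈ M.cells) : Convex ℝ T := by
  obtain ⟨⟨s, rfl⟩, -⟩ := M.polytope T hT
  exact convex_convexHull ℝ _

theorem isCompact_cell {T : Set (E d)} (hT : T ∈ M.cells) : IsCompact T := by
  obtain ⟨⟨s, rfl⟩, -⟩ := M.polytope T hT
  exact s.finite_toSet.isCompact_convexHull (𝕜 := ℝ)

theorem isBounded_cell {T : Set (E d)} (hT : T ∈ M.cells) : Bornology.IsBounded T :=
  (M.isCompact_cell hT).isBounded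

theorem diam_le_size {T : Set (E d)} (hT : T ∈ M.cells) : Metric.diam T ≤ M.size :=
  le_csSup (M.cells.finite_toSet.image _).bddAbove ⟨T, hT, rfl⟩

theorem diam_pos (hd : 1 ≤ d) {T : Set (E d)} (hT : T ∈ M.cells) : 0 < Metric.diam T := by
  obtain ⟨x, hx⟩ := (M.polytope T hT).2
  obtain ⟨ε, hε, hball⟩ := Metric.isOpen_iff.mp isOpen_interior x hx
  set y := x + (ε / 2) • EuclideanSpace.single (⟨0, hd⟩ : Fin d) (1 : ℝ)
  have hxy : dist y x = ε / 2 := by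
    simp [y, dist_eq_norm, norm_smul, abs_of_pos hε]
  have hy : y ∈ T := interior_subset (hball (by rw [Metric.mem_ball, hxy]; linarith))
  have := Metric.dist_le_diam_of_mem (M.isBounded_cell hT) hy (interior_subset hx)
  linarith

theorem cell_eq_of_exposed {T T' : Set (E d)} (hi : (interior (T ∩ T')).Nonempty)
    (h : IsExposed ℝ T (T ∩ T')) : T ∩ T' = T := by
  obtain ⟨x, hx⟩ := hi
  obtain ⟨l, hl⟩ := h ⟨x, interior_subset hx⟩
  have hmax : ∀ y ∈ T ∩ T', ∀ z ∈ T, l z ≤ l y := fun y hy => (hl ▸ hy).2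
  have hl0 : l = 0 := by
    obtain ⟨ε, hε, hball⟩ := Metric.isOpen_iff.mp isOpen_interior x hx
    ext u
    by_contra hu
    have key : ∀ u : E d, l u ≤ 0 := by
      intro u
      obtain ⟨t, ht, htu⟩ : ∃ t : ℝ, 0 < t ∧ ‖t • u‖ < ε := by
        refine ⟨ε / (‖u‖ + 1) / 2, by positivity, ?_⟩
        rw [norm_smul, Real.norm_eq_abs, abs_of_pos (by positivity), div_div, div_mul_eq_mul_div,
          div_lt_iff₀ (by positivity)]
        nlinarith [norm_nonneg u]
      have hmem : x + t • u ∈ T ∩ T' := interior_subset (hball (by simpa using htu))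
      have := hmax x (interior_subset hx) _ hmem.1
      rw [map_add, map_smul, smul_eq_mul] at this
      by_contra hc
      push Not at hc
      nlinarith [mul_pos ht hc]
    have h1 := key u
    have h2 := key (-u)
    rw [map_neg] at h2
    have h3 : l u = 0 := le_antisymm h1 (by linarith)
    exact hu h3
  rw [hl, hl0]
  ext y; simp

/-- Distinct cells do not overlap. -/
theorem eq_of_interior_inter {T T' : Set (E d)} (hT : T ∈ M.cells) (hT' : T' ∈ M.cells)
    (hi : (interior (T ∩ T')).Nonempty) : T = T' := by
  by_contra hne
  obtain ⟨h1, h2⟩ := M.conforming T hT T' hT' hne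
  have e1 := cell_eq_of_exposed hi h1
  have e2 := cell_eq_of_exposed (inter_comm T T' ▸ hi) (inter_comm T T' ▸ h2)
  exact hne (by rw [← e1, inter_comm, e2])

theorem disjoint_interior {T T' : Set (E d)} (hT : T ∈ M.cells) (hT' : T' ∈ M.cells)
    (hne : T ≠ T') : Disjoint (interior T) (interior T') := by
  rw [Set.disjoint_iff_inter_eq_empty, ← not_nonempty_iff_eq_empty, ← interior_inter]
  exact fun h => hne (M.eq_of_interior_inter hT hT' h)

end BackgroundMesh

end UnfittedFEM

namespace UnfittedFEM

/-- The ratio between the radius of the balls at the facets and the mesh size. -/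
noncomputable def facetRadius (σ : ℝ) : ℝ := min (σ ^ 2 / 4) (σ ^ 4 / 8)

theorem facetRadius_pos {σ : ℝ} (hσ : 0 < σ) : 0 < facetRadius σ := by
  unfold facetRadius; positivity

namespace BackgroundMesh

variable {d : ℕ} {M : BackgroundMesh d}

theorem size_pos (hd : 1 ≤ d) {T : Set (E d)} (hT : T ∈ M.cells) : 0 < M.size :=
  (M.diam_pos hd hT).trans_le (M.diam_le_size hT)

theorem sq_mul_size_le {σ : ℝ} (hσ : 0 < σ) (hQ : M.QuasiUniform σ) {T : Set (E d)}
    (hT : T ∈ M.cells) : σ ^ 2 * M.size ≤ σ * Metric.diam T := by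
  have := hQ T hT
  rw [pow_two, mul_assoc]
  gcongr

theorem exists_closedBall_subset {σ : ℝ} (hσ : 0 < σ) (hS : M.ShapeRegular σ)
    (hQ : M.QuasiUniform σ) {T : Set (E d)} (hT : T ∈ M.cells) :
    ∃ z, Metric.closedBall z (σ ^ 2 * M.size) ⊆ T := by
  obtain ⟨⟨z, hz⟩, -⟩ := hS T hT
  exact ⟨z, (Metric.closedBall_subset_closedBall (sq_mul_size_le hσ hQ hT)).trans hz⟩

theorem exists_closedBall_subset_interior (hd : 1 ≤ d) {σ : ℝ} (hσ : 0 < σ)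
    (hS : M.ShapeRegular σ) (hQ : M.QuasiUniform σ) {T : Set (E d)} (hT : T ∈ M.cells) :
    ∃ z, Metric.closedBall z (facetRadius σ * M.size) ⊆ interior T := by
  obtain ⟨z, hz⟩ := exists_closedBall_subset hσ hS hQ hT
  have hh := size_pos hd hT
  refine ⟨z, (Metric.closedBall_subset_ball ?_).trans
    (interior_maximal (Metric.ball_subset_closedBall.trans hz) Metric.isOpen_ball)⟩
  have h1 : facetRadius σ ≤ σ ^ 2 / 4 := min_le_left _ _
  have : 0 < σ ^ 2 := by positivity
  nlinarith

theorem exists_disc_subset {σ : ℝ} (hσ : 0 < σ) (hS : M.ShapeRegular σ)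
    (hQ : M.QuasiUniform σ) {T F : Set (E d)} (hT : T ∈ M.cells) (hF : IsFacet T F) :
    ∃ c ∈ F, disc c (unitNormal F) (σ ^ 2 * M.size) ⊆ F := by
  obtain ⟨c, hc, hsub⟩ := (hS T hT).2 F hF
  refine ⟨c, hc, fun x hx => hsub ⟨?_, ?_⟩⟩
  · rw [Metric.mem_closedBall, dist_eq_norm]
    exact hx.2.trans (sq_mul_size_le hσ hQ hT)
  · exact (mem_affineSpan_iff hF.2.2 hc x).mpr hx.1

theorem exists_halfBall_subset (hd : 1 ≤ d) {σ : ℝ} (hσ : 0 < σ) (hS : M.ShapeRegular σ)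
    (hQ : M.QuasiUniform σ) {T F : Set (E d)} (hT : T ∈ M.cells) (hF : IsFacet T F) {c : E d}
    (hc : c ∈ F) (hdisc : disc c (unitNormal F) (σ ^ 2 * M.size) ⊆ F) :
    ∃ e : ℝ, (e = 1 ∨ e = -1) ∧ ∀ x, ‖x - c‖ ≤ 2 * (facetRadius σ * M.size) →
      inner ℝ (e • unitNormal F) (x - c) ≤ (0 : ℝ) → x ∈ T := by
  obtain ⟨e, he, hside⟩ := hF.exists_side (M.polytope T hT).2 hc
  obtain ⟨z, hz⟩ := exists_closedBall_subset hσ hS hQ hT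
  have hn := (unitNormal_spec hF.2.2).1
  have hen : ‖e • unitNormal F‖ = 1 := by
    rw [norm_smul, hn]; rcases he with rfl | rfl <;> simp
  have hh := size_pos hd hT
  have hFT : F ⊆ T := hF.1.subset
  have hzT : z ∈ T := hz (Metric.mem_closedBall_self (by positivity))
  have hH : σ ^ 2 * M.size ≤ -inner ℝ (e • unitNormal F) (z - c) := by
    have hmem : z + (σ ^ 2 * M.size) • (e • unitNormal F) ∈ T := hz (by
      rw [Metric.mem_closedBall, dist_eq_norm, add_sub_cancel_left, norm_smul, hen,
        Real.norm_eq_abs, abs_of_pos (by positivity), mul_one])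
    have := hside _ hmem
    rw [add_sub_right_comm, inner_add_right, inner_smul_right, real_inner_self_eq_norm_sq, hen]
      at this
    linarith
  have hD : ‖z - c‖ ≤ M.size := by
    rw [← dist_eq_norm]
    exact (Metric.dist_le_diam_of_mem (M.isBounded_cell hT) hzT (hFT hc)).trans
      (M.diam_le_size hT)
  have hHD : -inner ℝ (e • unitNormal F) (z - c) ≤ M.size := by
    have := neg_le_abs (inner ℝ (e • unitNormal F) (z - c))
    have h2 := abs_real_inner_le_norm (e • unitNormal F) (z - c)
    rw [hen, one_mul] at h2
    linarith
  have hr1 : facetRadius σ ≤ σ ^ 2 / 4 := min_le_left _ _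
  have hr2 : facetRadius σ ≤ σ ^ 4 / 8 := min_le_right _ _
  have hr0 := facetRadius_pos hσ
  set H := -inner ℝ (e • unitNormal F) (z - c)
  have hH0 : 0 < H := lt_of_lt_of_le (by positivity) hH
  refine ⟨e, he, halfBall_subset (M.convex_cell hT) (ρ := σ ^ 2 * M.size) (H := H) (D := M.size)
    ?_ hzT hH0 (by simp [H]) hD ?_ ?_ hen⟩
  · refine Subset.trans ?_ (hdisc.trans hFT)
    rintro x ⟨hx, hx'⟩
    refine ⟨?_, hx'⟩
    rw [inner_smul_left] at hx
    rcases he with rfl | rfl <;> simpa using hx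
  · have : facetRadius σ * M.size ≤ σ ^ 2 / 4 * M.size := by gcongr
    linarith
  · calc 2 * (2 * (facetRadius σ * M.size)) * (H + M.size)
        ≤ 2 * (2 * (σ ^ 4 / 8 * M.size)) * (M.size + M.size) := by gcongr
      _ = σ ^ 2 * M.size * (σ ^ 2 * M.size) := by ring
      _ ≤ σ ^ 2 * M.size * H := by gcongr

theorem isFacet_of_inter_eq {T F S S' : Set (E d)} (hF : IsFacet T F) (hS : S ∈ M.cells)
    (hS' : S' ∈ M.cells) (hne : S ≠ S') (h : S ∩ S' = F) : IsFacet S F ∧ IsFacet S' F := by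
  have := M.conforming S hS S' hS' hne
  rw [h] at this
  exact ⟨⟨this.1, hF.2⟩, ⟨this.2, hF.2⟩⟩

theorem eq_of_halfBall {S S' : Set (E d)} (hS : S ∈ M.cells) (hS' : S' ∈ M.cells) {n c : E d}
    {ε : ℝ} (hn : ‖n‖ = 1) (hε : 0 < ε)
    (h : ∀ x, ‖x - c‖ ≤ ε → inner ℝ n (x - c) ≤ (0 : ℝ) → x ∈ S)
    (h' : ∀ x, ‖x - c‖ ≤ ε → inner ℝ n (x - c) ≤ (0 : ℝ) → x ∈ S') : S = S' :=
  M.eq_of_interior_inter hS hS'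
    (interior_nonempty_of_halfBall hn hε fun x hx hx' => ⟨h x hx hx', h' x hx hx'⟩)

/-- Balls at the facet shared by two cells. -/
theorem exists_facet_balls (hd : 1 ≤ d) {σ : ℝ} (hσ : 0 < σ) (hS : M.ShapeRegular σ)
    (hQ : M.QuasiUniform σ) {T T' : Set (E d)} (hT : T ∈ M.cells) (hT' : T' ∈ M.cells)
    (h : FacetAdjacent T T') {r : ℝ} (hr : r = facetRadius σ * M.size) :
    ∃ c a a' : E d, T ∩ T' ⊆ disc c (unitNormal (T ∩ T')) (1 * M.size) ∧
      disc c (unitNormal (T ∩ T')) (σ ^ 2 * M.size) ⊆ T ∩ T' ∧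
      c ∈ T ∩ T' ∧
      Metric.closedBall c r ⊆ interior (T ∪ T') ∧
      Metric.closedBall a (r / 4) ⊆ interior T ∧ Metric.closedBall a' (r / 4) ⊆ interior T' ∧
      dist a c ≤ r / 2 ∧ dist a' c ≤ r / 2 := by
  obtain ⟨hne, hF, hF'⟩ := h
  obtain ⟨c, hc, hdisc⟩ := exists_disc_subset hσ hS hQ hT hF
  obtain ⟨e, he, hb⟩ := exists_halfBall_subset hd hσ hS hQ hT hF hc hdisc
  obtain ⟨e', he', hb'⟩ := exists_halfBall_subset hd hσ hS hQ hT' hF' hc hdisc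
  have hn := (unitNormal_spec hF.2.2).1
  have hh := size_pos hd hT
  have hr0 : 0 < r := hr ▸ mul_pos (facetRadius_pos hσ) hh
  rw [← hr] at hb hb'
  set n := unitNormal (T ∩ T')
  have hen : ‖e • n‖ = 1 := by
    rw [norm_smul, hn]; rcases he with rfl | rfl <;> simp
  have hopp : e' = -e := by
    by_contra hcon
    have : e' = e := by rcases he with rfl | rfl <;> rcases he' with rfl | rfl <;> simp_all
    subst this
    exact hne (eq_of_halfBall hT hT' hen (by positivity) hb hb')
  have key : ∀ {S : Set (E d)} {m : E d}, ‖m‖ = 1 →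
      (∀ x, ‖x - c‖ ≤ 2 * r → inner ℝ m (x - c) ≤ (0 : ℝ) → x ∈ S) →
      Metric.closedBall (c - (r / 2) • m) (r / 4) ⊆ interior S ∧
        dist (c - (r / 2) • m) c ≤ r / 2 := by
    intro S m hm hS
    have hmr : ‖(r / 2) • m‖ = r / 2 := by
      rw [norm_smul, hm, Real.norm_eq_abs, abs_of_pos (by positivity), mul_one]
    refine ⟨(Metric.closedBall_subset_ball (by linarith : r / 4 < r / 2)).trans
      (interior_maximal (fun x hx => ?_) Metric.isOpen_ball), ?_⟩
    · have hx' : ‖x - (c - (r / 2) • m)‖ < r / 2 := by rwa [← dist_eq_norm]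
      have hxc : x - c = (x - (c - (r / 2) • m)) - (r / 2) • m := by module
      refine hS x ?_ ?_
      · rw [hxc]
        refine (norm_sub_le _ _).trans ?_
        rw [hmr]
        linarith
      · rw [hxc, inner_sub_right, inner_smul_right, real_inner_self_eq_norm_sq, hm]
        have := real_inner_le_norm m (x - (c - (r / 2) • m))
        rw [hm, one_mul] at this
        linarith
    · rw [dist_eq_norm, sub_sub_cancel_left, norm_neg, hmr]
  have hen' : ‖e' • n‖ = 1 := by rw [hopp, neg_smul, norm_neg, hen]
  obtain ⟨k1, k2⟩ := key hen hb
  obtain ⟨k1', k2'⟩ := key hen' hb'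
  refine ⟨c, c - (r / 2) • (e • n), c - (r / 2) • (e' • n), ?_, hdisc, hc, ?_, k1, k1', k2, k2'⟩
  · intro x hx
    refine ⟨(mem_affineSpan_iff hF.2.2 hc x).mp (subset_affineSpan ℝ _ hx), ?_⟩
    rw [← dist_eq_norm, one_mul]
    exact (Metric.dist_le_diam_of_mem (M.isBounded_cell hT) hx.1 hc.1).trans (M.diam_le_size hT)
  · refine (Metric.closedBall_subset_ball (by linarith : r < 2 * r)).trans
      (interior_maximal (fun x hx => ?_) Metric.isOpen_ball)
    have hx' : ‖x - c‖ ≤ 2 * r := by rw [← dist_eq_norm]; exact (Metric.mem_ball.mp hx).le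
    rcases le_total (inner ℝ (e • n) (x - c)) 0 with h0 | h0
    · exact Or.inl (hb x hx' h0)
    · refine Or.inr (hb' x hx' ?_)
      rw [hopp, neg_smul, inner_neg_left]
      linarith

/-- A facet belongs to two cells only. -/
theorem eq_or_eq_of_inter_eq (hd : 1 ≤ d) {σ : ℝ} (hσ : 0 < σ) (hS : M.ShapeRegular σ)
    (hQ : M.QuasiUniform σ) {T T' S S' : Set (E d)} (hT : T ∈ M.cells) (hT' : T' ∈ M.cells)
    (hSc : S ∈ M.cells) (hSc' : S' ∈ M.cells) (h : FacetAdjacent T T') (hne : S ≠ S')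
    (heq : S ∩ S' = T ∩ T') : (S = T ∧ S' = T') ∨ (S = T' ∧ S' = T) := by
  obtain ⟨hneT, hF, hF'⟩ := h
  obtain ⟨hFS, hFS'⟩ := isFacet_of_inter_eq hF hSc hSc' hne heq
  obtain ⟨c, hc, hdisc⟩ := exists_disc_subset hσ hS hQ hT hF
  have hn := (unitNormal_spec hF.2.2).1
  have hr0 : 0 < 2 * (facetRadius σ * M.size) := by
    have := mul_pos (facetRadius_pos hσ) (size_pos hd hT); linarith
  have half : ∀ {S}, S ∈ M.cells → IsFacet S (T ∩ T') → _ := fun h1 h2 =>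
    exists_halfBall_subset hd hσ hS hQ h1 h2 hc hdisc
  obtain ⟨e1, he1, h1⟩ := half hT hF
  obtain ⟨e2, he2, h2⟩ := half hT' hF'
  obtain ⟨e3, he3, h3⟩ := half hSc hFS
  obtain ⟨e4, he4, h4⟩ := half hSc' hFS'
  have en : ∀ {e : ℝ}, (e = 1 ∨ e = -1) → ‖e • unitNormal (T ∩ T')‖ = 1 := by
    intro e he; rw [norm_smul, hn]; rcases he with rfl | rfl <;> simp
  have ne12 : e1 ≠ e2 := by
    rintro rfl; exact hneT (eq_of_halfBall hT hT' (en he1) hr0 h1 h2)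
  have ne34 : e3 ≠ e4 := by
    rintro rfl; exact hne (eq_of_halfBall hSc hSc' (en he3) hr0 h3 h4)
  have cases : (e3 = e1 ∧ e4 = e2) ∨ (e3 = e2 ∧ e4 = e1) := by
    rcases he1 with rfl | rfl <;> rcases he2 with rfl | rfl <;> rcases he3 with rfl | rfl <;>
      rcases he4 with rfl | rfl <;> simp_all
  rcases cases with ⟨rfl, rfl⟩ | ⟨rfl, rfl⟩
  · exact Or.inl ⟨eq_of_halfBall hSc hT (en he3) hr0 h3 h1,
      eq_of_halfBall hSc' hT' (en he4) hr0 h4 h2⟩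
  · exact Or.inr ⟨eq_of_halfBall hSc hT' (en he3) hr0 h3 h2,
      eq_of_halfBall hSc' hT (en he4) hr0 h4 h1⟩

theorem mem_cells_of_active {Ω T : Set (E d)} (hT : T ∈ M.active Ω) : T ∈ M.cells := by
  classical
  exact (Finset.mem_filter.mp hT).1

theorem mem_active_of_interiorCells {Ω T : Set (E d)} (hT : T ∈ M.interiorCells Ω) :
    T ∈ M.active Ω := by
  classical
  exact (Finset.mem_filter.mp hT).1

/-- The integral over an interior facet involves the two cells that share it. -/
theorem facetIntegral_inter (hd : 1 ≤ d) {σ : ℝ} (hσ : 0 < σ) (hS : M.ShapeRegular σ)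
    (hQ : M.QuasiUniform σ) {Ω : Set (E d)} (T T' : Active M Ω) (h : FacetAdjacent T.1 T'.1)
    (f : Active M Ω → Active M Ω → E d → ℝ) (hf : f T' T = f T T') :
    facetIntegral (T.1 ∩ T'.1) f =
      ∫ x in T.1 ∩ T'.1, f T T' x ∂(Measure.euclideanHausdorffMeasure (d - 1)) := by
  classical
  have hne : T ≠ T' := fun h' => h.1 (congrArg Subtype.val h')
  have hfilter : (Finset.univ.filter fun p : Active M Ω × Active M Ω =>
      p.1 ≠ p.2 ∧ p.1.1 ∩ p.2.1 = T.1 ∩ T'.1) = {(T, T'), (T', T)} := by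
    ext ⟨S, S'⟩
    simp only [Finset.mem_filter, Finset.mem_univ, true_and, Finset.mem_insert,
      Finset.mem_singleton, Prod.mk.injEq]
    constructor
    · rintro ⟨hn, heq⟩
      have := eq_or_eq_of_inter_eq hd hσ hS hQ (mem_cells_of_active T.2)
        (mem_cells_of_active T'.2) (mem_cells_of_active S.2) (mem_cells_of_active S'.2) h
        (fun h' => hn (Subtype.ext h')) heq
      simpa only [Subtype.ext_iff] using this
    · rintro (⟨rfl, rfl⟩ | ⟨rfl, rfl⟩)
      · exact ⟨hne, rfl⟩
      · exact ⟨hne.symm, inter_comm _ _⟩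
  unfold facetIntegral
  have hpair : ((T, T') : Active M Ω × Active M Ω) ≠ (T', T) := by
    simp [hne]
  have : (∑ p : Active M Ω × Active M Ω with p.1 ≠ p.2 ∧ p.1.1 ∩ p.2.1 = T.1 ∩ T'.1,
      ∫ x in T.1 ∩ T'.1, f p.1 p.2 x ∂(Measure.euclideanHausdorffMeasure (d - 1))) =
      ∑ p ∈ ({(T, T'), (T', T)} : Finset (Active M Ω × Active M Ω)),
      ∫ x in T.1 ∩ T'.1, f p.1 p.2 x ∂(Measure.euclideanHausdorffMeasure (d - 1)) := by
    rw [← hfilter]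
  rw [this, Finset.sum_pair hpair]
  simp only [hf]
  ring

/-! ### The active domain -/

theorem isClosed_active (Ω : Set (E d)) : IsClosed (⋃ T ∈ M.active Ω, T) :=
  (M.active Ω).finite_toSet.isClosed_biUnion fun _ hT =>
    (M.isCompact_cell (mem_cells_of_active hT)).isClosed

theorem activeDomain_subset (Ω : Set (E d)) : M.activeDomain Ω ⊆ ⋃ T ∈ M.active Ω, T := by
  unfold activeDomain
  rw [(isClosed_active Ω).closure_eq]
  exact interior_subset

theorem isOpen_activeDomain (Ω : Set (E d)) : IsOpen (M.activeDomain Ω) := isOpen_interior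

theorem interior_subset_activeDomain {Ω S : Set (E d)} (h : S ⊆ ⋃ T ∈ M.active Ω, T) :
    interior S ⊆ M.activeDomain Ω :=
  interior_mono (h.trans subset_closure)

theorem interior_cell_subset_activeDomain {Ω T : Set (E d)} (hT : T ∈ M.active Ω) :
    interior T ⊆ M.activeDomain Ω :=
  interior_subset_activeDomain fun _ hx => mem_iUnion₂.mpr ⟨T, hT, hx⟩

theorem subset_activeDomain {Ω : Set (E d)} (hΩ : IsOpen Ω) (h : Ω ⊆ ⋃ T ∈ M.cells, T) :
    Ω ⊆ M.activeDomain Ω := by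
  classical
  refine (hΩ.subset_interior_iff.mpr ?_).trans
    (interior_subset_activeDomain (M := M) (S := ⋃ T ∈ M.active Ω, T) subset_rfl)
  intro x hx
  obtain ⟨T, hT, hxT⟩ := mem_iUnion₂.mp (h hx)
  refine mem_iUnion₂.mpr ⟨T, Finset.mem_filter.mpr ⟨hT, ?_⟩, hxT⟩
  have hcl : x ∈ closure (interior T) := by
    rw [(M.convex_cell hT).closure_interior_eq_closure_of_nonempty_interior (M.polytope T hT).2]
    exact subset_closure hxT
  obtain ⟨y, hy, hy'⟩ := mem_closure_iff.mp hcl Ω hΩ hx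
  exact ⟨y, hy', hy⟩

theorem interior_ae_eq {T : Set (E d)} (hT : T ∈ M.cells) :
    interior T =ᵐ[volume] T :=
  (M.convex_cell hT).addHaar_frontier volume |> fun h =>
    (Filter.eventuallyLE_antisymm_iff.mpr ⟨(interior_subset).eventuallyLE, by
      have : T \ interior T ⊆ frontier T := by
        rw [frontier]; exact sdiff_subset_sdiff_left subset_closure
      exact ae_le_set.mpr (measure_mono_null this h)⟩)

end BackgroundMesh

end UnfittedFEM

namespace UnfittedFEM

/-! ### Integrals of piecewise polynomials -/

section Piecewise

variable {d : ℕ} {M : BackgroundMesh d} {Ω : Set (E d)}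

theorem pwFun_eq (q : PwPoly M Ω) (T : Active M Ω) {x : E d} (hx : x ∈ interior T.1) :
    pwFun q x = polyFun (q T) x := by
  unfold pwFun
  rw [Finset.sum_eq_single T]
  · rw [indicator_of_mem hx]
  · intro S _ hST
    refine indicator_of_notMem (fun hxS => ?_) _
    exact disjoint_left.mp (M.disjoint_interior (BackgroundMesh.mem_cells_of_active S.2)
      (BackgroundMesh.mem_cells_of_active T.2) fun h => hST (Subtype.ext h)) hxS hx
  · simp

theorem pwVecFun_apply (v : PwVecPoly M Ω) (x : E d) (i : Fin d) :
    pwVecFun v x i = pwFun (fun T => v T i) x := by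
  unfold pwVecFun pwFun
  rw [WithLp.ofLp_sum, Finset.sum_apply]
  refine Finset.sum_congr rfl fun T _ => ?_
  by_cases hx : x ∈ interior T.1
  · rw [indicator_of_mem hx, indicator_of_mem hx]; rfl
  · rw [indicator_of_notMem hx, indicator_of_notMem hx]; rfl

theorem memLp_pwFun (q : PwPoly M Ω) (U : Set (E d)) : MemLp (pwFun q) 2 (volume.restrict U) := by
  refine MemLp.restrict _ (memLp_finsetSum (μ := volume) Finset.univ
    (f := fun T : Active M Ω => (interior T.1).indicator (polyFun (q T))) fun T _ => ?_)
  rw [memLp_indicator_iff_restrict isOpen_interior.measurableSet,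
    memLp_two_iff_integrable_sq (polyFun_continuous _).aestronglyMeasurable]
  exact polyFun_sq_integrableOn _ ((M.isBounded_cell
    (BackgroundMesh.mem_cells_of_active T.2)).subset interior_subset)

theorem memLp_pwVecFun (v : PwVecPoly M Ω) (U : Set (E d)) :
    MemLp (pwVecFun v) 2 (volume.restrict U) :=
  MemLp.of_eval_piLp fun i => by
    simp only [pwVecFun_apply]
    exact memLp_pwFun _ U

theorem l2norm_sq_eq_sum {U : Set (E d)} {f : E d → E d} (hf : MemLp f 2 (volume.restrict U)) :
    l2norm U f ^ 2 = ∑ i, ∫ x in U, f x i ^ 2 := by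
  rw [l2norm_sq_eq hf, ← integral_finsetSum]
  · simp [EuclideanSpace.norm_sq_eq]
  · intro i _
    exact (hf.eval_piLp i).integrable_sq

theorem activeDomain_ae_eq (Ω : Set (E d)) :
    M.activeDomain Ω =ᵐ[volume] ⋃ T : Active M Ω, interior T.1 := by
  have h1 : (⋃ T : Active M Ω, interior T.1) =ᵐ[volume] ⋃ T : Active M Ω, T.1 :=
    Filter.EventuallyEq.countable_iUnion fun T =>
      BackgroundMesh.interior_ae_eq (BackgroundMesh.mem_cells_of_active T.2)
  refine Filter.EventuallyLE.antisymm ?_ (LE.le.eventuallyLE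
    (iUnion_subset fun T => BackgroundMesh.interior_cell_subset_activeDomain T.2))
  refine Filter.EventuallyLE.trans (LE.le.eventuallyLE ?_) h1.symm.le
  intro x hx
  obtain ⟨T, hT, hxT⟩ := mem_iUnion₂.mp (BackgroundMesh.activeDomain_subset Ω hx)
  exact mem_iUnion.mpr ⟨⟨T, hT⟩, hxT⟩

theorem pairwise_disjoint_interior :
    Pairwise fun T T' : Active M Ω => Disjoint (interior T.1) (interior T'.1) :=
  fun T T' h => M.disjoint_interior (BackgroundMesh.mem_cells_of_active T.2)
    (BackgroundMesh.mem_cells_of_active T'.2) fun h' => h (Subtype.ext h')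

theorem setIntegral_activeDomain {g : E d → ℝ} (hg : IntegrableOn g (M.activeDomain Ω)) :
    ∫ x in M.activeDomain Ω, g x = ∑ T : Active M Ω, ∫ x in interior T.1, g x := by
  rw [setIntegral_congr_set (activeDomain_ae_eq Ω),
    integral_iUnion_fintype (fun T => isOpen_interior.measurableSet) pairwise_disjoint_interior]
  exact fun T => hg.mono_set (BackgroundMesh.interior_cell_subset_activeDomain T.2)

theorem setIntegral_interior_pwFun (w : E d → ℝ) (q : PwPoly M Ω) (T : Active M Ω) :
    ∫ x in interior T.1, (w x - pwFun q x) ^ 2 =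
      ∫ x in interior T.1, (w x - polyFun (q T) x) ^ 2 :=
  setIntegral_congr_fun isOpen_interior.measurableSet fun x hx => by
    simp only [pwFun_eq q T hx]

theorem l2norm_sub_pwFun_sq {w : E d → ℝ} (hw : MemLp w 2 (volume.restrict (M.activeDomain Ω)))
    (q : PwPoly M Ω) : l2norm (M.activeDomain Ω) (fun x => w x - pwFun q x) ^ 2 =
      ∑ T : Active M Ω, ∫ x in interior T.1, (w x - polyFun (q T) x) ^ 2 := by
  have hm : MemLp (fun x => w x - pwFun q x) 2 (volume.restrict (M.activeDomain Ω)) :=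
    hw.sub (memLp_pwFun q _)
  rw [l2norm_sq_eq_real hm, setIntegral_activeDomain hm.integrable_sq]
  exact Finset.sum_congr rfl fun T _ => setIntegral_interior_pwFun w q T

theorem l2norm_sub_pwVecFun_sq {w : E d → E d}
    (hw : MemLp w 2 (volume.restrict (M.activeDomain Ω)))
    (v : PwVecPoly M Ω) : l2norm (M.activeDomain Ω) (fun x => w x - pwVecFun v x) ^ 2 =
      ∑ T : Active M Ω, ∑ i, ∫ x in interior T.1, (w x i - polyFun (v T i) x) ^ 2 := by
  have hm : MemLp (fun x => w x - pwVecFun v x) 2 (volume.restrict (M.activeDomain Ω)) :=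
    hw.sub (memLp_pwVecFun v _)
  rw [l2norm_sq_eq_sum hm, Finset.sum_comm]
  refine Finset.sum_congr rfl fun i _ => ?_
  rw [setIntegral_activeDomain (hm.eval_piLp i).integrable_sq]
  refine Finset.sum_congr rfl fun T _ => ?_
  rw [← setIntegral_interior_pwFun _ (fun T => v T i)]
  simp [pwVecFun_apply]

/-- The squared `L²` norm of a tuple of polynomials. -/
noncomputable def polySq {ι : Type*} [Fintype ι] (S : Set (E d)) (p : ι → Poly d) : ℝ :=
  ∑ i, ∫ x in S, polyFun (p i) x ^ 2

theorem l2norm_pwVecFun_sq (v : PwVecPoly M Ω) :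
    l2norm (M.activeDomain Ω) (pwVecFun v) ^ 2 = ∑ T : Active M Ω, polySq (interior T.1) (v T) := by
  have := l2norm_sub_pwVecFun_sq (M := M) (Ω := Ω) (w := 0) MemLp.zero v
  have e : (fun x => (0 : E d → E d) x - pwVecFun v x) = - pwVecFun v := by ext x; simp
  rw [e] at this
  simp only [Pi.zero_apply, PiLp.zero_apply, zero_sub, neg_sq] at this
  unfold polySq
  rw [← this, l2norm, l2norm, eLpNorm_neg]

theorem l2norm_pwFun_sq (q : PwPoly M Ω) : l2norm (M.activeDomain Ω) (pwFun q) ^ 2 =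
    ∑ T : Active M Ω, polySq (interior T.1) (fun _ : Unit => q T) := by
  have := l2norm_sub_pwFun_sq (M := M) (Ω := Ω) (w := 0) MemLp.zero q
  have e : (fun x => (0 : E d → ℝ) x - pwFun q x) = - pwFun q := by ext x; simp
  rw [e] at this
  simp only [Pi.zero_apply, zero_sub, neg_sq] at this
  simp only [polySq, Finset.univ_unique, Finset.sum_singleton]
  rw [← this, l2norm, l2norm, eLpNorm_neg]

theorem sum_interiorCells_le {s : Finset (Active M Ω)} (hs : ∀ T ∈ s, interior T.1 ⊆ Ω)
    {g : E d → ℝ} (hg : IntegrableOn g Ω) (h0 : ∀ x, 0 ≤ g x) :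
    ∑ T ∈ s, ∫ x in interior T.1, g x ≤ ∫ x in Ω, g x := by
  rw [← integral_biUnion_finset _ (fun T _ => isOpen_interior.measurableSet)]
  · refine setIntegral_mono_set hg (Filter.Eventually.of_forall h0) (LE.le.eventuallyLE
      (iUnion₂_subset fun T hT => ?_))
    exact hs T hT
  · exact fun T _ T' _ h => pairwise_disjoint_interior h
  · exact fun T hT => hg.mono_set (hs T hT)

theorem sum_polySq_interior_le_vec {s : Finset (Active M Ω)} (hs : ∀ T ∈ s, interior T.1 ⊆ Ω)
    (v : PwVecPoly M Ω) :
    ∑ T ∈ s, polySq (interior T.1) (v T) ≤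
      l2norm Ω (pwVecFun v) ^ 2 := by
  rw [l2norm_sq_eq_sum (memLp_pwVecFun v Ω)]
  unfold polySq
  rw [Finset.sum_comm]
  refine Finset.sum_le_sum fun i _ => ?_
  refine le_trans (le_of_eq ?_) (sum_interiorCells_le hs
    ((memLp_pwVecFun v Ω).eval_piLp i).integrable_sq fun x => sq_nonneg _)
  refine Finset.sum_congr rfl fun T _ => setIntegral_congr_fun isOpen_interior.measurableSet
    fun x hx => ?_
  simp only [pwVecFun_apply, pwFun_eq (fun T => v T i) T hx]

theorem sum_polySq_interior_le {s : Finset (Active M Ω)} (hs : ∀ T ∈ s, interior T.1 ⊆ Ω)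
    (q : PwPoly M Ω) :
    ∑ T ∈ s, polySq (interior T.1) (fun _ : Unit => q T) ≤
      l2norm Ω (pwFun q) ^ 2 := by
  rw [l2norm_sq_eq_real (memLp_pwFun q Ω)]
  simp only [polySq, Finset.univ_unique, Finset.sum_singleton]
  refine le_trans (le_of_eq ?_) (sum_interiorCells_le hs
    (memLp_pwFun q Ω).integrable_sq fun x => sq_nonneg _)
  refine Finset.sum_congr rfl fun T _ => setIntegral_congr_fun isOpen_interior.measurableSet
    fun x hx => ?_
  simp only [pwFun_eq q T hx]

variable {ι : Type*} [Fintype ι]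

theorem polySq_nonneg (S : Set (E d)) (p : ι → Poly d) : 0 ≤ polySq S p :=
  Finset.sum_nonneg fun _ _ => integral_nonneg fun _ => sq_nonneg _

theorem polySq_mono {S S' : Set (E d)} (hS' : Bornology.IsBounded S') (h : S ⊆ S')
    (p : ι → Poly d) : polySq S p ≤ polySq S' p :=
  Finset.sum_le_sum fun _ _ => setIntegral_polyFun_sq_mono _ hS' h

theorem setIntegral_add_sq_le {S : Set (E d)} {f g : E d → ℝ}
    (hf : MemLp f 2 (volume.restrict S)) (hg : MemLp g 2 (volume.restrict S)) :
    ∫ x in S, (f x + g x) ^ 2 ≤ 2 * (∫ x in S, f x ^ 2) + 2 * ∫ x in S, g x ^ 2 := by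
  rw [← integral_const_mul, ← integral_const_mul,
    ← integral_add (hf.integrable_sq.const_mul 2) (hg.integrable_sq.const_mul 2)]
  refine integral_mono (hf.add hg).integrable_sq
    ((hf.integrable_sq.const_mul 2).add (hg.integrable_sq.const_mul 2)) fun x => ?_
  simp only
  nlinarith [sq_nonneg (f x - g x)]

theorem memLp_polyFun (p : Poly d) {S : Set (E d)} (hS : Bornology.IsBounded S) :
    MemLp (polyFun p) 2 (volume.restrict S) :=
  (memLp_two_iff_integrable_sq (polyFun_continuous p).aestronglyMeasurable).mpr
    (polyFun_sq_integrableOn p hS)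

theorem polySq_add_le {S : Set (E d)} (hS : Bornology.IsBounded S) (p q : ι → Poly d) :
    polySq S (p + q) ≤ 2 * polySq S p + 2 * polySq S q := by
  unfold polySq
  rw [Finset.mul_sum, Finset.mul_sum, ← Finset.sum_add_distrib]
  refine Finset.sum_le_sum fun i _ => ?_
  simp only [Pi.add_apply, polyFun_add]
  exact setIntegral_add_sq_le (memLp_polyFun _ hS) (memLp_polyFun _ hS)

theorem polySq_neg (S : Set (E d)) (p : ι → Poly d) : polySq S (-p) = polySq S p := by
  unfold polySq
  refine Finset.sum_congr rfl fun i _ => ?_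
  have : -p i = (-1 : ℝ) • p i := by simp
  simp only [Pi.neg_apply, this, polyFun_smul]
  simp

theorem polySq_sub_comm (S : Set (E d)) (p q : ι → Poly d) :
    polySq S (p - q) = polySq S (q - p) := by
  rw [← polySq_neg, neg_sub]

theorem polySq_sub_le {S : Set (E d)} (hS : Bornology.IsBounded S) (p m q : ι → Poly d) :
    polySq S (p - q) ≤ 2 * polySq S (p - m) + 2 * polySq S (m - q) := by
  have := polySq_add_le hS (p - m) (m - q)
  rwa [sub_add_sub_cancel] at this

end Piecewise

/-! ### Chains of cells and the size of aggregates -/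

/-- A quantity with a weak triangle inequality is bounded along chains in a finite set. -/
theorem le_of_reflTransGen {α : Type*} {S : Finset α} {r : α → α → Prop} {D : α → α → ℝ} {e : ℝ}
    (he : 0 ≤ e) (hD0 : ∀ a, D a a ≤ 0) (hD : ∀ a b c, D a c ≤ 2 * D a b + 2 * D b c)
    (hsymm : ∀ a b, D a b = D b a)
    (hr : ∀ a b, r a b → a ∈ S ∧ b ∈ S ∧ D a b ≤ e) {a b : α} (ha : a ∈ S)
    (hab : Relation.ReflTransGen r a b) : D a b ≤ 4 ^ S.card * e := by
  classical
  have walk : ∀ {x y : α} (p : (SimpleGraph.fromRel r).Walk x y), D x y ≤ (4 ^ p.length - 1) * e := by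
    intro x y p
    induction p with
    | nil => simpa using hD0 _
    | @cons u v w huv p ih =>
      have h1 : D u v ≤ e := by
        rcases huv.2 with h | h
        · exact (hr _ _ h).2.2
        · rw [hsymm]; exact (hr _ _ h).2.2
      have h4 : (1 : ℝ) ≤ 4 ^ p.length := one_le_pow₀ (by norm_num)
      rw [SimpleGraph.Walk.length_cons, pow_succ]
      nlinarith [hD u v w]
  have mem : ∀ {x y : α} (p : (SimpleGraph.fromRel r).Walk x y), x ∈ S → ∀ z ∈ p.support, z ∈ S := by
    intro x y p hx
    induction p with
    | nil => intro z hz; simp at hz; exact hz ▸ hx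
    | @cons u v w huv p ih =>
      intro z hz
      rw [SimpleGraph.Walk.support_cons, List.mem_cons] at hz
      rcases hz with rfl | hz
      · exact hx
      · refine ih ?_ z hz
        rcases huv.2 with h | h
        · exact (hr _ _ h).2.1
        · exact (hr _ _ h).1
  have reach : (SimpleGraph.fromRel r).Reachable a b := by
    induction hab with
    | refl => exact SimpleGraph.Reachable.refl _
    | @tail b c _ hbc ih =>
      by_cases hne : b = c
      · exact hne ▸ ih
      · exact ih.trans (SimpleGraph.Adj.reachable ⟨hne, Or.inl hbc⟩)
  obtain ⟨p, hp⟩ := reach.exists_isPath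
  have hlen : p.length + 1 ≤ S.card := by
    rw [← SimpleGraph.Walk.length_support, ← List.toFinset_card_of_nodup hp.support_nodup]
    exact Finset.card_le_card fun z hz => mem p ha z (List.mem_toFinset.mp hz)
  refine (walk p).trans ?_
  gcongr
  have : (4 : ℝ) ^ p.length ≤ 4 ^ S.card := pow_le_pow_right₀ (by norm_num) (by omega)
  linarith

namespace Aggregation

variable {d : ℕ} {M : BackgroundMesh d} {Ω : Set (E d)} (A : Aggregation M Ω)

theorem mem_aggregate {K T : Set (E d)} : T ∈ A.aggregate K ↔ T ∈ M.active Ω ∧ A.root T = K := by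
  classical
  exact Finset.mem_filter

theorem aggregate_subset_closedBall {c : ℝ} (hA : A.DiamBounded c) {K T z : Set (E d)}
    {y : E d} (hK : K ∈ M.interiorCells Ω) (hT : T ∈ A.aggregate K) (hz : z ∈ A.aggregate K)
    (hy : y ∈ z) : T ⊆ Metric.closedBall y (c * M.size) := by
  intro x hx
  refine le_trans (Metric.dist_le_diam_of_mem ?_ (mem_iUnion₂.mpr ⟨T, hT, hx⟩)
    (mem_iUnion₂.mpr ⟨z, hz, hy⟩)) (hA K hK)
  exact (Bornology.isBounded_biUnion_finset _).mpr fun S hS =>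
    M.isBounded_cell (BackgroundMesh.mem_cells_of_active (A.mem_aggregate.mp hS).1)

/-- The number of cells of an aggregate is bounded. -/
theorem card_aggregate_le (hd : 1 ≤ d) {σ : ℝ} (hσ : 0 < σ) (hS : M.ShapeRegular σ)
    (hQ : M.QuasiUniform σ) {c : ℝ} (hA : A.DiamBounded c) {K : Set (E d)}
    (hK : K ∈ M.interiorCells Ω) :
    ((A.aggregate K).card : ℝ) ≤ (|c| / facetRadius σ) ^ d := by
  have : Nonempty (Fin d) := ⟨⟨0, hd⟩⟩
  have hKA : K ∈ A.aggregate K :=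
    A.mem_aggregate.mpr ⟨BackgroundMesh.mem_active_of_interiorCells hK, A.root_inner K hK⟩
  have hcell : ∀ T ∈ A.aggregate K, T ∈ M.cells := fun T hT =>
    BackgroundMesh.mem_cells_of_active (A.mem_aggregate.mp hT).1
  have hh := BackgroundMesh.size_pos hd (hcell K hKA)
  obtain ⟨y, hy⟩ := (M.polytope K (hcell K hKA)).2
  have hr := mul_pos (facetRadius_pos hσ) hh
  set μ : Measure (E d) := volume
  set v := μ.real (Metric.ball (0 : E d) 1) with hv
  have hv0 : 0 < v := by
    rw [hv, measureReal_def]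
    exact ENNReal.toReal_pos (Metric.measure_ball_pos _ _ one_pos).ne' measure_ball_lt_top.ne
  have hball : ∀ (x : E d) (ρ : ℝ), 0 ≤ ρ → μ.real (Metric.closedBall x ρ) = ρ ^ d * v := by
    intro x ρ hρ
    rw [Measure.addHaar_real_closedBall _ _ hρ, finrank_euclideanSpace, Fintype.card_fin]
  have hlow : ∀ T ∈ A.aggregate K, (facetRadius σ * M.size) ^ d * v ≤ μ.real (interior T) := by
    intro T hT
    obtain ⟨z, hz⟩ := BackgroundMesh.exists_closedBall_subset_interior hd hσ hS hQ (hcell T hT)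
    rw [← hball z _ hr.le]
    exact measureReal_mono hz
      ((M.isBounded_cell (hcell T hT)).subset interior_subset).measure_lt_top.ne
  have hsum : ∑ T ∈ A.aggregate K, μ.real (interior T) ≤ (|c| * M.size) ^ d * v := by
    rw [← hball y _ (by positivity), ← measureReal_biUnion_finset (fun T hT T' hT' h => M.disjoint_interior (hcell T hT)
      (hcell T' hT') h) (fun T _ => isOpen_interior.measurableSet) (fun T hT => ((M.isBounded_cell
      (hcell T hT)).subset interior_subset).measure_lt_top.ne)]
    · refine measureReal_mono (iUnion₂_subset fun T hT => ?_) measure_closedBall_lt_top.ne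
      refine interior_subset.trans ((A.aggregate_subset_closedBall hA hK hT hKA
        (interior_subset hy)).trans (Metric.closedBall_subset_closedBall ?_))
      gcongr
      exact le_abs_self c
  have h1 := (Finset.card_nsmul_le_sum _ _ _ hlow).trans hsum
  rw [nsmul_eq_mul, ← mul_assoc] at h1
  have h2 := le_of_mul_le_mul_right h1 hv0
  rw [mul_pow, mul_pow, ← mul_assoc] at h2
  have h3 := le_of_mul_le_mul_right h2 (by positivity)
  rw [div_pow, le_div_iff₀ (pow_pos (facetRadius_pos hσ) d)]
  exact h3

end Aggregation

end UnfittedFEM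

namespace UnfittedFEM

/-! ### Estimates at a single facet -/

section LocalEstimates

variable {d : ℕ} {ι : Type*} [Fintype ι] {κ : ℕ → Type*} [∀ j, Fintype (κ j)]

theorem PP_mono {k l : ℕ} (h : k ≤ l) : PP d k ≤ PP d l := fun p hp => by
  rw [MvPolynomial.mem_restrictTotalDegree] at hp ⊢
  exact hp.trans h

theorem BackgroundMesh.subset_closedBall_of_mem {M : BackgroundMesh d} {T : Set (E d)}
    (hT : T ∈ M.cells) {x z : E d} (hx : x ∈ T) (hz : z ∈ T) {S : Set (E d)} {R : ℝ}
    (hS : S ⊆ Metric.closedBall x (R * M.size)) : S ⊆ Metric.closedBall z ((R + 1) * M.size) := by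
  refine hS.trans (Metric.closedBall_subset_closedBall' ?_)
  rw [add_mul, one_mul]
  gcongr
  exact (Metric.dist_le_diam_of_mem (M.isBounded_cell hT) hx hz).trans (M.diam_le_size hT)

/-- Norms of polynomials near a cell are bounded by norms on the cell. -/
theorem exists_polySq_le (hd : 1 ≤ d) {σ : ℝ} (hσ : 0 < σ) (N : ℕ) (R : ℝ) :
    ∃ C : ℝ, 0 < C ∧ ∀ M : BackgroundMesh d, M.ShapeRegular σ → M.QuasiUniform σ →
      ∀ T ∈ M.cells, ∀ x ∈ T, ∀ S ⊆ Metric.closedBall x (R * M.size), ∀ p : ι → Poly d,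
      (∀ i, p i ∈ PP d N) → polySq S p ≤ C * polySq (interior T) p := by
  obtain ⟨C, hC, hle⟩ := exists_setIntegral_sq_le d N (R + 1) (facetRadius_pos hσ)
  refine ⟨C, hC, fun M hS hQ T hT x hx S hSx p hp => ?_⟩
  obtain ⟨z, hz⟩ := BackgroundMesh.exists_closedBall_subset_interior hd hσ hS hQ hT
  have hh := BackgroundMesh.size_pos hd hT
  have hzT : z ∈ T := interior_subset (hz (Metric.mem_closedBall_self
    (mul_pos (facetRadius_pos hσ) hh).le))
  unfold polySq
  rw [Finset.mul_sum]
  refine Finset.sum_le_sum fun i _ => (hle _ (hp i) M.size hh z S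
    (BackgroundMesh.subset_closedBall_of_mem hT hx hzT hSx)).trans ?_
  exact mul_le_mul_of_nonneg_left (setIntegral_polyFun_sq_mono _
    ((M.isBounded_cell hT).subset interior_subset) hz) hC.le

/-- The part of a cell in the error of an approximation of `w` of order `s`. -/
noncomputable def cellError (U : Set (E d)) (h : ℝ) (s : ℕ) (w : ι → E d → ℝ) (T : Set (E d))
    (p : ι → Poly d) : ℝ :=
  ∑ i, ((∫ x in interior T, (w i x - polyFun (p i) x) ^ 2) + h ^ (2 * s) *
    ∑ α ∈ Finset.piAntidiag (Finset.univ : Finset (Fin d)) s,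
      ∫ x in interior T, weakDeriv U α (w i) x ^ 2)

theorem cellError_nonneg {U : Set (E d)} {h : ℝ} (hh : 0 ≤ h) {s : ℕ} {w : ι → E d → ℝ}
    {T : Set (E d)} {p : ι → Poly d} : 0 ≤ cellError U h s w T p :=
  Finset.sum_nonneg fun _ _ => add_nonneg (integral_nonneg fun _ => sq_nonneg _)
    (mul_nonneg (by positivity) (Finset.sum_nonneg fun _ _ => integral_nonneg fun _ => sq_nonneg _))

theorem integrableOn_sub_polyFun_sq {U S : Set (E d)} {w : E d → ℝ}
    (hw : MemLp w 2 (volume.restrict U)) (hS : Bornology.IsBounded S) (hSU : S ⊆ U) (p : Poly d) :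
    IntegrableOn (fun x => (w x - polyFun p x) ^ 2) S :=
  ((hw.mono_measure (Measure.restrict_mono hSU le_rfl)).sub (memLp_polyFun p hS)).integrable_sq

/-- A piecewise polynomial that is close to a smooth function is close to a polynomial near a
facet. -/
theorem exists_facet_approximation (hd : 1 ≤ d) {σ : ℝ} (hσ : 0 < σ) (N s : ℕ) (R : ℝ) :
    ∃ C : ℝ, 0 < C ∧ ∀ M : BackgroundMesh d, M.ShapeRegular σ → M.QuasiUniform σ →
      ∀ U : Set (E d), IsOpen U → ∀ T ∈ M.cells, ∀ T' ∈ M.cells, FacetAdjacent T T' →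
      interior (T ∪ T') ⊆ U →
      ∀ w : ι → E d → ℝ, (∀ i, MemSobolev U s (w i)) → ∀ p p' : ι → Poly d,
      (∀ i, p i ∈ PP d N) → (∀ i, p' i ∈ PP d N) →
      ∀ x ∈ T ∩ T', ∀ S ⊆ Metric.closedBall x (R * M.size),
      polySq S (p - p') ≤
        C * (cellError U M.size s w T p + cellError U M.size s w T' p') := by
  obtain ⟨C₁, hC₁, hq⟩ := exists_polynomial_approximation d N s
  obtain ⟨C₂, hC₂, hle⟩ := exists_setIntegral_sq_le d (max N s) (R + 1)
    (ρ := facetRadius σ / 8) (by have := facetRadius_pos hσ; positivity)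
  set b := max 1 (facetRadius σ ^ (2 * s)) with hb
  have hb1 : 1 ≤ b := le_max_left _ _
  refine ⟨4 * (C₂ * (C₁ * b)), by positivity, ?_⟩
  intro M hS hQ U hU T hT T' hT' hadj hsub w hw p p' hp hp' x hx S hSx
  set h := M.size with hhdef
  have hh : 0 < h := BackgroundMesh.size_pos hd hT
  obtain ⟨c, a, a', -, -, hc, hcU, ha, ha', hac, ha'c⟩ :=
    BackgroundMesh.exists_facet_balls hd hσ hS hQ hT hT' hadj rfl
  rw [← hhdef] at hcU ha ha' hac ha'c
  set r := facetRadius σ * h with hr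
  have hr0 : 0 < r := mul_pos (facetRadius_pos hσ) hh
  have hcT := hcU.trans interior_subset
  choose q hqP hqle using fun i => hq U hU (w i) (hw i).1 (fun α => weakDeriv U α (w i))
    (fun α hα => weakDeriv_spec (hw i) hα.le) c r hr0 (hcU.trans hsub)
  have haT : a ∈ T := interior_subset (ha (Metric.mem_closedBall_self (by positivity)))
  have haT' : a' ∈ T' := interior_subset (ha' (Metric.mem_closedBall_self (by positivity)))
  have hbT := (M.isBounded_cell hT).subset (interior_subset (s := T))
  have hbT' := (M.isBounded_cell hT').subset (interior_subset (s := T'))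
  have hTU : interior T ⊆ U := (interior_mono subset_union_left).trans hsub
  have hTU' : interior T' ⊆ U := (interior_mono subset_union_right).trans hsub
  have hG : ∀ i, ∑ α ∈ Finset.piAntidiag (Finset.univ : Finset (Fin d)) s,
      ∫ x in Metric.closedBall c r, weakDeriv U α (w i) x ^ 2 ≤
      (∑ α ∈ Finset.piAntidiag (Finset.univ : Finset (Fin d)) s,
        ∫ x in interior T, weakDeriv U α (w i) x ^ 2) +
      ∑ α ∈ Finset.piAntidiag (Finset.univ : Finset (Fin d)) s,
        ∫ x in interior T', weakDeriv U α (w i) x ^ 2 := by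
    intro i
    rw [← Finset.sum_add_distrib]
    refine Finset.sum_le_sum fun α hα => ?_
    have hGi := (weakDeriv_spec (hw i) (α := α) (by simpa using (Finset.mem_piAntidiag.mp hα).1.le)).1.integrable_sq
    rw [← setIntegral_union (M.disjoint_interior hT hT' hadj.1) isOpen_interior.measurableSet
      (IntegrableOn.mono_set hGi hTU) (IntegrableOn.mono_set hGi hTU')]
    refine setIntegral_mono_set (IntegrableOn.mono_set hGi (union_subset hTU hTU'))
      (Filter.Eventually.of_forall fun _ => sq_nonneg _) ?_
    exact hcT.eventuallyLE.trans ((BackgroundMesh.interior_ae_eq hT).symm.union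
      (BackgroundMesh.interior_ae_eq hT').symm).le
  have one : ∀ (V : Set (E d)) (z : E d) (u : ι → Poly d), V ∈ M.cells → z ∈ V → x ∈ V →
      interior V ⊆ U →
      Metric.closedBall z (r / 4) ⊆ interior V → dist z c ≤ r / 2 → (∀ i, u i ∈ PP d N) →
      (∀ i, ∫ y in interior V, (w i y - polyFun (u i) y) ^ 2 ≤
        (∫ y in interior T, (w i y - polyFun (p i) y) ^ 2) +
        ∫ y in interior T', (w i y - polyFun (p' i) y) ^ 2) →
      polySq S (u - q) ≤
        C₂ * (C₁ * b) * (cellError U h s w T p + cellError U h s w T' p') := by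
    intro V z u hV hzV hxV hVU hzsub hzc hu hle2
    unfold polySq cellError
    rw [← Finset.sum_add_distrib, Finset.mul_sum]
    refine Finset.sum_le_sum fun i _ => ?_
    have huq : u i - q i ∈ PP d (max N s) := Submodule.sub_mem _
      (PP_mono (le_max_left _ _) (hu i))
      (PP_mono ((Nat.sub_le _ _).trans (le_max_right _ _)) (hqP i))
    refine (hle _ huq h hh z S (BackgroundMesh.subset_closedBall_of_mem hV hxV hzV hSx)).trans ?_
    rw [mul_assoc]
    gcongr
    have e : facetRadius σ / 8 * h = r / 8 := by rw [hr]; ring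
    rw [e]
    refine (hqle i (u i) (hu i) z (by linarith)).trans ?_
    rw [mul_assoc]
    gcongr
    have h1 : ∫ y in Metric.closedBall z (r / 4), (w i y - polyFun (u i) y) ^ 2 ≤
        ∫ y in interior V, (w i y - polyFun (u i) y) ^ 2 :=
      setIntegral_mono_set (integrableOn_sub_polyFun_sq (hw i).1
        ((M.isBounded_cell hV).subset interior_subset) hVU _)
        (Filter.Eventually.of_forall fun _ => sq_nonneg _) hzsub.eventuallyLE
    have h2 := hle2 i
    have h3 := hG i
    set g := ∑ α ∈ Finset.piAntidiag (Finset.univ : Finset (Fin d)) s,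
        ∫ x in interior T, weakDeriv U α (w i) x ^ 2
    set g' := ∑ α ∈ Finset.piAntidiag (Finset.univ : Finset (Fin d)) s,
        ∫ x in interior T', weakDeriv U α (w i) x ^ 2
    have hg : 0 ≤ g := Finset.sum_nonneg fun _ _ => integral_nonneg fun _ => sq_nonneg _
    have hg' : 0 ≤ g' := Finset.sum_nonneg fun _ _ => integral_nonneg fun _ => sq_nonneg _
    have h4 : 0 ≤ ∫ y in interior T, (w i y - polyFun (p i) y) ^ 2 :=
      integral_nonneg fun _ => sq_nonneg _
    have h4' : 0 ≤ ∫ y in interior T', (w i y - polyFun (p' i) y) ^ 2 :=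
      integral_nonneg fun _ => sq_nonneg _
    have h5 : r ^ (2 * s) ≤ b * h ^ (2 * s) := by
      rw [hr, mul_pow]
      gcongr
      exact le_max_right _ _
    calc _ ≤ ((∫ y in interior T, (w i y - polyFun (p i) y) ^ 2) +
          ∫ y in interior T', (w i y - polyFun (p' i) y) ^ 2) + (b * h ^ (2 * s)) * (g + g') := by
          gcongr
          exact h1.trans h2
      _ ≤ b * ((∫ y in interior T, (w i y - polyFun (p i) y) ^ 2) +
          ∫ y in interior T', (w i y - polyFun (p' i) y) ^ 2) + (b * h ^ (2 * s)) * (g + g') := by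
          gcongr
          exact le_mul_of_one_le_left (by positivity) hb1
      _ = _ := by ring
  have hSb : Bornology.IsBounded S := Metric.isBounded_closedBall.subset hSx
  have e1 := one T a p hT haT hx.1 hTU ha hac hp fun i =>
    le_add_of_nonneg_right (integral_nonneg fun _ => sq_nonneg _)
  have e2 := one T' a' p' hT' haT' hx.2 hTU' ha' ha'c hp' fun i =>
    le_add_of_nonneg_left (integral_nonneg fun _ => sq_nonneg _)
  have e3 := polySq_sub_le hSb p q p'
  rw [polySq_sub_comm S q p'] at e3
  linarith

/-- The facet form of two tuples of polynomials. -/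
noncomputable def faceTerm (dir : E d → (j : ℕ) → κ j → Fin j → E d) (m : ℕ) (h : ℝ)
    (F : Set (E d)) (p q : ι → Poly d) : ℝ :=
  ∑ j ∈ Finset.range (m + 1), h ^ (2 * j + 1) *
    ∫ x in F, ∑ i, ∑ k, dirDeriv (p i) j x (dir (unitNormal F) j k) *
      dirDeriv (q i) j x (dir (unitNormal F) j k) ∂(Measure.euclideanHausdorffMeasure (d - 1))

theorem faceTerm_self_nonneg (dir : E d → (j : ℕ) → κ j → Fin j → E d) (m : ℕ) {h : ℝ}
    (hh : 0 ≤ h) (F : Set (E d)) (p : ι → Poly d) : 0 ≤ faceTerm dir m h F p p :=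
  Finset.sum_nonneg fun _ _ => mul_nonneg (by positivity) (integral_nonneg fun _ =>
    Finset.sum_nonneg fun _ _ => Finset.sum_nonneg fun _ _ => mul_self_nonneg _)

theorem faceTerm_zero (dir : E d → (j : ℕ) → κ j → Fin j → E d) (m : ℕ) (h : ℝ)
    (F : Set (E d)) (q : ι → Poly d) : faceTerm dir m h F 0 q = 0 := by
  have : ∀ j x u, dirDeriv (0 : Poly d) j x u = 0 := fun j x u => by
    simpa using dirDeriv_smul (0 : ℝ) (0 : Poly d) j x u
  simp [faceTerm, this]

/-- The facet form is bounded. -/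
theorem exists_abs_faceTerm_le (hd : 1 ≤ d) {σ : ℝ} (hσ : 0 < σ) (N m : ℕ)
    (dir : E d → (j : ℕ) → κ j → Fin j → E d)
    (hdir : ∀ n, ‖n‖ = 1 → ∀ j k a, ‖dir n j k a‖ ≤ 1) :
    ∃ C : ℝ, 0 < C ∧ ∀ M : BackgroundMesh d, M.ShapeRegular σ → M.QuasiUniform σ →
      ∀ T ∈ M.cells, ∀ T' ∈ M.cells, FacetAdjacent T T' →
      ∀ x ∈ T ∩ T', ∀ p q : ι → Poly d,
      (∀ i, p i ∈ PP d N) → (∀ i, q i ∈ PP d N) →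
      |faceTerm dir m M.size (T ∩ T') p q| ≤
        C * (Real.sqrt (polySq (Metric.closedBall x (2 * M.size)) p) *
          Real.sqrt (polySq (Metric.closedBall x (2 * M.size)) q)) := by
  obtain ⟨C, hC, hle⟩ := exists_abs_face_le (ι := ι) (κ := κ) hd N m dir hdir (R := 1) (ρ := 1)
    one_pos
  refine ⟨C, hC, fun M hS hQ T hT T' hT' hadj x hx p q hp hq => ?_⟩
  obtain ⟨c, -, -, hF, -, hc, -⟩ :=
    BackgroundMesh.exists_facet_balls hd hσ hS hQ hT hT' hadj rfl
  refine (hle p q hp hq M.size (BackgroundMesh.size_pos hd hT) c _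
    (unitNormal_spec hadj.2.1.2.2).1 _ hF).trans ?_
  have hsub : Metric.closedBall c (1 * M.size) ⊆ Metric.closedBall x (2 * M.size) := by
    have := BackgroundMesh.subset_closedBall_of_mem hT hc.1 hx.1 (R := 1) subset_rfl
    norm_num at this ⊢
    exact this
  have := fun u : ι → Poly d => polySq_mono Metric.isBounded_closedBall hsub u
  exact mul_le_mul_of_nonneg_left (mul_le_mul (Real.sqrt_le_sqrt (this p))
    (Real.sqrt_le_sqrt (this q)) (Real.sqrt_nonneg _) (Real.sqrt_nonneg _)) hC.le

/-- The facet form of a jump controls the jump. -/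
theorem exists_polySq_le_faceTerm (hd : 1 ≤ d) {σ : ℝ} (hσ : 0 < σ)
    (W : Submodule ℝ (ι → Poly d)) {N : ℕ}
    (hWN : ∀ v ∈ W, ∀ i, v i ∈ PP d N)
    (hWaff : ∀ v ∈ W, ∀ b h, (fun i => affSub b h (v i)) ∈ W) (m : ℕ)
    (dir : E d → (j : ℕ) → κ j → Fin j → E d) (hdir : ∀ j k, Continuous fun n => dir n j k)
    (hunis : ∀ n, ‖n‖ = 1 → ∀ v ∈ W, (∀ i, ∀ j ≤ m, ∀ k, ∀ x, inner ℝ n x = (0 : ℝ) →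
      dirDeriv (v i) j x (dir n j k) = 0) → v = 0) (R : ℝ) :
    ∃ C : ℝ, 0 < C ∧ ∀ M : BackgroundMesh d, M.ShapeRegular σ → M.QuasiUniform σ →
      ∀ T ∈ M.cells, ∀ T' ∈ M.cells, FacetAdjacent T T' →
      ∀ x ∈ T ∩ T', ∀ S ⊆ Metric.closedBall x (R * M.size), ∀ p ∈ W,
      polySq S p ≤ C * faceTerm dir m M.size (T ∩ T') p p := by
  obtain ⟨C, hC, hle⟩ := exists_setIntegral_sq_le_disc hd W hWN hWaff m dir hdir hunis (R + 1)
    (ρ := σ ^ 2) (by positivity)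
  refine ⟨C, hC, fun M hS hQ T hT T' hT' hadj x hx S hSx p hp => ?_⟩
  obtain ⟨c, -, -, hF, hF', hc, -⟩ :=
    BackgroundMesh.exists_facet_balls hd hσ hS hQ hT hT' hadj rfl
  have hh := BackgroundMesh.size_pos hd hT
  have hn := (unitNormal_spec hadj.2.1.2.2).1
  refine (polySq_mono Metric.isBounded_closedBall
    (BackgroundMesh.subset_closedBall_of_mem hT hx.1 hc.1 hSx) p).trans
    ((hle p hp M.size hh c _ hn).trans ?_)
  unfold faceTerm
  gcongr with j
  simp only [← sq]
  refine setIntegral_mono_set ?_ (Filter.Eventually.of_forall fun x =>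
    Finset.sum_nonneg fun _ _ => Finset.sum_nonneg fun _ _ => sq_nonneg _) hF'.eventuallyLE
  have hcompact : IsCompact (T ∩ T') := (M.isCompact_cell hT).inter (M.isCompact_cell hT')
  set n := unitNormal (T ∩ T')
  have hcont : Continuous fun x => ∑ i, ∑ k, dirDeriv (p i) j x (dir n j k) ^ 2 := by
    refine continuous_finsetSum _ fun i _ => continuous_finsetSum _ fun k _ => ?_
    have : Continuous fun x => dirDeriv (p i) j x (dir n j k) :=
      (dirDeriv_continuous (p i) j).comp (by fun_prop : Continuous fun x : E d => (x, dir n j k))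
    exact this.pow 2
  obtain ⟨B, hB⟩ := hcompact.exists_bound_of_continuousOn hcont.continuousOn
  exact Measure.integrableOn_of_bounded
    ((measure_mono hF).trans_lt (measure_disc hn hh 1).1).ne hcont.aestronglyMeasurable
    (M := B) (ae_restrict_of_forall_mem hcompact.isClosed.measurableSet hB)

end LocalEstimates

end UnfittedFEM

namespace UnfittedFEM

/-! ### Sums over the facets of the aggregates -/

section Assembly

variable {d : ℕ} {ι : Type*} [Fintype ι] {κ : ℕ → Type*} [∀ j, Fintype (κ j)]
  {M : BackgroundMesh d} {Ω : Set (E d)}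

/-- The face-based form for tuples of piecewise polynomials and a family of directions. -/
noncomputable def faceForm (dir : E d → (j : ℕ) → κ j → Fin j → E d) (Fs : Finset (Set (E d)))
    (m : ℕ) (u v : Active M Ω → ι → Poly d) : ℝ :=
  ∑ F ∈ Fs, ∑ j ∈ Finset.range (m + 1), M.size ^ (2 * j + 1) *
    facetIntegral F fun T T' x => ∑ i, ∑ k,
      dirDeriv (u T i - u T' i) j x (dir (unitNormal F) j k) *
      dirDeriv (v T i - v T' i) j x (dir (unitNormal F) j k)

namespace Aggregation

variable (A : Aggregation M Ω)

theorem root_mem_active {T : Set (E d)} (hT : T ∈ M.active Ω) : A.root T ∈ M.active Ω :=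
  BackgroundMesh.mem_active_of_interiorCells (A.root_mem T hT)

/-- The root of an active cell. -/
noncomputable def rootCell (T : Active M Ω) : Active M Ω := ⟨A.root T.1, A.root_mem_active T.2⟩

theorem rootCell_interior (T : Active M Ω) : interior (A.rootCell T).1 ⊆ Ω := by
  classical
  exact (Finset.mem_filter.mp (A.root_mem T.1 T.2)).2

theorem rootCell_rootCell (T : Active M Ω) : A.rootCell (A.rootCell T) = A.rootCell T :=
  Subtype.ext (A.root_inner _ (A.root_mem T.1 T.2))

theorem mem_aggregate_root (T : Active M Ω) : T.1 ∈ A.aggregate (A.rootCell T).1 :=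
  A.mem_aggregate.mpr ⟨T.2, rfl⟩

theorem rootCell_eq_self {T : Active M Ω} (h : (A.rootCell T).1 ∉ A.boundaryRoots) :
    A.rootCell T = T := by
  classical
  have hT : T.1 ∈ M.interiorCells Ω := by
    by_contra hcon
    exact h (Finset.mem_filter.mpr ⟨A.root_mem T.1 T.2,
      T.1, Finset.mem_sdiff.mpr ⟨T.2, hcon⟩, rfl⟩)
  exact Subtype.ext (A.root_inner _ hT)

theorem exists_facet_choice {FA : Set (E d) → Finset (Set (E d))} (hFA : A.IsFacetSelection FA) :
    ∃ T T' : {F // F ∈ A.stabFacets FA} → Active M Ω, ∀ F, FacetAdjacent (T F).1 (T' F).1 ∧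
      F.1 = (T F).1 ∩ (T' F).1 ∧ A.rootCell (T F) = A.rootCell (T' F) ∧
      (A.rootCell (T F)).1 ∈ A.boundaryRoots := by
  classical
  have : ∀ F : {F // F ∈ A.stabFacets FA}, ∃ T T' : Active M Ω, FacetAdjacent T.1 T'.1 ∧
      F.1 = T.1 ∩ T'.1 ∧ A.rootCell T = A.rootCell T' ∧
      (A.rootCell T).1 ∈ A.boundaryRoots := by
    rintro ⟨F, hF⟩
    obtain ⟨K, hK, hFK⟩ := Finset.mem_biUnion.mp hF
    obtain ⟨-, T, hT, T', hT', hadj, heq⟩ := (hFA K hK).1 F hFK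
    rw [A.mem_aggregate] at hT hT'
    exact ⟨⟨T, hT.1⟩, ⟨T', hT'.1⟩, hadj, heq, Subtype.ext (hT.2.trans hT'.2.symm),
      by simpa [rootCell, hT.2] using hK⟩
  choose T T' h using this
  exact ⟨T, T', h⟩

/-- The number of cells with a given root. -/
theorem card_filter_rootCell_le (hd : 1 ≤ d) {σ : ℝ} (hσ : 0 < σ) (hS : M.ShapeRegular σ)
    (hQ : M.QuasiUniform σ) {c : ℝ} (hA : A.DiamBounded c) (K : Active M Ω)
    [DecidablePred fun T : Active M Ω => A.rootCell T = K] :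
    (Finset.univ.filter fun T : Active M Ω => A.rootCell T = K).card ≤
      ⌊(|c| / facetRadius σ) ^ d⌋₊ := by
  classical
  rcases (Finset.univ.filter fun T : Active M Ω => A.rootCell T = K).eq_empty_or_nonempty with h | ⟨T, hT⟩
  · rw [h]; simp
  · have hTK := (Finset.mem_filter.mp hT).2
    have hK : K.1 ∈ M.interiorCells Ω := hTK ▸ A.root_mem T.1 T.2
    refine le_trans ?_ (Nat.le_floor (A.card_aggregate_le hd hσ hS hQ hA hK))
    refine Finset.card_le_card_of_injOn Subtype.val (fun S hS => ?_) Subtype.val_injective.injOn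
    rw [Finset.mem_coe, Finset.mem_filter] at hS
    exact hS.2 ▸ A.mem_aggregate_root S

theorem sum_rootCell_le {n : ℕ} (hn : ∀ K : Active M Ω, ∀ [DecidablePred fun T : Active M Ω =>
      A.rootCell T = K], (Finset.univ.filter fun T : Active M Ω => A.rootCell T = K).card ≤ n)
    {f : Active M Ω → ℝ} (hf : ∀ T, 0 ≤ f T) {s : Finset (Active M Ω)}
    (hs : ∀ T, A.rootCell T ∈ s) :
    ∑ T, f (A.rootCell T) ≤ n * ∑ K ∈ s, f K := by
  classical
  rw [← Finset.sum_fiberwise_of_maps_to (s := Finset.univ) (t := s) (g := A.rootCell)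
    (fun T _ => hs T), Finset.mul_sum]
  refine Finset.sum_le_sum fun K _ => ?_
  rw [Finset.sum_congr rfl (g := fun _ => f K) fun T hT => by rw [(Finset.mem_filter.mp hT).2],
    Finset.sum_const, nsmul_eq_mul]
  exact mul_le_mul_of_nonneg_right (Nat.cast_le.mpr (hn K)) (hf K)

theorem sum_le_of_injective {n : ℕ} (hn : ∀ K : Active M Ω, ∀ [DecidablePred fun T : Active M Ω =>
      A.rootCell T = K], (Finset.univ.filter fun T : Active M Ω => A.rootCell T = K).card ≤ n)
    {X : Type*} [Fintype X] {T T' : X → Active M Ω}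
    (hinj : Function.Injective fun x => (T x, T' x))
    (hroot : ∀ x, A.rootCell (T x) = A.rootCell (T' x)) {a : Active M Ω → ℝ} (ha : ∀ T, 0 ≤ a T) :
    ∑ x, a (T x) ≤ n * ∑ T, a T := by
  classical
  set g : Active M Ω × Active M Ω → ℝ := fun p =>
    if A.rootCell p.2 = A.rootCell p.1 then a p.1 else 0 with hg
  have h1 : ∑ x, a (T x) = ∑ p ∈ Finset.univ.image fun x => (T x, T' x), g p := by
    rw [Finset.sum_image fun x _ y _ h => hinj h]
    refine Finset.sum_congr rfl fun x _ => ?_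
    simp only [hg, hroot x, if_true]
  have h2 : ∑ p ∈ Finset.univ.image fun x => (T x, T' x), g p ≤ ∑ p, g p := by
    refine Finset.sum_le_sum_of_subset_of_nonneg (Finset.subset_univ _) fun p _ _ => ?_
    simp only [hg]
    split_ifs
    · exact ha _
    · exact le_rfl
  rw [h1]
  refine h2.trans ?_
  rw [Fintype.sum_prod_type, Finset.mul_sum]
  refine Finset.sum_le_sum fun S _ => ?_
  simp only [hg]
  rw [← Finset.sum_filter, Finset.sum_const, nsmul_eq_mul]
  exact mul_le_mul_of_nonneg_right (Nat.cast_le.mpr (hn _)) (ha S)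

/-- Differences along an aggregate are bounded by the jumps at its facets. -/
theorem polySq_rootCell_sub_le {FA : Set (E d) → Finset (Set (E d))} (hFA : A.IsFacetSelection FA)
    {n : ℕ} {T : Active M Ω} (hT : (A.rootCell T).1 ∈ A.boundaryRoots)
    (hcard : (A.aggregate (A.rootCell T).1).card ≤ n)
    {B : Set (E d)} (hB : Bornology.IsBounded B) (v : Active M Ω → ι → Poly d) {e : ℝ} (he : 0 ≤ e)
    (h : ∀ S S' : Active M Ω, A.rootCell S = A.rootCell T → A.rootCell S' = A.rootCell T →
      FacetAdjacent S.1 S'.1 → S.1 ∩ S'.1 ∈ FA (A.rootCell T).1 → polySq B (v S - v S') ≤ e) :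
    polySq B (v T - v (A.rootCell T)) ≤ 4 ^ n * e := by
  classical
  set V : Set (E d) → ι → Poly d := fun S => if hS : S ∈ M.active Ω then v ⟨S, hS⟩ else 0 with hV
  have hVv : ∀ S : Active M Ω, V S.1 = v S := fun S => by simp [hV]
  have key := le_of_reflTransGen (S := A.aggregate (A.rootCell T).1)
    (D := fun S S' => polySq B (V S - V S')) he (fun S => by simp [polySq, polyFun_zero])
    (fun a b c => polySq_sub_le hB _ _ _) (fun a b => polySq_sub_comm B _ _) ?_
    (by have := A.mem_aggregate_root (A.rootCell T); rwa [A.rootCell_rootCell] at this)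
    ((hFA _ hT).2 T.1 (A.mem_aggregate_root T))
  · simp only [hVv] at key
    rw [polySq_sub_comm]
    refine key.trans (mul_le_mul_of_nonneg_right ?_ he)
    exact pow_le_pow_right₀ (by norm_num) hcard
  · rintro S S' ⟨hS, hS', hadj, hF⟩
    refine ⟨hS, hS', ?_⟩
    rw [A.mem_aggregate] at hS hS'
    have := h ⟨S, hS.1⟩ ⟨S', hS'.1⟩ (Subtype.ext hS.2) (Subtype.ext hS'.2) hadj hF
    rwa [← hVv, ← hVv] at this

end Aggregation

end Assembly

end UnfittedFEM

namespace UnfittedFEM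

/-! ### Bounds of the face-based forms -/

section FormBounds

variable {d : ℕ} {ι : Type*} [Fintype ι] {κ : ℕ → Type*} [∀ j, Fintype (κ j)]

theorem dirDeriv_sub_comm (p q : Poly d) (j : ℕ) (x : E d) (u : Fin j → E d) :
    dirDeriv (p - q) j x u = -dirDeriv (q - p) j x u := by
  rw [dirDeriv_sub, dirDeriv_sub]; ring

theorem faceForm_eq_sum (hd : 1 ≤ d) {σ : ℝ} (hσ : 0 < σ) {M : BackgroundMesh d}
    (hS : M.ShapeRegular σ) (hQ : M.QuasiUniform σ) {Ω : Set (E d)}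
    (dir : E d → (j : ℕ) → κ j → Fin j → E d) (m : ℕ) {Fs : Finset (Set (E d))}
    {T T' : {F // F ∈ Fs} → Active M Ω}
    (hT : ∀ F, FacetAdjacent (T F).1 (T' F).1) (hF : ∀ F, F.1 = (T F).1 ∩ (T' F).1)
    (u v : Active M Ω → ι → Poly d) :
    faceForm dir Fs m u v = ∑ F : {F // F ∈ Fs},
      faceTerm dir m M.size F.1 (u (T F) - u (T' F)) (v (T F) - v (T' F)) := by
  unfold faceForm
  rw [← Finset.sum_coe_sort Fs]
  refine Finset.sum_congr rfl fun F _ => Finset.sum_congr rfl fun j _ => ?_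
  congr 1
  have := BackgroundMesh.facetIntegral_inter hd hσ hS hQ (T F) (T' F) (hT F)
    (fun S S' x => ∑ i, ∑ k,
      dirDeriv (u S i - u S' i) j x (dir (unitNormal F.1) j k) *
      dirDeriv (v S i - v S' i) j x (dir (unitNormal F.1) j k)) (by
    ext x
    refine Finset.sum_congr rfl fun i _ => Finset.sum_congr rfl fun k _ => ?_
    rw [dirDeriv_sub_comm, dirDeriv_sub_comm (v (T' F) i), neg_mul_neg])
  rw [← hF F] at this
  exact this

theorem sum_mul_sqrt_le {X : Type*} [Fintype X] {a b : X → ℝ} (ha : ∀ x, 0 ≤ a x)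
    (hb : ∀ x, 0 ≤ b x) :
    ∑ x, Real.sqrt (a x) * Real.sqrt (b x) ≤ Real.sqrt (∑ x, a x) * Real.sqrt (∑ x, b x) :=
  Real.sum_sqrt_mul_sqrt_le Finset.univ ha hb

/-- The face-based form is bounded by bounds of the jumps. -/
theorem exists_abs_faceForm_le (hd : 1 ≤ d) {σ : ℝ} (hσ : 0 < σ) (c : ℝ) (N m : ℕ)
    (dir : E d → (j : ℕ) → κ j → Fin j → E d)
    (hdir : ∀ n, ‖n‖ = 1 → ∀ j k a, ‖dir n j k a‖ ≤ 1) :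
    ∃ C : ℝ, 0 < C ∧ ∀ M : BackgroundMesh d, M.ShapeRegular σ → M.QuasiUniform σ →
      ∀ Ω : Set (E d), ∀ A : Aggregation M Ω, A.DiamBounded c →
      ∀ FA : Set (E d) → Finset (Set (E d)), A.IsFacetSelection FA →
      ∀ u v : Active M Ω → ι → Poly d, (∀ T i, u T i ∈ PP d N) → (∀ T i, v T i ∈ PP d N) →
      ∀ a b : Active M Ω → ℝ, (∀ T, 0 ≤ a T) → (∀ T, 0 ≤ b T) →
      (∀ T T' : Active M Ω, FacetAdjacent T.1 T'.1 → ∀ x ∈ T.1 ∩ T'.1,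
        polySq (Metric.closedBall x (2 * M.size)) (u T - u T') ≤ a T + a T') →
      (∀ T T' : Active M Ω, FacetAdjacent T.1 T'.1 → ∀ x ∈ T.1 ∩ T'.1,
        polySq (Metric.closedBall x (2 * M.size)) (v T - v T') ≤ b T + b T') →
      |faceForm dir (A.stabFacets FA) m u v| ≤ C * (Real.sqrt (∑ T, a T) * Real.sqrt (∑ T, b T)) := by
  obtain ⟨C, hC, hle⟩ := exists_abs_faceTerm_le (ι := ι) hd hσ N m dir hdir
  set n := ⌊(|c| / facetRadius σ) ^ d⌋₊
  refine ⟨C * (2 * n + 1), by positivity, ?_⟩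
  intro M hS hQ Ω A hA FA hFA u v hu hv a b ha hb hau hbv
  obtain ⟨T, T', hTT⟩ := A.exists_facet_choice hFA
  rw [faceForm_eq_sum hd hσ hS hQ dir m (fun F => (hTT F).1) (fun F => (hTT F).2.1)]
  have hn : ∀ K : Active M Ω, ∀ [DecidablePred fun T : Active M Ω => A.rootCell T = K],
    (Finset.univ.filter fun T : Active M Ω => A.rootCell T = K).card ≤ n := fun K _ =>
    A.card_filter_rootCell_le hd hσ hS hQ hA K
  have hinj : Function.Injective fun F => (T F, T' F) := by
    intro F F' h
    obtain ⟨h1, h2⟩ := Prod.mk.inj h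
    exact Subtype.ext (by rw [(hTT F).2.1, (hTT F').2.1, h1, h2])
  have hinj' : Function.Injective fun F => (T' F, T F) := by
    intro F F' h
    obtain ⟨h1, h2⟩ := Prod.mk.inj h
    exact hinj (by simp only [h1, h2])
  have hsum : ∀ g : Active M Ω → ℝ, (∀ T, 0 ≤ g T) →
      ∑ F, (g (T F) + g (T' F)) ≤ (2 * n + 1) * ∑ T, g T := by
    intro g hg
    rw [Finset.sum_add_distrib]
    have h1 := A.sum_le_of_injective hn hinj (fun F => (hTT F).2.2.1) hg
    have h2 := A.sum_le_of_injective hn hinj' (fun F => (hTT F).2.2.1.symm) hg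
    have h3 : 0 ≤ ∑ T, g T := Finset.sum_nonneg fun T _ => hg T
    linarith
  have hterm : ∀ F, |faceTerm dir m M.size F.1 (u (T F) - u (T' F)) (v (T F) - v (T' F))| ≤
      C * (Real.sqrt (a (T F) + a (T' F)) * Real.sqrt (b (T F) + b (T' F))) := by
    intro F
    obtain ⟨hadj, hF, -⟩ := hTT F
    obtain ⟨x, hx⟩ := hadj.2.1.2.1
    rw [hF]
    refine (hle M hS hQ _ (BackgroundMesh.mem_cells_of_active (T F).2) _
      (BackgroundMesh.mem_cells_of_active (T' F).2) hadj x hx _ _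
      (fun i => Submodule.sub_mem _ (hu _ i) (hu _ i))
      (fun i => Submodule.sub_mem _ (hv _ i) (hv _ i))).trans ?_
    exact mul_le_mul_of_nonneg_left (mul_le_mul (Real.sqrt_le_sqrt (hau _ _ hadj x hx))
      (Real.sqrt_le_sqrt (hbv _ _ hadj x hx)) (Real.sqrt_nonneg _) (Real.sqrt_nonneg _)) hC.le
  refine (Finset.abs_sum_le_sum_abs _ _).trans ((Finset.sum_le_sum fun F _ => hterm F).trans ?_)
  rw [← Finset.mul_sum, mul_assoc]
  refine mul_le_mul_of_nonneg_left ?_ hC.le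
  refine (sum_mul_sqrt_le (fun F => add_nonneg (ha _) (ha _))
    (fun F => add_nonneg (hb _) (hb _))).trans ?_
  refine (mul_le_mul (Real.sqrt_le_sqrt (hsum a ha)) (Real.sqrt_le_sqrt (hsum b hb))
    (Real.sqrt_nonneg _) (Real.sqrt_nonneg _)).trans_eq ?_
  rw [Real.sqrt_mul (by positivity), Real.sqrt_mul (by positivity)]
  have := Real.mul_self_sqrt (show (0 : ℝ) ≤ 2 * n + 1 by positivity)
  linear_combination (Real.sqrt (∑ T, a T) * Real.sqrt (∑ T, b T)) * this

/-- The jumps of a piecewise polynomial are bounded by its norm. -/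
theorem exists_polySq_jump_le (hd : 1 ≤ d) {σ : ℝ} (hσ : 0 < σ) (N : ℕ) :
    ∃ C : ℝ, 0 < C ∧ ∀ M : BackgroundMesh d, M.ShapeRegular σ → M.QuasiUniform σ →
      ∀ Ω : Set (E d), ∀ v : Active M Ω → ι → Poly d, (∀ T i, v T i ∈ PP d N) →
      ∀ T T' : Active M Ω, ∀ x ∈ T.1 ∩ T'.1,
        polySq (Metric.closedBall x (2 * M.size)) (v T - v T') ≤
          C * polySq (interior T.1) (v T) + C * polySq (interior T'.1) (v T') := by
  obtain ⟨C, hC, hle⟩ := exists_polySq_le (ι := ι) hd hσ N 2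
  refine ⟨2 * C, by positivity, fun M hS hQ Ω v hv T T' x hx => ?_⟩
  have h1 := hle M hS hQ T.1 (BackgroundMesh.mem_cells_of_active T.2) x hx.1 _ subset_rfl (v T) (hv T)
  have h2 := hle M hS hQ T'.1 (BackgroundMesh.mem_cells_of_active T'.2) x hx.2 _ subset_rfl (v T')
    (hv T')
  have h3 := polySq_sub_le (Metric.isBounded_closedBall (x := x) (r := 2 * M.size)) (v T) 0 (v T')
  rw [sub_zero, polySq_sub_comm _ 0, sub_zero] at h3
  linarith

theorem exists_faceForm_self_le (hd : 1 ≤ d) {σ : ℝ} (hσ : 0 < σ) (c : ℝ) (N m : ℕ)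
    (dir : E d → (j : ℕ) → κ j → Fin j → E d)
    (hdir : ∀ n, ‖n‖ = 1 → ∀ j k a, ‖dir n j k a‖ ≤ 1) :
    ∃ C : ℝ, 0 < C ∧ ∀ M : BackgroundMesh d, M.ShapeRegular σ → M.QuasiUniform σ →
      ∀ Ω : Set (E d), ∀ A : Aggregation M Ω, A.DiamBounded c →
      ∀ FA : Set (E d) → Finset (Set (E d)), A.IsFacetSelection FA →
      ∀ v : Active M Ω → ι → Poly d, (∀ T i, v T i ∈ PP d N) →
      faceForm dir (A.stabFacets FA) m v v ≤ C * ∑ T : Active M Ω, polySq (interior T.1) (v T) := by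
  obtain ⟨C₁, hC₁, h₁⟩ := exists_abs_faceForm_le (ι := ι) hd hσ c N m dir hdir
  obtain ⟨C₂, hC₂, h₂⟩ := exists_polySq_jump_le (ι := ι) hd hσ N
  refine ⟨C₁ * C₂, by positivity, fun M hS hQ Ω A hA FA hFA v hv => (le_abs_self _).trans ?_⟩
  have hnn : ∀ T : Active M Ω, 0 ≤ C₂ * polySq (interior T.1) (v T) := fun T =>
    mul_nonneg hC₂.le (polySq_nonneg _ _)
  have h := h₁ M hS hQ Ω A hA FA hFA v v hv hv _ _ hnn hnn
    (fun T T' _ x hx => h₂ M hS hQ Ω v hv T T' x hx)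
    (fun T T' _ x hx => h₂ M hS hQ Ω v hv T T' x hx)
  rwa [Real.mul_self_sqrt (Finset.sum_nonneg fun T _ => hnn T), ← Finset.mul_sum, ← mul_assoc] at h

/-- Weak consistency in terms of the errors on the cells. -/
theorem exists_abs_faceForm_le_cellError (hd : 1 ≤ d) {σ : ℝ} (hσ : 0 < σ) (c : ℝ) (N m s : ℕ)
    (dir : E d → (j : ℕ) → κ j → Fin j → E d)
    (hdir : ∀ n, ‖n‖ = 1 → ∀ j k a, ‖dir n j k a‖ ≤ 1) :
    ∃ C : ℝ, 0 < C ∧ ∀ M : BackgroundMesh d, M.ShapeRegular σ → M.QuasiUniform σ →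
      ∀ Ω U : Set (E d), IsOpen U → M.activeDomain Ω ⊆ U →
      ∀ A : Aggregation M Ω, A.DiamBounded c →
      ∀ FA : Set (E d) → Finset (Set (E d)), A.IsFacetSelection FA →
      ∀ w : ι → E d → ℝ, (∀ i, MemSobolev U s (w i)) →
      ∀ u v : Active M Ω → ι → Poly d, (∀ T i, u T i ∈ PP d N) → (∀ T i, v T i ∈ PP d N) →
      |faceForm dir (A.stabFacets FA) m u v| ≤
        C * (Real.sqrt (∑ T : Active M Ω, cellError U M.size s w T.1 (u T)) *
          Real.sqrt (∑ T : Active M Ω, polySq (interior T.1) (v T))) := by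
  obtain ⟨C₁, hC₁, h₁⟩ := exists_abs_faceForm_le (ι := ι) hd hσ c N m dir hdir
  obtain ⟨C₂, hC₂, h₂⟩ := exists_polySq_jump_le (ι := ι) hd hσ N
  obtain ⟨C₃, hC₃, h₃⟩ := exists_facet_approximation (ι := ι) hd hσ N s 2
  refine ⟨C₁ * (Real.sqrt C₃ * Real.sqrt C₂), by positivity,
    fun M hS hQ Ω U hU hΩU A hA FA hFA w hw u v hu hv => ?_⟩
  have hh : ∀ T : Active M Ω, 0 ≤ M.size := fun T =>
    (BackgroundMesh.size_pos hd (BackgroundMesh.mem_cells_of_active T.2)).le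
  have hnn : ∀ T : Active M Ω, 0 ≤ C₂ * polySq (interior T.1) (v T) := fun T =>
    mul_nonneg hC₂.le (polySq_nonneg _ _)
  have hnn' : ∀ T : Active M Ω, 0 ≤ C₃ * cellError U M.size s w T.1 (u T) := fun T =>
    mul_nonneg hC₃.le (cellError_nonneg (hh T))
  have h := h₁ M hS hQ Ω A hA FA hFA u v hu hv _ _ hnn' hnn
    (fun T T' hadj x hx => by
      rw [← mul_add]
      refine h₃ M hS hQ U hU T.1 (BackgroundMesh.mem_cells_of_active T.2) T'.1
        (BackgroundMesh.mem_cells_of_active T'.2) hadj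
        ((BackgroundMesh.interior_subset_activeDomain ?_).trans hΩU) w hw _ _ (hu T) (hu T') x hx _
        subset_rfl
      rintro y (hy | hy)
      · exact mem_iUnion₂.mpr ⟨_, T.2, hy⟩
      · exact mem_iUnion₂.mpr ⟨_, T'.2, hy⟩)
    (fun T T' _ x hx => h₂ M hS hQ Ω v hv T T' x hx)
  rw [← Finset.mul_sum, ← Finset.mul_sum, Real.sqrt_mul hC₃.le, Real.sqrt_mul hC₂.le] at h
  refine h.trans_eq ?_
  ring

/-- The norm on the active domain is controlled by the norm on the interior cells and the
stabilisation. -/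
theorem exists_sum_polySq_le (hd : 1 ≤ d) {σ : ℝ} (hσ : 0 < σ) (c : ℝ)
    (W : Submodule ℝ (ι → Poly d)) {N : ℕ}
    (hWN : ∀ v ∈ W, ∀ i, v i ∈ PP d N)
    (hWaff : ∀ v ∈ W, ∀ b h, (fun i => affSub b h (v i)) ∈ W) (m : ℕ)
    (dir : E d → (j : ℕ) → κ j → Fin j → E d) (hdir : ∀ j k, Continuous fun n => dir n j k)
    (hunis : ∀ n, ‖n‖ = 1 → ∀ v ∈ W, (∀ i, ∀ j ≤ m, ∀ k, ∀ x, inner ℝ n x = (0 : ℝ) →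
      dirDeriv (v i) j x (dir n j k) = 0) → v = 0) :
    ∃ C : ℝ, 0 < C ∧ ∀ M : BackgroundMesh d, M.ShapeRegular σ → M.QuasiUniform σ →
      ∀ Ω : Set (E d), ∀ A : Aggregation M Ω, A.DiamBounded c →
      ∀ FA : Set (E d) → Finset (Set (E d)), A.IsFacetSelection FA →
      ∃ s : Finset (Active M Ω), (∀ T ∈ s, interior T.1 ⊆ Ω) ∧
      ∀ v : Active M Ω → ι → Poly d, (∀ T, v T ∈ W) →
      ∑ T : Active M Ω, polySq (interior T.1) (v T) ≤
        C * (∑ T ∈ s, polySq (interior T.1) (v T) + faceForm dir (A.stabFacets FA) m v v) := by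
  classical
  obtain ⟨C₁, hC₁, h₁⟩ := exists_polySq_le_faceTerm hd hσ W hWN hWaff m dir hdir hunis (2 * |c|)
  obtain ⟨C₂, hC₂, h₂⟩ := exists_polySq_le (ι := ι) hd hσ N |c|
  set n := ⌊(|c| / facetRadius σ) ^ d⌋₊
  set C₃ := 2 * (4 ^ n * C₁) + 2 * C₂ + 1 with hC₃
  have hC₃0 : 0 < C₃ := by positivity
  refine ⟨(n + 1) * C₃, by positivity, fun M hS hQ Ω A hA FA hFA =>
    ⟨Finset.univ.image A.rootCell, ?_, fun v hv => ?_⟩⟩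
  · intro K hK
    obtain ⟨T, -, rfl⟩ := Finset.mem_image.mp hK
    exact A.rootCell_interior T
  obtain ⟨T, T', hTT⟩ := A.exists_facet_choice hFA
  have hn : ∀ K : Active M Ω, ∀ [DecidablePred fun T : Active M Ω => A.rootCell T = K],
    (Finset.univ.filter fun T : Active M Ω => A.rootCell T = K).card ≤ n := fun K _ =>
    A.card_filter_rootCell_le hd hσ hS hQ hA K
  rw [faceForm_eq_sum hd hσ hS hQ dir m (fun F => (hTT F).1) (fun F => (hTT F).2.1)]
  set τ := fun F : {F // F ∈ A.stabFacets FA} =>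
    faceTerm dir m M.size F.1 (v (T F) - v (T' F)) (v (T F) - v (T' F)) with hτ
  have hτ0 : ∀ F, 0 ≤ τ F := fun F => faceTerm_self_nonneg dir m
    (BackgroundMesh.size_pos hd (BackgroundMesh.mem_cells_of_active (T F).2)).le _ _
  set g := fun K : Active M Ω => polySq (interior K.1) (v K) +
    ∑ F with A.rootCell (T F) = K, τ F with hg
  have hg0 : ∀ K, 0 ≤ g K := fun K =>
    add_nonneg (polySq_nonneg _ _) (Finset.sum_nonneg fun F _ => hτ0 F)
  have hcell : ∀ S : Active M Ω, polySq (interior S.1) (v S) ≤ C₃ * g (A.rootCell S) := by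
    intro S
    by_cases hK : (A.rootCell S).1 ∈ A.boundaryRoots
    · have hKc := BackgroundMesh.mem_cells_of_active (A.rootCell S).2
      have hh := BackgroundMesh.size_pos hd hKc
      have hKint : (A.rootCell S).1 ∈ M.interiorCells Ω := A.root_mem S.1 S.2
      obtain ⟨z, hz⟩ := (M.polytope _ hKc).2
      have hzK := interior_subset hz
      set B := Metric.closedBall z (|c| * M.size) with hB
      have hBb : Bornology.IsBounded B := Metric.isBounded_closedBall
      have hsub : ∀ S' : Active M Ω, A.rootCell S' = A.rootCell S → S'.1 ⊆ B := fun S' hS' =>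
        (A.aggregate_subset_closedBall hA hKint (hS' ▸ A.mem_aggregate_root S')
          (by have := A.mem_aggregate_root (A.rootCell S); rwa [A.rootCell_rootCell] at this)
          hzK).trans (Metric.closedBall_subset_closedBall (by gcongr; exact le_abs_self c))
      set e := ∑ F with A.rootCell (T F) = A.rootCell S, τ F with he
      have he0 : 0 ≤ e := Finset.sum_nonneg fun F _ => hτ0 F
      have hchain := A.polySq_rootCell_sub_le hFA hK
        (Nat.le_floor (A.card_aggregate_le hd hσ hS hQ hA hKint)) hBb v (e := C₁ * e)
        (by positivity) (by
          intro P P' hP hP' hadj hPF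
          have hF : P.1 ∩ P'.1 ∈ A.stabFacets FA := Finset.mem_biUnion.mpr ⟨_, hK, hPF⟩
          obtain ⟨hadjF, hFeq, hroot, -⟩ := hTT ⟨_, hF⟩
          set F : {F // F ∈ A.stabFacets FA} := ⟨_, hF⟩
          have hcase := BackgroundMesh.eq_or_eq_of_inter_eq hd hσ hS hQ
            (BackgroundMesh.mem_cells_of_active P.2) (BackgroundMesh.mem_cells_of_active P'.2)
            (BackgroundMesh.mem_cells_of_active (T F).2)
            (BackgroundMesh.mem_cells_of_active (T' F).2) hadj hadjF.1 hFeq.symm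
          simp only [← Subtype.ext_iff] at hcase
          have hTF : A.rootCell (T F) = A.rootCell S := by
            rcases hcase with ⟨h, -⟩ | ⟨h, -⟩ <;> rw [h] <;> assumption
          have hPP : polySq B (v P - v P') = polySq B (v (T F) - v (T' F)) := by
            rcases hcase with ⟨h, h'⟩ | ⟨h, h'⟩
            · rw [h, h']
            · rw [h, h', polySq_sub_comm]
          obtain ⟨x, hx⟩ := hadjF.2.1.2.1
          have h5 := h₁ M hS hQ _ (BackgroundMesh.mem_cells_of_active (T F).2) _
            (BackgroundMesh.mem_cells_of_active (T' F).2) hadjF x hx B (by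
              refine Metric.closedBall_subset_closedBall' ?_
              have := hsub _ hTF hx.1
              rw [Metric.mem_closedBall, dist_comm] at this
              linarith) _ (W.sub_mem (hv (T F)) (hv (T' F)))
          rw [hPP]
          refine h5.trans (mul_le_mul_of_nonneg_left ?_ hC₁.le)
          rw [← hFeq]
          exact Finset.single_le_sum (f := τ) (fun F _ => hτ0 F)
            (Finset.mem_filter.mpr ⟨Finset.mem_univ F, hTF⟩))
      have hK2 := h₂ M hS hQ _ hKc z hzK B subset_rfl (v (A.rootCell S)) (hWN _ (hv _))
      have h6 := polySq_sub_le hBb (v S) (v (A.rootCell S)) 0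
      rw [sub_zero, sub_zero] at h6
      have h7 := polySq_mono hBb (interior_subset.trans (hsub S rfl)) (v S)
      have h8 := polySq_nonneg (interior (A.rootCell S).1) (v (A.rootCell S))
      have h9 : g (A.rootCell S) = polySq (interior (A.rootCell S).1) (v (A.rootCell S)) + e := rfl
      rw [h9, hC₃]
      have h10 : 0 ≤ 4 ^ n * C₁ := by positivity
      nlinarith
    · have hroot := A.rootCell_eq_self hK
      rw [hroot]
      have h1 : polySq (interior S.1) (v S) ≤ g S :=
        le_add_of_nonneg_right (Finset.sum_nonneg fun F _ => hτ0 F)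
      have h2 : 1 ≤ C₃ := by rw [hC₃]; have : 0 ≤ 2 * (4 ^ n * C₁) + 2 * C₂ := by positivity
                             linarith
      exact h1.trans (le_mul_of_one_le_left (hg0 S) h2)
  have hsum := A.sum_rootCell_le hn hg0 (s := Finset.univ.image A.rootCell)
    (fun S => Finset.mem_image_of_mem _ (Finset.mem_univ S))
  have hsum2 : ∑ K ∈ Finset.univ.image A.rootCell, g K =
      ∑ K ∈ Finset.univ.image A.rootCell, polySq (interior K.1) (v K) + ∑ F, τ F := by
    rw [hg, Finset.sum_add_distrib]
    congr 1
    exact Finset.sum_fiberwise_of_maps_to (fun F _ => Finset.mem_image_of_mem _ (Finset.mem_univ _)) _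
  refine (Finset.sum_le_sum fun S _ => hcell S).trans ?_
  rw [← Finset.mul_sum, ← hsum2]
  have h0 : 0 ≤ ∑ K ∈ Finset.univ.image A.rootCell, g K := Finset.sum_nonneg fun K _ => hg0 K
  nlinarith

end FormBounds

end UnfittedFEM

namespace UnfittedFEM

/-! ### Approximation by functions that are polynomial on the aggregates -/

section KernelApproximation

variable {d : ℕ} {ι : Type*} [Fintype ι]

/-- On a cell, a smooth function is approximated by a polynomial. -/
theorem exists_cell_approximation (hd : 1 ≤ d) {σ : ℝ} (hσ : 0 < σ) (N s : ℕ) (R : ℝ) :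
    ∃ C : ℝ, 0 < C ∧ ∀ M : BackgroundMesh d, M.ShapeRegular σ → M.QuasiUniform σ →
      ∀ U : Set (E d), IsOpen U → ∀ T ∈ M.cells, interior T ⊆ U →
      ∀ w : ι → E d → ℝ, (∀ i, MemSobolev U s (w i)) →
      ∃ q : ι → Poly d, (∀ i, q i ∈ PP d (s - 1)) ∧ ∀ p : ι → Poly d, (∀ i, p i ∈ PP d N) →
      ∀ x ∈ T, ∀ S ⊆ Metric.closedBall x (R * M.size),
      polySq S (p - q) ≤ C * cellError U M.size s w T p := by
  obtain ⟨C₁, hC₁, hq⟩ := exists_polynomial_approximation d N s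
  obtain ⟨C₂, hC₂, hle⟩ := exists_setIntegral_sq_le d (max N s) (R + 1)
    (ρ := facetRadius σ / 8) (by have := facetRadius_pos hσ; positivity)
  set b := max 1 (facetRadius σ ^ (2 * s)) with hb
  have hb1 : 1 ≤ b := le_max_left _ _
  refine ⟨C₂ * (C₁ * b), by positivity, ?_⟩
  intro M hS hQ U hU T hT hTU w hw
  have hh : 0 < M.size := BackgroundMesh.size_pos hd hT
  obtain ⟨z, hz⟩ := BackgroundMesh.exists_closedBall_subset_interior hd hσ hS hQ hT
  set r := facetRadius σ * M.size with hr
  have hr0 : 0 < r := mul_pos (facetRadius_pos hσ) hh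
  choose q hqP hqle using fun i => hq U hU (w i) (hw i).1 (fun α => weakDeriv U α (w i))
    (fun α hα => weakDeriv_spec (hw i) hα.le) z r hr0 (hz.trans hTU)
  refine ⟨q, hqP, fun p hp x hx S hSx => ?_⟩
  unfold polySq cellError
  rw [Finset.mul_sum]
  refine Finset.sum_le_sum fun i _ => ?_
  have hpq : p i - q i ∈ PP d (max N s) := Submodule.sub_mem _
    (PP_mono (le_max_left _ _) (hp i))
    (PP_mono ((Nat.sub_le _ _).trans (le_max_right _ _)) (hqP i))
  have hzT : z ∈ T := interior_subset (hz (Metric.mem_closedBall_self hr0.le))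
  refine (hle _ hpq M.size hh z S
    (BackgroundMesh.subset_closedBall_of_mem hT hx hzT hSx)).trans ?_
  rw [mul_assoc]
  refine mul_le_mul_of_nonneg_left ?_ hC₂.le
  have e : facetRadius σ / 8 * M.size = r / 8 := by rw [hr]; ring
  rw [e]
  refine (hqle i (p i) (hp i) z (by rw [dist_self]; positivity)).trans ?_
  rw [mul_assoc]
  refine mul_le_mul_of_nonneg_left ?_ hC₁.le
  have h1 : ∫ y in Metric.closedBall z (r / 4), (w i y - polyFun (p i) y) ^ 2 ≤
      ∫ y in interior T, (w i y - polyFun (p i) y) ^ 2 :=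
    setIntegral_mono_set (integrableOn_sub_polyFun_sq (hw i).1
      ((M.isBounded_cell hT).subset interior_subset) hTU _)
      (Filter.Eventually.of_forall fun _ => sq_nonneg _)
      ((Metric.closedBall_subset_closedBall (by linarith)).trans hz).eventuallyLE
  have h2 : ∑ α ∈ Finset.piAntidiag (Finset.univ : Finset (Fin d)) s,
      ∫ x in Metric.closedBall z r, weakDeriv U α (w i) x ^ 2 ≤
      ∑ α ∈ Finset.piAntidiag (Finset.univ : Finset (Fin d)) s,
        ∫ x in interior T, weakDeriv U α (w i) x ^ 2 := by
    refine Finset.sum_le_sum fun α hα => ?_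
    have hGi := (weakDeriv_spec (hw i) (α := α)
      (by simpa using (Finset.mem_piAntidiag.mp hα).1.le)).1.integrable_sq
    exact setIntegral_mono_set (IntegrableOn.mono_set hGi hTU)
      (Filter.Eventually.of_forall fun _ => sq_nonneg _) hz.eventuallyLE
  have h3 : 0 ≤ ∫ y in interior T, (w i y - polyFun (p i) y) ^ 2 :=
    integral_nonneg fun _ => sq_nonneg _
  have h4 : 0 ≤ ∑ α ∈ Finset.piAntidiag (Finset.univ : Finset (Fin d)) s,
      ∫ x in Metric.closedBall z r, weakDeriv U α (w i) x ^ 2 :=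
    Finset.sum_nonneg fun _ _ => integral_nonneg fun _ => sq_nonneg _
  have h5 : r ^ (2 * s) ≤ b * M.size ^ (2 * s) := by
    rw [hr, mul_pow]
    exact mul_le_mul_of_nonneg_right (le_max_right _ _) (by positivity)
  have h6 := mul_le_mul h5 h2 h4 (by positivity)
  have h7 := le_mul_of_one_le_left h3 hb1
  rw [mul_add, ← mul_assoc b]
  exact add_le_add (h1.trans h7) h6

/-- A piecewise polynomial can be replaced by one that is polynomial on each nontrivial aggregate,
with an error of the same size. -/
theorem exists_aggregate_approximation (hd : 1 ≤ d) {σ : ℝ} (hσ : 0 < σ) (c : ℝ) (N s : ℕ) :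
    ∃ C : ℝ, 0 < C ∧ ∀ M : BackgroundMesh d, M.ShapeRegular σ → M.QuasiUniform σ →
      ∀ Ω U : Set (E d), IsOpen U → M.activeDomain Ω ⊆ U →
      ∀ A : Aggregation M Ω, A.DiamBounded c →
      ∀ FA : Set (E d) → Finset (Set (E d)), A.IsFacetSelection FA →
      ∀ w : ι → E d → ℝ, (∀ i, MemSobolev U s (w i)) →
      ∀ u : Active M Ω → ι → Poly d, (∀ T i, u T i ∈ PP d N) →
      ∃ u' : Active M Ω → ι → Poly d, (∀ T, u' T = u T ∨ ∀ i, u' T i ∈ PP d (s - 1)) ∧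
        (∀ T T', A.rootCell T = A.rootCell T' → (A.rootCell T).1 ∈ A.boundaryRoots →
          u' T = u' T') ∧
        ∑ T : Active M Ω, ∑ i, ∫ x in interior T.1, (w i x - polyFun (u' T i) x) ^ 2 ≤
          C * ∑ T : Active M Ω, cellError U M.size s w T.1 (u T) := by
  classical
  obtain ⟨C₁, hC₁, h₁⟩ := exists_facet_approximation (ι := ι) hd hσ N s (2 * |c|)
  obtain ⟨C₂, hC₂, h₂⟩ := exists_cell_approximation (ι := ι) hd hσ N s |c|
  set n := ⌊(|c| / facetRadius σ) ^ d⌋₊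
  set C₃ := 2 + 2 * (2 * (4 ^ n * (C₁ * 2)) + 2 * C₂) with hC₃
  have hC₃0 : 0 < C₃ := by positivity
  refine ⟨(n + 1) * C₃, by positivity, fun M hS hQ Ω U hU hΩU A hA FA hFA w hw u hu => ?_⟩
  have hcellU : ∀ T : Active M Ω, interior T.1 ⊆ U := fun T =>
    (BackgroundMesh.interior_cell_subset_activeDomain T.2).trans hΩU
  choose q hqP hq using fun K : Active M Ω => h₂ M hS hQ U hU K.1
    (BackgroundMesh.mem_cells_of_active K.2) (hcellU K) w hw
  set u' : Active M Ω → ι → Poly d := fun T =>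
    if (A.rootCell T).1 ∈ A.boundaryRoots then q (A.rootCell T) else u T with hu'
  have hh : ∀ T : Active M Ω, 0 ≤ M.size := fun T =>
    (BackgroundMesh.size_pos hd (BackgroundMesh.mem_cells_of_active T.2)).le
  set Φ := fun T : Active M Ω => cellError U M.size s w T.1 (u T) with hΦ
  have hΦ0 : ∀ T, 0 ≤ Φ T := fun T => cellError_nonneg (hh T)
  set g := fun K : Active M Ω => ∑ T with A.rootCell T = K, Φ T with hg
  have hg0 : ∀ K, 0 ≤ g K := fun K => Finset.sum_nonneg fun T _ => hΦ0 T
  have hΦg : ∀ T K, A.rootCell T = K → Φ T ≤ g K := fun T K h =>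
    Finset.single_le_sum (f := Φ) (fun T _ => hΦ0 T)
      (Finset.mem_filter.mpr ⟨Finset.mem_univ T, h⟩)
  have herr : ∀ T : Active M Ω,
      ∑ i, ∫ x in interior T.1, (w i x - polyFun (u T i) x) ^ 2 ≤ Φ T := fun T =>
    Finset.sum_le_sum fun i _ => le_add_of_nonneg_right (mul_nonneg
      (pow_nonneg (hh T) _) (Finset.sum_nonneg fun _ _ => integral_nonneg fun _ => sq_nonneg _))
  refine ⟨u', fun T => ?_, fun T T' hTT hT => ?_, ?_⟩
  · by_cases hT : (A.rootCell T).1 ∈ A.boundaryRoots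
    · right; simp only [hu', if_pos hT]; exact hqP _
    · left; simp only [hu', if_neg hT]
  · simp only [hu', ← hTT, if_pos hT]
  have hcell : ∀ T : Active M Ω,
      ∑ i, ∫ x in interior T.1, (w i x - polyFun (u' T i) x) ^ 2 ≤ C₃ * g (A.rootCell T) := by
    intro S
    by_cases hK : (A.rootCell S).1 ∈ A.boundaryRoots
    · simp only [hu', if_pos hK]
      have hKc := BackgroundMesh.mem_cells_of_active (A.rootCell S).2
      have hKint : (A.rootCell S).1 ∈ M.interiorCells Ω := A.root_mem S.1 S.2
      obtain ⟨z, hz⟩ := (M.polytope _ hKc).2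
      have hzK := interior_subset hz
      set B := Metric.closedBall z (|c| * M.size) with hB
      have hBb : Bornology.IsBounded B := Metric.isBounded_closedBall
      have hsub : ∀ S' : Active M Ω, A.rootCell S' = A.rootCell S → S'.1 ⊆ B := fun S' hS' =>
        (A.aggregate_subset_closedBall hA hKint (hS' ▸ A.mem_aggregate_root S')
          (by have := A.mem_aggregate_root (A.rootCell S); rwa [A.rootCell_rootCell] at this)
          hzK).trans (Metric.closedBall_subset_closedBall
            (mul_le_mul_of_nonneg_right (le_abs_self c) (hh S)))
      have hgK := hg0 (A.rootCell S)
      have hchain := A.polySq_rootCell_sub_le hFA hK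
        (Nat.le_floor (A.card_aggregate_le hd hσ hS hQ hA hKint)) hBb u
        (e := C₁ * (2 * g (A.rootCell S))) (by positivity) (by
          intro P P' hP hP' hadj _
          obtain ⟨x, hx⟩ := hadj.2.1.2.1
          have h5 := h₁ M hS hQ U hU _ (BackgroundMesh.mem_cells_of_active P.2) _
            (BackgroundMesh.mem_cells_of_active P'.2) hadj (by
              refine (BackgroundMesh.interior_subset_activeDomain ?_).trans hΩU
              rintro y (hy | hy)
              · exact mem_iUnion₂.mpr ⟨_, P.2, hy⟩
              · exact mem_iUnion₂.mpr ⟨_, P'.2, hy⟩) w hw _ _ (hu P) (hu P') x hx B (by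
              refine Metric.closedBall_subset_closedBall' ?_
              have := hsub _ hP hx.1
              rw [Metric.mem_closedBall, dist_comm] at this
              linarith)
          refine h5.trans (mul_le_mul_of_nonneg_left ?_ hC₁.le)
          have e1 := hΦg P _ hP
          have e2 := hΦg P' _ hP'
          simp only [hΦ] at e1 e2
          linarith)
      have hK2 := hq (A.rootCell S) (u (A.rootCell S)) (hu _) z hzK B subset_rfl
      have hK3 : Φ (A.rootCell S) ≤ g (A.rootCell S) := hΦg _ _ (A.rootCell_rootCell S)
      have h6 := polySq_sub_le hBb (u S) (u (A.rootCell S)) (q (A.rootCell S))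
      have h7 := polySq_mono hBb (interior_subset.trans (hsub S rfl)) (u S - q (A.rootCell S))
      have h8 := hΦg S _ rfl
      have h9 : ∑ i, ∫ x in interior S.1, (w i x - polyFun (q (A.rootCell S) i) x) ^ 2 ≤
          2 * (∑ i, ∫ x in interior S.1, (w i x - polyFun (u S i) x) ^ 2) +
          2 * polySq (interior S.1) (u S - q (A.rootCell S)) := by
        unfold polySq
        rw [Finset.mul_sum, Finset.mul_sum, ← Finset.sum_add_distrib]
        refine Finset.sum_le_sum fun i _ => ?_
        have hb := (M.isBounded_cell (BackgroundMesh.mem_cells_of_active S.2)).subset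
          (interior_subset (s := S.1))
        have := setIntegral_add_sq_le (S := interior S.1)
          (f := fun x => w i x - polyFun (u S i) x) (g := polyFun (u S i - q (A.rootCell S) i))
          (((hw i).1.mono_measure (Measure.restrict_mono (hcellU S) le_rfl)).sub
            (memLp_polyFun _ hb)) (memLp_polyFun _ hb)
        refine le_trans (le_of_eq ?_) this
        simp only [polyFun_sub, Pi.sub_apply, sub_add_sub_cancel]
      have h10 := herr S
      have h11 := mul_le_mul_of_nonneg_left hK3 hC₂.le
      simp only [hΦ] at h8 h10 h11
      have h12 : (4 : ℝ) ^ ⌊(|c| / facetRadius σ) ^ d⌋₊ = 4 ^ n := rfl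
      rw [h12] at hchain
      rw [hC₃]
      linarith
    · have hroot := A.rootCell_eq_self hK
      simp only [hu', if_neg hK]
      have h1 := (herr S).trans (hΦg S _ rfl)
      have h2 : 1 ≤ C₃ := by
        rw [hC₃]
        have : 0 ≤ 2 * (2 * (4 ^ n * (C₁ * 2)) + 2 * C₂) := by positivity
        linarith
      exact h1.trans (le_mul_of_one_le_left (hg0 _) h2)
  have hn : ∀ K : Active M Ω, ∀ [DecidablePred fun T : Active M Ω => A.rootCell T = K],
    (Finset.univ.filter fun T : Active M Ω => A.rootCell T = K).card ≤ n := fun K _ =>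
    A.card_filter_rootCell_le hd hσ hS hQ hA K
  have hsum := A.sum_rootCell_le hn hg0 (s := Finset.univ) (fun S => Finset.mem_univ _)
  have hsum2 : ∑ K, g K = ∑ T, Φ T :=
    Finset.sum_fiberwise_of_maps_to (fun T _ => Finset.mem_univ _) _
  refine (Finset.sum_le_sum fun S _ => hcell S).trans ?_
  rw [← Finset.mul_sum, ← hsum2]
  have h0 : 0 ≤ ∑ K, g K := Finset.sum_nonneg fun K _ => hg0 K
  nlinarith

/-- A function that is polynomial on the nontrivial aggregates is in the kernel of the form. -/
theorem faceForm_eq_zero {κ : ℕ → Type*} [∀ j, Fintype (κ j)] (hd : 1 ≤ d) {σ : ℝ} (hσ : 0 < σ)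
    {M : BackgroundMesh d} (hS : M.ShapeRegular σ) (hQ : M.QuasiUniform σ) {Ω : Set (E d)}
    (A : Aggregation M Ω) {FA : Set (E d) → Finset (Set (E d))} (hFA : A.IsFacetSelection FA)
    (dir : E d → (j : ℕ) → κ j → Fin j → E d) (m : ℕ) {u : Active M Ω → ι → Poly d}
    (hu : ∀ T T', A.rootCell T = A.rootCell T' → (A.rootCell T).1 ∈ A.boundaryRoots → u T = u T')
    (v : Active M Ω → ι → Poly d) : faceForm dir (A.stabFacets FA) m u v = 0 := by
  obtain ⟨T, T', hTT⟩ := A.exists_facet_choice hFA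
  rw [faceForm_eq_sum hd hσ hS hQ dir m (fun F => (hTT F).1) (fun F => (hTT F).2.1)]
  refine Finset.sum_eq_zero fun F _ => ?_
  rw [hu _ _ (hTT F).2.2.1 (hTT F).2.2.2, sub_self, faceTerm_zero]

/-- The sum of the errors on the cells. -/
theorem sum_cellError_le {M : BackgroundMesh d} {Ω U : Set (E d)} (hΩU : M.activeDomain Ω ⊆ U)
    (hh : 0 ≤ M.size) {s : ℕ} {w : ι → E d → ℝ} (hw : ∀ i, MemSobolev U s (w i))
    (u : Active M Ω → ι → Poly d) :
    ∑ T : Active M Ω, cellError U M.size s w T.1 (u T) ≤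
      (∑ T : Active M Ω, ∑ i, ∫ x in interior T.1, (w i x - polyFun (u T i) x) ^ 2) +
        M.size ^ (2 * s) * ∑ i, sobolevNorm U s (w i) ^ 2 := by
  unfold cellError
  simp only [Finset.sum_add_distrib]
  refine add_le_add le_rfl ?_
  rw [Finset.sum_comm, Finset.mul_sum]
  refine Finset.sum_le_sum fun i _ => ?_
  rw [← Finset.mul_sum]
  refine mul_le_mul_of_nonneg_left ?_ (by positivity)
  refine le_trans ?_ (sum_integral_weakDeriv_sq_le (hw i))
  rw [Finset.sum_comm]
  refine Finset.sum_le_sum fun α hα => ?_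
  have hGi := (weakDeriv_spec (hw i) (α := α)
    (by simpa using (Finset.mem_piAntidiag.mp hα).1.le)).1.integrable_sq
  rw [← setIntegral_activeDomain (IntegrableOn.mono_set hGi hΩU)]
  exact setIntegral_mono_set hGi (Filter.Eventually.of_forall fun _ => sq_nonneg _)
    hΩU.eventuallyLE

end KernelApproximation

end UnfittedFEM

namespace UnfittedFEM

/-! ### The flux and pressure forms -/

section Forms

variable {d : ℕ} {M : BackgroundMesh d} {Ω : Set (E d)}

/-- The normal directions. -/
def normalDir (n : E d) (j : ℕ) (_ : Unit) (_ : Fin j) : E d := n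

/-- The coordinate directions. -/
noncomputable def coordDir (_ : E d) (j : ℕ) (I : Fin j → Fin d) (a : Fin j) : E d :=
  EuclideanSpace.single (I a) 1

theorem iteratedFDeriv_vecPolyFun_apply (v : VecPoly d) (j : ℕ) (x : E d) (u : Fin j → E d)
    (i : Fin d) : iteratedFDeriv ℝ j (vecPolyFun v) x u i = dirDeriv (v i) j x u := by
  have hc : ContDiff ℝ j (vecPolyFun v) := by
    rw [contDiff_piLp]
    exact fun i => polyFun_contDiff (v i)
  have h := (EuclideanSpace.proj i : E d →L[ℝ] ℝ).iteratedFDeriv_comp_left hc.contDiffAt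
    (x := x) (i := j) le_rfl
  have e : (EuclideanSpace.proj i : E d →L[ℝ] ℝ) ∘ vecPolyFun v = polyFun (v i) := rfl
  rw [e] at h
  rw [dirDeriv, h]
  rfl

theorem faceFluxForm_eq (Fs : Finset (Set (E d))) (m : ℕ) (u v : PwVecPoly M Ω) :
    faceFluxForm Fs m u v = faceForm (κ := fun _ => Unit) normalDir Fs m u v := by
  unfold faceFluxForm faceForm
  refine Finset.sum_congr rfl fun F _ => Finset.sum_congr rfl fun j _ => ?_
  congr 2
  ext T T' x
  rw [PiLp.inner_apply]
  refine Finset.sum_congr rfl fun i _ => ?_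
  simp only [Finset.univ_unique, Finset.sum_singleton, normalJump, PiLp.sub_apply,
    iteratedFDeriv_vecPolyFun_apply, dirDeriv_sub]
  simp only [RCLike.inner_apply, conj_trivial]
  exact mul_comm _ _

theorem facePressureForm_eq (Fs : Finset (Set (E d))) (m : ℕ) (p q : PwPoly M Ω) :
    facePressureForm Fs m p q = faceForm (κ := fun j => Fin j → Fin d) coordDir Fs m
      (fun T (_ : Unit) => p T) (fun T _ => q T) := by
  unfold facePressureForm faceForm
  refine Finset.sum_congr rfl fun F _ => Finset.sum_congr rfl fun j _ => ?_
  congr 2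
  ext T T' x
  simp only [Finset.univ_unique, Finset.sum_singleton, dirDeriv_sub]
  rfl

theorem QQ_le_PP (d m : ℕ) : QQ d m ≤ PP d (d * m) := by
  intro p hp
  rw [MvPolynomial.mem_restrictDegree] at hp
  rw [MvPolynomial.mem_restrictTotalDegree]
  refine Finset.sup_le fun s hs => ?_
  rw [Finsupp.sum_fintype _ _ fun _ => rfl]
  refine (Finset.sum_le_card_nsmul _ _ m fun i _ => hp s hs i).trans ?_
  simp

theorem affSub_X (b : E d) (h : ℝ) (i : Fin d) :
    affSub b h (MvPolynomial.X i) = MvPolynomial.C (b i) + MvPolynomial.C h * MvPolynomial.X i := by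
  simp [affSub]

/-- A space of fields with the properties used for the flux. -/
theorem exists_flux_space (hd : 2 ≤ d) {Vd : Submodule ℝ (VecPoly d)} {m : ℕ}
    (h : (Vd : Set (VecPoly d)) ⊆ raviartThomas d m ∨
      (Vd : Set (VecPoly d)) ⊆ vecOf (QQ d m)) :
    ∃ (W : Submodule ℝ (VecPoly d)) (N : ℕ), Vd ≤ W ∧ (∀ v ∈ W, ∀ i, v i ∈ PP d N) ∧
      (∀ v ∈ W, ∀ b h, (fun i => affSub b h (v i)) ∈ W) ∧
      ∀ n, ‖n‖ = 1 → ∀ v ∈ W, (∀ i, ∀ j ≤ m, ∀ k, ∀ x, inner ℝ n x = (0 : ℝ) →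
        dirDeriv (v i) j x (normalDir n j k) = 0) → v = 0 := by
  rcases h with h | h
  · let W : Submodule ℝ (VecPoly d) :=
      { carrier := raviartThomas d m
        zero_mem' := ⟨0, 0, fun _ => Submodule.zero_mem _, Submodule.zero_mem _, by simp⟩
        add_mem' := by
          rintro v v' ⟨p, q, hp, hq, e⟩ ⟨p', q', hp', hq', e'⟩
          refine ⟨p + p', q + q', fun i => Submodule.add_mem _ (hp i) (hp' i),
            Submodule.add_mem _ hq hq', fun i => ?_⟩
          rw [Pi.add_apply, e, e', Pi.add_apply]
          ring
        smul_mem' := by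
          rintro a v ⟨p, q, hp, hq, e⟩
          refine ⟨a • p, a • q, fun i => Submodule.smul_mem _ _ (hp i),
            Submodule.smul_mem _ _ hq, fun i => ?_⟩
          rw [Pi.smul_apply, e, Pi.smul_apply, smul_add, mul_smul_comm] }
    refine ⟨W, m + 1, h, ?_, ?_, fun n hn v hv hv' =>
      eq_zero_of_mem_raviartThomas hd hn hv fun i j hj x hx => hv' i j hj () x hx⟩
    · rintro v ⟨p, q, hp, hq, e⟩ i
      rw [e]
      refine Submodule.add_mem _ (PP_mono (Nat.le_succ m) (hp i)) ?_
      rw [MvPolynomial.mem_restrictTotalDegree] at hq ⊢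
      refine (MvPolynomial.totalDegree_mul _ _).trans ?_
      rw [MvPolynomial.totalDegree_X]
      omega
    · rintro v ⟨p, q, hp, hq, e⟩ b t
      refine ⟨fun i => affSub b t (p i) + b i • affSub b t q, t • affSub b t q,
        fun i => Submodule.add_mem _ (affSub_mem_PP b t (hp i))
          (Submodule.smul_mem _ _ (affSub_mem_PP b t hq)),
        Submodule.smul_mem _ _ (affSub_mem_PP b t hq), fun i => ?_⟩
      simp only [e, map_add, map_mul, affSub_X, MvPolynomial.smul_eq_C_mul]
      ring
  · refine ⟨Submodule.pi univ fun _ => QQ d m, d * m, fun v hv i _ => h hv i,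
      fun v hv i => QQ_le_PP d m (hv i (mem_univ i)),
      fun v hv b t i _ => affSub_mem_QQ b t (hv i (mem_univ i)), fun n hn v hv hv' => ?_⟩
    ext1 i
    exact eq_zero_of_mem_QQ hn (hv i (mem_univ i)) fun j hj x hx => hv' i j hj () x hx

theorem norm_normalDir {n : E d} (hn : ‖n‖ = 1) (j : ℕ) (k : Unit) (a : Fin j) :
    ‖normalDir n j k a‖ ≤ 1 := hn.le

theorem norm_coordDir (n : E d) (j : ℕ) (I : Fin j → Fin d) (a : Fin j) :
    ‖coordDir n j I a‖ ≤ 1 := by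
  simp [coordDir]

/-- The space of the polynomials of degree at most `m` in each variable, as a space of tuples. -/
noncomputable def pressureTuples (d m : ℕ) : Submodule ℝ (Unit → Poly d) :=
  Submodule.pi univ fun _ => QQ d m

theorem mem_pressureTuples {m : ℕ} {v : Unit → Poly d} :
    v ∈ pressureTuples d m ↔ v () ∈ QQ d m :=
  ⟨fun h => h () (mem_univ _), fun h _ _ => h⟩

theorem eq_zero_of_mem_pressureTuples {m : ℕ} {n : E d} (hn : ‖n‖ = 1) {v : Unit → Poly d}
    (hv : v ∈ pressureTuples d m)
    (h : ∀ i, ∀ j ≤ m, ∀ k, ∀ x, inner ℝ n x = (0 : ℝ) →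
      dirDeriv (v i) j x (coordDir n j k) = 0) : v = 0 := by
  ext1 i
  refine eq_zero_of_mem_QQ hn (mem_pressureTuples.mp hv) fun j hj x hx => ?_
  rw [dirDeriv, multilinear_eq_sum_single]
  exact Finset.sum_eq_zero fun I _ => by
    have := h () j hj I x hx
    rw [dirDeriv] at this
    rw [show (fun a => EuclideanSpace.single (I a) (1 : ℝ)) = coordDir n j I from rfl, this,
      mul_zero]

theorem size_nonneg (M : BackgroundMesh d) : 0 ≤ M.size := by
  refine Real.sSup_nonneg ?_
  rintro _ ⟨T, -, rfl⟩
  exact Metric.diam_nonneg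

/-! ### Norm equivalence -/

theorem exists_flux_norm_equivalence (hd : 2 ≤ d) {Vd : Submodule ℝ (VecPoly d)} {m : ℕ}
    (h : (Vd : Set (VecPoly d)) ⊆ raviartThomas d m ∨
      (Vd : Set (VecPoly d)) ⊆ vecOf (QQ d m)) {σ : ℝ} (hσ : 0 < σ) (c : ℝ) :
    ∃ C : ℝ, 0 < C ∧ ∀ M : BackgroundMesh d, M.ShapeRegular σ → M.QuasiUniform σ →
      ∀ Ω : Set (E d), Ω ⊆ M.activeDomain Ω → ∀ A : Aggregation M Ω, A.DiamBounded c →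
      ∀ FA : Set (E d) → Finset (Set (E d)), A.IsFacetSelection FA →
      ∀ v : PwVecPoly M Ω, (∀ T, v T ∈ Vd) →
      l2norm Ω (pwVecFun v) ^ 2 + faceFluxForm (A.stabFacets FA) m v v ≤
        C * l2norm (M.activeDomain Ω) (pwVecFun v) ^ 2 ∧
      l2norm (M.activeDomain Ω) (pwVecFun v) ^ 2 ≤
        C * (l2norm Ω (pwVecFun v) ^ 2 + faceFluxForm (A.stabFacets FA) m v v) := by
  have hd1 : 1 ≤ d := by omega
  obtain ⟨W, N, hVW, hWN, hWaff, hunis⟩ := exists_flux_space hd h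
  obtain ⟨C₁, hC₁, h₁⟩ := exists_faceForm_self_le (ι := Fin d) (κ := fun _ => Unit) hd1 hσ c N m normalDir
    fun n hn j k a => norm_normalDir hn j k a
  obtain ⟨C₂, hC₂, h₂⟩ := exists_sum_polySq_le (κ := fun _ => Unit) hd1 hσ c W hWN hWaff m normalDir
    (fun j k => by unfold normalDir; fun_prop) hunis
  refine ⟨1 + C₁ + C₂, by positivity, fun M hS hQ Ω hΩ A hA FA hFA v hv => ?_⟩
  obtain ⟨s, hs, h₂'⟩ := h₂ M hS hQ Ω A hA FA hFA
  have e1 := h₁ M hS hQ Ω A hA FA hFA v fun T => hWN _ (hVW (hv T))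
  have e2 := h₂' v fun T => hVW (hv T)
  have e3 := sum_polySq_interior_le_vec hs v
  have e4 : l2norm Ω (pwVecFun v) ^ 2 ≤ l2norm (M.activeDomain Ω) (pwVecFun v) ^ 2 :=
    pow_le_pow_left₀ (l2norm_nonneg _ _) (l2norm_mono hΩ (memLp_pwVecFun v _)) 2
  rw [← faceFluxForm_eq, ← l2norm_pwVecFun_sq] at e1 e2
  have e5 := sq_nonneg (l2norm (M.activeDomain Ω) (pwVecFun v))
  have e6 : 0 ≤ l2norm Ω (pwVecFun v) ^ 2 + faceFluxForm (A.stabFacets FA) m v v := by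
    have := e5.trans e2
    have := (mul_nonneg_iff_of_pos_left hC₂).mp this
    linarith
  constructor
  · nlinarith
  · have : C₂ * (∑ T ∈ s, polySq (interior T.1) (v T) + faceFluxForm (A.stabFacets FA) m v v) ≤
      C₂ * (l2norm Ω (pwVecFun v) ^ 2 + faceFluxForm (A.stabFacets FA) m v v) := by gcongr
    nlinarith

theorem exists_pressure_norm_equivalence (hd : 1 ≤ d) {V0 : Submodule ℝ (Poly d)} {m : ℕ}
    (h : V0 ≤ QQ d m) {σ : ℝ} (hσ : 0 < σ) (c : ℝ) :
    ∃ C : ℝ, 0 < C ∧ ∀ M : BackgroundMesh d, M.ShapeRegular σ → M.QuasiUniform σ →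
      ∀ Ω : Set (E d), Ω ⊆ M.activeDomain Ω → ∀ A : Aggregation M Ω, A.DiamBounded c →
      ∀ FA : Set (E d) → Finset (Set (E d)), A.IsFacetSelection FA →
      ∀ q ∈ pressureSpace M Ω V0,
      l2norm Ω (pwFun q) ^ 2 + facePressureForm (A.stabFacets FA) m q q ≤
        C * l2norm (M.activeDomain Ω) (pwFun q) ^ 2 ∧
      l2norm (M.activeDomain Ω) (pwFun q) ^ 2 ≤
        C * (l2norm Ω (pwFun q) ^ 2 + facePressureForm (A.stabFacets FA) m q q) := by
  obtain ⟨C₁, hC₁, h₁⟩ := exists_faceForm_self_le (ι := Unit) (κ := fun j => Fin j → Fin d) hd hσ c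
    (d * m) m coordDir fun n _ j k a => norm_coordDir n j k a
  obtain ⟨C₂, hC₂, h₂⟩ := exists_sum_polySq_le (κ := fun j => Fin j → Fin d) hd hσ c
    (pressureTuples d m) (fun v hv i => QQ_le_PP d m (mem_pressureTuples.mp hv))
    (fun v hv b t => mem_pressureTuples.mpr (affSub_mem_QQ b t (mem_pressureTuples.mp hv))) m
    coordDir (fun j k => by unfold coordDir; fun_prop)
    fun n hn v hv hv' => eq_zero_of_mem_pressureTuples hn hv hv'
  refine ⟨1 + C₁ + C₂, by positivity, fun M hS hQ Ω hΩ A hA FA hFA v hv => ?_⟩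
  obtain ⟨s, hs, h₂'⟩ := h₂ M hS hQ Ω A hA FA hFA
  have e1 := h₁ M hS hQ Ω A hA FA hFA (fun T _ => v T) fun T _ => QQ_le_PP d m (h (hv T))
  have e2 := h₂' (fun T _ => v T) fun T => mem_pressureTuples.mpr (h (hv T))
  have e3 := sum_polySq_interior_le hs v
  have e4 : l2norm Ω (pwFun v) ^ 2 ≤ l2norm (M.activeDomain Ω) (pwFun v) ^ 2 :=
    pow_le_pow_left₀ (l2norm_nonneg _ _) (l2norm_mono hΩ (memLp_pwFun v _)) 2
  rw [← facePressureForm_eq, ← l2norm_pwFun_sq] at e1 e2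
  have e5 := sq_nonneg (l2norm (M.activeDomain Ω) (pwFun v))
  have e6 : 0 ≤ l2norm Ω (pwFun v) ^ 2 + facePressureForm (A.stabFacets FA) m v v := by
    have := e5.trans e2
    have := (mul_nonneg_iff_of_pos_left hC₂).mp this
    linarith
  constructor
  · nlinarith
  · have : C₂ * (∑ T ∈ s, polySq (interior T.1) (fun _ : Unit => v T) +
        facePressureForm (A.stabFacets FA) m v v) ≤
      C₂ * (l2norm Ω (pwFun v) ^ 2 + facePressureForm (A.stabFacets FA) m v v) := by gcongr
    nlinarith

end Forms

end UnfittedFEM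

namespace UnfittedFEM

/-! ### Weak consistency and approximation by the kernel -/

section Consistency

variable {d : ℕ}

theorem vecSobolevNorm_sq (U : Set (E d)) (s : ℕ) (w : E d → E d) :
    vecSobolevNorm U s w ^ 2 = ∑ i, sobolevNorm U s (fun x => w x i) ^ 2 :=
  Real.sq_sqrt (Finset.sum_nonneg fun _ _ => sq_nonneg _)

theorem vecSobolevNorm_nonneg (U : Set (E d)) (s : ℕ) (w : E d → E d) :
    0 ≤ vecSobolevNorm U s w := Real.sqrt_nonneg _

theorem vecSobolevNorm_mono {U V : Set (E d)} (hU : IsOpen U) (hV : IsOpen V) (hUV : U ⊆ V)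
    {s : ℕ} {w : E d → E d} (h : MemVecSobolev V s w) :
    vecSobolevNorm U s w ≤ vecSobolevNorm V s w :=
  Real.sqrt_le_sqrt (Finset.sum_le_sum fun i _ =>
    pow_le_pow_left₀ (sobolevNorm_nonneg _ _) (sobolevNorm_mono hU hV hUV (h i)) 2)

theorem MemVecSobolev.memLp {U : Set (E d)} {s : ℕ} {w : E d → E d} (h : MemVecSobolev U s w) :
    MemLp w 2 (volume.restrict U) :=
  MemLp.of_eval_piLp fun i => (h i).1

theorem sq_le_of_le_mul {a b c x y : ℝ} (ha : 0 ≤ a) (hb : 0 ≤ b) (hx : 0 ≤ x) (hxy : x ≤ y)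
    (h : a ≤ c * b * x) : a ^ 2 ≤ c ^ 2 * (b * y) ^ 2 := by
  have h1 : a ≤ |c| * (b * y) := by
    refine h.trans ?_
    rw [mul_assoc]
    exact mul_le_mul (le_abs_self c) (mul_le_mul_of_nonneg_left hxy hb) (by positivity)
      (abs_nonneg c)
  calc a ^ 2 ≤ (|c| * (b * y)) ^ 2 := pow_le_pow_left₀ ha h1 2
    _ = _ := by rw [mul_pow, sq_abs]

theorem sum_cellError_le_vec {M : BackgroundMesh d} {Ω U : Set (E d)} (hU : IsOpen U)
    (hΩU : M.activeDomain Ω ⊆ U) {s : ℕ} {c : ℝ} {w : E d → E d} (hw : MemVecSobolev U s w)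
    {u : PwVecPoly M Ω}
    (hu : l2norm (M.activeDomain Ω) (fun x => w x - pwVecFun u x) ≤
      c * M.size ^ s * vecSobolevNorm (M.activeDomain Ω) s w) :
    ∑ T : Active M Ω, cellError U M.size s (fun i x => w x i) T.1 (u T) ≤
      (c ^ 2 + 1) * (M.size ^ s * vecSobolevNorm U s w) ^ 2 := by
  have h1 := sum_cellError_le hΩU (size_nonneg M) (w := fun i x => w x i) hw u
  rw [← l2norm_sub_pwVecFun_sq (hw.memLp.mono_measure (Measure.restrict_mono hΩU le_rfl)) u,
    ← vecSobolevNorm_sq] at h1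
  have h2 := sq_le_of_le_mul (l2norm_nonneg _ _) (pow_nonneg (size_nonneg M) s)
    (vecSobolevNorm_nonneg _ _ _)
    (vecSobolevNorm_mono (BackgroundMesh.isOpen_activeDomain Ω) hU hΩU hw) hu
  have h3 : M.size ^ (2 * s) * vecSobolevNorm U s w ^ 2 =
      (M.size ^ s * vecSobolevNorm U s w) ^ 2 := by ring
  rw [h3] at h1
  linarith

theorem sum_cellError_le_scalar {M : BackgroundMesh d} {Ω U : Set (E d)} (hU : IsOpen U)
    (hΩU : M.activeDomain Ω ⊆ U) {s : ℕ} {c : ℝ} {w : E d → ℝ} (hw : MemSobolev U s w)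
    {u : PwPoly M Ω}
    (hu : l2norm (M.activeDomain Ω) (fun x => w x - pwFun u x) ≤
      c * M.size ^ s * sobolevNorm (M.activeDomain Ω) s w) :
    ∑ T : Active M Ω, cellError U M.size s (fun (_ : Unit) => w) T.1 (fun _ => u T) ≤
      (c ^ 2 + 1) * (M.size ^ s * sobolevNorm U s w) ^ 2 := by
  have h1 := sum_cellError_le hΩU (size_nonneg M) (w := fun (_ : Unit) => w) (fun _ => hw)
    (fun T _ => u T)
  simp only [Finset.univ_unique, Finset.sum_singleton] at h1
  rw [← l2norm_sub_pwFun_sq (hw.1.mono_measure (Measure.restrict_mono hΩU le_rfl)) u] at h1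
  have h2 := sq_le_of_le_mul (l2norm_nonneg _ _) (pow_nonneg (size_nonneg M) s)
    (sobolevNorm_nonneg _ _)
    (sobolevNorm_mono (BackgroundMesh.isOpen_activeDomain Ω) hU hΩU hw) hu
  have h3 : M.size ^ (2 * s) * sobolevNorm U s w ^ 2 =
      (M.size ^ s * sobolevNorm U s w) ^ 2 := by ring
  rw [h3] at h1
  linarith

theorem mul_sqrt_le {C c a b x y : ℝ} (hC : 0 ≤ C) (ha : a ≤ (c ^ 2 + 1) * x ^ 2) (hx : 0 ≤ x)
    (hb : b = y ^ 2) (hy : 0 ≤ y) :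
    C * (Real.sqrt a * Real.sqrt b) ≤ C * Real.sqrt (c ^ 2 + 1) * x * y := by
  have h1 : Real.sqrt a ≤ Real.sqrt (c ^ 2 + 1) * x := by
    refine (Real.sqrt_le_sqrt ha).trans_eq ?_
    rw [Real.sqrt_mul (by positivity), Real.sqrt_sq hx]
  rw [hb, Real.sqrt_sq hy, mul_assoc, mul_assoc, ← mul_assoc (Real.sqrt (c ^ 2 + 1))]
  exact mul_le_mul_of_nonneg_left (mul_le_mul_of_nonneg_right h1 hy) hC

theorem exists_flux_consistency (hd : 2 ≤ d) {Vd : Submodule ℝ (VecPoly d)} {m : ℕ}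
    (h : (Vd : Set (VecPoly d)) ⊆ raviartThomas d m ∨
      (Vd : Set (VecPoly d)) ⊆ vecOf (QQ d m)) {σ : ℝ} (hσ : 0 < σ) (c cint : ℝ) (s : ℕ) :
    ∃ C : ℝ, 0 < C ∧ ∀ M : BackgroundMesh d, M.ShapeRegular σ → M.QuasiUniform σ →
      ∀ Ω U : Set (E d), IsOpen U → M.activeDomain Ω ⊆ U →
      ∀ A : Aggregation M Ω, A.DiamBounded c →
      ∀ FA : Set (E d) → Finset (Set (E d)), A.IsFacetSelection FA →
      ∀ w, MemVecSobolev U s w → ∀ u v : PwVecPoly M Ω, (∀ T, u T ∈ Vd) → (∀ T, v T ∈ Vd) →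
      l2norm (M.activeDomain Ω) (fun x => w x - pwVecFun u x) ≤
        cint * M.size ^ s * vecSobolevNorm (M.activeDomain Ω) s w →
      |faceFluxForm (A.stabFacets FA) m u v| ≤
        C * M.size ^ s * vecSobolevNorm U s w * l2norm (M.activeDomain Ω) (pwVecFun v) := by
  obtain ⟨W, N, hVW, hWN, -, -⟩ := exists_flux_space hd h
  obtain ⟨C, hC, hle⟩ := exists_abs_faceForm_le_cellError (ι := Fin d) (κ := fun _ => Unit)
    (one_le_two.trans hd) hσ c N m s normalDir fun n hn j k a => norm_normalDir hn j k a
  refine ⟨C * Real.sqrt (cint ^ 2 + 1), by positivity, ?_⟩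
  intro M hS hQ Ω U hU hΩU A hA FA hFA w hw u v hu hv happ
  have h1 := hle M hS hQ Ω U hU hΩU A hA FA hFA (fun i x => w x i) hw u v
    (fun T => hWN _ (hVW (hu T))) (fun T => hWN _ (hVW (hv T)))
  rw [← faceFluxForm_eq] at h1
  refine h1.trans ((mul_sqrt_le hC.le (sum_cellError_le_vec hU hΩU hw happ)
    (mul_nonneg (pow_nonneg (size_nonneg M) s) (vecSobolevNorm_nonneg _ _ _))
    (l2norm_pwVecFun_sq v).symm (l2norm_nonneg _ _)).trans_eq ?_)
  ring

theorem exists_pressure_consistency (hd : 1 ≤ d) {V0 : Submodule ℝ (Poly d)} {m : ℕ}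
    (h : V0 ≤ QQ d m) {σ : ℝ} (hσ : 0 < σ) (c cint : ℝ) (s : ℕ) :
    ∃ C : ℝ, 0 < C ∧ ∀ M : BackgroundMesh d, M.ShapeRegular σ → M.QuasiUniform σ →
      ∀ Ω U : Set (E d), IsOpen U → M.activeDomain Ω ⊆ U →
      ∀ A : Aggregation M Ω, A.DiamBounded c →
      ∀ FA : Set (E d) → Finset (Set (E d)), A.IsFacetSelection FA →
      ∀ w, MemSobolev U s w → ∀ u ∈ pressureSpace M Ω V0, ∀ v ∈ pressureSpace M Ω V0,
      l2norm (M.activeDomain Ω) (fun x => w x - pwFun u x) ≤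
        cint * M.size ^ s * sobolevNorm (M.activeDomain Ω) s w →
      |facePressureForm (A.stabFacets FA) m u v| ≤
        C * M.size ^ s * sobolevNorm U s w * l2norm (M.activeDomain Ω) (pwFun v) := by
  obtain ⟨C, hC, hle⟩ := exists_abs_faceForm_le_cellError (ι := Unit)
    (κ := fun j => Fin j → Fin d) hd hσ c (d * m) m s coordDir fun n _ j k a => norm_coordDir n j k a
  refine ⟨C * Real.sqrt (cint ^ 2 + 1), by positivity, ?_⟩
  intro M hS hQ Ω U hU hΩU A hA FA hFA w hw u hu v hv happ
  have h1 := hle M hS hQ Ω U hU hΩU A hA FA hFA (fun _ => w) (fun _ => hw) (fun T _ => u T)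
    (fun T _ => v T) (fun T _ => QQ_le_PP d m (h (hu T))) (fun T _ => QQ_le_PP d m (h (hv T)))
  rw [← facePressureForm_eq] at h1
  refine h1.trans ((mul_sqrt_le hC.le (sum_cellError_le_scalar hU hΩU hw happ)
    (mul_nonneg (pow_nonneg (size_nonneg M) s) (sobolevNorm_nonneg _ _))
    (l2norm_pwFun_sq v).symm (l2norm_nonneg _ _)).trans_eq ?_)
  ring

theorem exists_kernel_approximation (hd : 1 ≤ d) {V0 : Submodule ℝ (Poly d)} {m k : ℕ}
    (h : V0 ≤ QQ d m) (hk : PP d k ≤ V0) {σ : ℝ} (hσ : 0 < σ) (c cint : ℝ) {s : ℕ}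
    (hs : s ≤ k + 1) :
    ∃ C : ℝ, 0 < C ∧ ∀ M : BackgroundMesh d, M.ShapeRegular σ → M.QuasiUniform σ →
      ∀ Ω U : Set (E d), IsOpen U → M.activeDomain Ω ⊆ U →
      ∀ A : Aggregation M Ω, A.DiamBounded c →
      ∀ FA : Set (E d) → Finset (Set (E d)), A.IsFacetSelection FA →
      ∀ w, MemSobolev U s w → ∀ u ∈ pressureSpace M Ω V0,
      l2norm (M.activeDomain Ω) (fun x => w x - pwFun u x) ≤
        cint * M.size ^ s * sobolevNorm (M.activeDomain Ω) s w →
      ∃ q ∈ pressureKernel M Ω V0 (facePressureForm (A.stabFacets FA) m),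
        l2norm (M.activeDomain Ω) (fun x => w x - pwFun q x) ≤
          C * M.size ^ s * sobolevNorm U s w := by
  obtain ⟨C, hC, hle⟩ := exists_aggregate_approximation (ι := Unit) hd hσ c (d * m) s
  refine ⟨Real.sqrt (C * (cint ^ 2 + 1)), by positivity, ?_⟩
  intro M hS hQ Ω U hU hΩU A hA FA hFA w hw u hu happ
  obtain ⟨u', h1, h2, h3⟩ := hle M hS hQ Ω U hU hΩU A hA FA hFA (fun _ => w) (fun _ => hw)
    (fun T _ => u T) (fun T _ => QQ_le_PP d m (h (hu T)))
  refine ⟨fun T => u' T (), ⟨fun T => ?_, fun φ _ => ?_⟩, ?_⟩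
  · rcases h1 T with h1 | h1
    · simp only [h1]; exact hu T
    · exact hk (PP_mono (by omega) (h1 ()))
  · rw [facePressureForm_eq]
    exact faceForm_eq_zero hd hσ hS hQ A hFA coordDir m h2 _
  · simp only [Finset.univ_unique, Finset.sum_singleton] at h3
    have h4 := l2norm_sub_pwFun_sq (hw.1.mono_measure (Measure.restrict_mono hΩU le_rfl))
      (fun T => u' T ())
    have h5 := sum_cellError_le_scalar hU hΩU hw happ
    have hnn : 0 ≤ M.size ^ s * sobolevNorm U s w :=
      mul_nonneg (pow_nonneg (size_nonneg M) s) (sobolevNorm_nonneg _ _)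
    have h6 : l2norm (M.activeDomain Ω) (fun x => w x - pwFun (fun T => u' T ()) x) ^ 2 ≤
        (C * (cint ^ 2 + 1)) * (M.size ^ s * sobolevNorm U s w) ^ 2 := by
      rw [h4, mul_assoc]
      exact h3.trans (mul_le_mul_of_nonneg_left h5 hC.le)
    have h7 := Real.sqrt_le_sqrt h6
    rwa [Real.sqrt_sq (l2norm_nonneg _ _), Real.sqrt_mul (by positivity), Real.sqrt_sq hnn,
      ← mul_assoc] at h7

theorem facePressureForm_const {M : BackgroundMesh d} {Ω : Set (E d)} (Fs : Finset (Set (E d)))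
    (m : ℕ) (a : ℝ) (q : PwPoly M Ω) :
    facePressureForm Fs m (fun _ => MvPolynomial.C a) q = 0 := by
  simp [facePressureForm, fullJump, facetIntegral]

theorem le_sum_abs (C : ℕ → ℝ) {s n : ℕ} (hs : s ≤ n) :
    C s ≤ ∑ s ∈ Finset.range (n + 1), |C s| :=
  (le_abs_self (C s)).trans (Finset.single_le_sum (f := fun s => |C s|)
    (fun s _ => abs_nonneg (C s)) (Finset.mem_range.mpr (Nat.lt_succ_of_le hs)))

end Consistency

end UnfittedFEM
theorem mainTheorem6 (d : ℕ) (hd : 2 ≤ d)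
    -- the local polynomial spaces and the polynomial degrees of the discrete spaces
    (Vd : Submodule ℝ (UnfittedFEM.VecPoly d)) (V0 : Submodule ℝ (UnfittedFEM.Poly d))
    (ku kp : ℕ)
    (hku : IsGreatest {k : ℕ | UnfittedFEM.vecOf (UnfittedFEM.PP d k) ⊆
      (Vd : Set (UnfittedFEM.VecPoly d))} ku)
    (hkp : IsGreatest {k : ℕ | UnfittedFEM.PP d k ≤ V0} kp)
    -- the orders of the derivatives in the forms
    (mu mp : ℕ)
    (hmu : (Vd : Set (UnfittedFEM.VecPoly d)) ⊆ UnfittedFEM.raviartThomas d mu ∨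
      (Vd : Set (UnfittedFEM.VecPoly d)) ⊆ UnfittedFEM.vecOf (UnfittedFEM.QQ d mu))
    (hmp : V0 ≤ UnfittedFEM.QQ d mp)
    -- shape regularity and quasi-uniformity, diameters of the aggregates, interpolation
    (σ : ℝ) (hσ : 0 < σ) (cag : ℝ) (cint : ℝ) :
    ∃ C : ℝ, 0 < C ∧
      ∀ (M : UnfittedFEM.BackgroundMesh d), M.ShapeRegular σ → M.QuasiUniform σ →
      ∀ Ω : Set (UnfittedFEM.E d), IsOpen Ω → Ω ⊆ (⋃ T ∈ M.cells, T) →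
      ∀ Ωext : Set (UnfittedFEM.E d), IsOpen Ωext → M.activeDomain Ω ⊆ Ωext →
      ∀ (A : UnfittedFEM.Aggregation M Ω), A.DiamBounded cag →
      ∀ FA : Set (UnfittedFEM.E d) → Finset (Set (UnfittedFEM.E d)), A.IsFacetSelection FA →
      ∀ (Pd : (UnfittedFEM.E d → UnfittedFEM.E d) →ₗ[ℝ] UnfittedFEM.PwVecPoly M Ω)
        (P0 : (UnfittedFEM.E d → ℝ) →ₗ[ℝ] UnfittedFEM.PwPoly M Ω),
      UnfittedFEM.IsCochainInterpolation M Ω Vd V0 ku kp cint Pd P0 →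
        UnfittedFEM.StabilisationAssumption M Ω Vd V0 ku kp Ωext Pd P0
          (UnfittedFEM.faceFluxForm (A.stabFacets FA) mu)
          (UnfittedFEM.facePressureForm (A.stabFacets FA) mp) C ∧
        UnfittedFEM.KernelApproximation M Ω V0 kp Ωext
          (UnfittedFEM.facePressureForm (A.stabFacets FA) mp) C := by
  have hd1 : 1 ≤ d := one_le_two.trans hd
  obtain ⟨C₁, hC₁, h₁⟩ := UnfittedFEM.exists_flux_norm_equivalence hd hmu hσ cag
  obtain ⟨C₂, hC₂, h₂⟩ := UnfittedFEM.exists_pressure_norm_equivalence hd1 hmp hσ cag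
  choose C₃ hC₃ h₃ using fun s => UnfittedFEM.exists_flux_consistency hd hmu hσ cag cint s
  choose C₄ hC₄ h₄ using fun s => UnfittedFEM.exists_pressure_consistency hd1 hmp hσ cag cint s
  choose! C₅ hC₅ h₅ using fun s (hs : s ≤ kp + 1) =>
    UnfittedFEM.exists_kernel_approximation hd1 hmp hkp.1 hσ cag cint hs
  set D₃ := ∑ s ∈ Finset.range (ku + 1 + 1), |C₃ s|
  set D₄ := ∑ s ∈ Finset.range (kp + 1 + 1), |C₄ s|
  set D₅ := ∑ s ∈ Finset.range (kp + 1 + 1), |C₅ s|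
  have hD₃ : 0 ≤ D₃ := Finset.sum_nonneg fun _ _ => abs_nonneg _
  have hD₄ : 0 ≤ D₄ := Finset.sum_nonneg fun _ _ => abs_nonneg _
  have hD₅ : 0 ≤ D₅ := Finset.sum_nonneg fun _ _ => abs_nonneg _
  refine ⟨C₁ + C₂ + D₃ + D₄ + D₅, by positivity, ?_⟩
  intro M hS hQ Ω hΩ hcov Ωext hext hsub A hA FA hFA Pd P0 hP
  have hΩA := UnfittedFEM.BackgroundMesh.subset_activeDomain hΩ hcov
  have hopen := UnfittedFEM.BackgroundMesh.isOpen_activeDomain (M := M) Ω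
  have hsize := UnfittedFEM.size_nonneg M
  have lift : ∀ {a b C X : ℝ}, a ≤ C * X → 0 ≤ X → C ≤ b → a ≤ b * X := fun h hX hC =>
    h.trans (mul_le_mul_of_nonneg_right hC hX)
  have nonneg_of : ∀ {a C X : ℝ}, 0 ≤ a → 0 < C → a ≤ C * X → 0 ≤ X := fun ha hC h =>
    (mul_nonneg_iff_of_pos_left hC).mp (ha.trans h)
  have hvec : ∀ s w, 0 ≤ M.size ^ s * UnfittedFEM.vecSobolevNorm Ωext s w := fun s w =>
    mul_nonneg (pow_nonneg hsize s) (UnfittedFEM.vecSobolevNorm_nonneg _ _ _)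
  have hsca : ∀ s w, 0 ≤ M.size ^ s * UnfittedFEM.sobolevNorm Ωext s w := fun s w =>
    mul_nonneg (pow_nonneg hsize s) (UnfittedFEM.sobolevNorm_nonneg _ _)
  have memSob : ∀ {s r}, UnfittedFEM.MemSobolev Ωext s r →
      UnfittedFEM.MemSobolev (M.activeDomain Ω) s r := fun h => h.mono hext hsub
  constructor
  · refine ⟨fun w hw => ?_, fun w hw => ?_, fun r hr => ?_, fun r hr => ?_, fun s hs w hw v hv => ?_,
      fun s hs r hr q hq => ?_, fun a q _ => UnfittedFEM.facePressureForm_const _ _ _ _⟩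
    · exact lift (h₁ M hS hQ Ω hΩA A hA FA hFA w hw.1).1 (sq_nonneg _) (by linarith)
    · have := (h₁ M hS hQ Ω hΩA A hA FA hFA w hw.1).2
      exact lift this (nonneg_of (sq_nonneg _) hC₁ this) (by linarith)
    · exact lift (h₂ M hS hQ Ω hΩA A hA FA hFA r hr).1 (sq_nonneg _) (by linarith)
    · have := (h₂ M hS hQ Ω hΩA A hA FA hFA r hr).2
      exact lift this (nonneg_of (sq_nonneg _) hC₂ this) (by linarith)
    · have hw' : UnfittedFEM.MemVecSobolev (M.activeDomain Ω) s w := fun i => memSob (hw i)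
      have h := h₃ s M hS hQ Ω Ωext hext hsub A hA FA hFA w hw (Pd w) v
        (hP.mem_flux w hw'.memLp).1 hv.1 (hP.approx_flux s hs w hw')
      have hle := UnfittedFEM.le_sum_abs C₃ hs
      rw [mul_assoc (C₃ s), mul_assoc] at h
      rw [mul_assoc (C₁ + C₂ + D₃ + D₄ + D₅), mul_assoc]
      exact lift h (mul_nonneg (hvec s w) (UnfittedFEM.l2norm_nonneg _ _)) (by linarith)
    · have h := h₄ s M hS hQ Ω Ωext hext hsub A hA FA hFA r hr (P0 r)
        (hP.mem_pressure r (memSob hr).1) q hq (hP.approx_pressure s hs r (memSob hr))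
      have hle := UnfittedFEM.le_sum_abs C₄ hs
      rw [mul_assoc (C₄ s), mul_assoc] at h
      rw [mul_assoc (C₁ + C₂ + D₃ + D₄ + D₅), mul_assoc]
      exact lift h (mul_nonneg (hsca s r) (UnfittedFEM.l2norm_nonneg _ _)) (by linarith)
  · intro s hs r hr
    obtain ⟨q, hq, h⟩ := h₅ s hs M hS hQ Ω Ωext hext hsub A hA FA hFA r hr (P0 r)
      (hP.mem_pressure r (memSob hr).1) (hP.approx_pressure s hs r (memSob hr))
    refine ⟨q, hq, ?_⟩
    have hle := UnfittedFEM.le_sum_abs C₅ hs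
    rw [mul_assoc] at h ⊢
    exact lift h (hsca s r) (by linarith)
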